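/- For $d\in\mathbb N$ let $X_d^2=\{0,1,\dots,d\}^2$. A halfplane is a concept $f_{a,b,c}:\mathbb R^2\to\{0,1\}$ with $a,b,c\in\mathbb R$ and $f_{a,b,c}(x,y)=1$ iff $cy\ge ax+b$; CONVEX-$k$-GON is the class of all conjunctions (intersections) of at most $k$ halfplanes. **Theorem.** There are an absolute constant $C>0$, a single randomized algorithm (a program for a random-access machine over the integers with logarithmic cost that can draw uniformly random integers from $\{0,\dots,m\}$), and a polynomial $p$ such that the following holds for all integers $k,d\ge 1$ and $n\ge 0$, and all reals $\alpha\in(0,\tfrac12]$, $\beta\in(0,1)$ with $2\beta\le dk$ (this excludes only $d=k=1$, $\beta>\frac12$), $\varepsilon\in(0,1)$, $\delta\in(0,1/e)$ with $$n\ \ge\ C\cdot\frac{k}{\alpha\varepsilon}\,\log\Big(\frac1\alpha\Big)\,\log\Big(\frac1\delta\Big)\,\log\Big(\frac{dk}{\beta}\log\frac1\alpha\Big).$$ Given a labelled database $S\in(X_d^2\times\{0,1\})^n$ and the parameters $n,d,k,\lceil1/\alpha\rceil,\lceil1/\beta\rceil,\lceil1/\varepsilon\rceil,\lceil1/\delta\rceil$,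 the algorithm $A$ outputs a finite list of integer triples $(a_i,b_i,c_i)$, which represents the hypothesis $h=\bigwedge_i f_{a_i,b_i,c_i}$, and 1. (efficiency) $A$ always halts within time $p(n+\lfloor\log_2 d\rfloor)$; 2. (privacy) $A$ is $(\varepsilon,\delta)$-differentially private: $\Pr[A(S)\in T]\le e^{\varepsilon}\Pr[A(S')\in T]+\delta$ for all databases $S,S'$ of size $n$ that differ on a single entry and every set $T$ of outputs; 3. (learning) $A$ is an $(\alpha,\beta)$-PAC learner for CONVEX-$k$-GON over examples from $X_d^2$: for every probability distribution $D$ on $X_d^2$ and every $c\in$ CONVEX-$k$-GON, if $x_1,\dots,x_n$ are drawn i.i.d. from $D$ and $h$ is the hypothesis that $A$ outputs on $((x_i,c(x_i)))_{i=1}^n$, then $\Pr\big[\Pr_{x\sim D}[h(x)\ne c(x)]>\alpha\big]\le\beta$. -/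

import Mathlib

open MeasureTheory

/-! A randomized random-access machine with logarithmic (bit-length) cost. -/

namespace RAM

/-- The memory: one integer cell for every integer address. -/
abbrev Mem := ℤ → ℤ

/-- Integer expressions; `get e` is the content of the cell whose address is the value of `e`. -/
inductive Expr where
  | lit (z : ℤ)
  | get (e : Expr)
  | add (a b : Expr)
  | sub (a b : Expr)
  | mul (a b : Expr)
  | div (a b : Expr)

/-- Programs: assignment `mem[a] := e`, random assignment `mem[a] := ` a uniformly random element
of `{0, …, e}`, writing `e` to the output, sequencing, branching on `0 < e`, and looping
while `0 < e`. -/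
inductive Prog where
  | skip
  | set (a e : Expr)
  | rand (a e : Expr)
  | emit (e : Expr)
  | seq (p q : Prog)
  | ite (e : Expr) (p q : Prog)
  | loop (e : Expr) (p : Prog)

/-- The bit length of an integer, with its sign. -/
def size (z : ℤ) : ℕ := Nat.size z.natAbs + 1

/-- The value of an expression (integer division with `x / 0 = 0`). -/
def Expr.val (m : Mem) : Expr → ℤ
  | .lit z => z
  | .get e => m (e.val m)
  | .add a b => a.val m + b.val m
  | .sub a b => a.val m - b.val m
  | .mul a b => a.val m * b.val m
  | .div a b => a.val m / b.val m

/-- The cost of evaluating an expression: the sum of the bit lengths of the values of all its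
subexpressions (in particular of all addresses, operands and results). -/
def Expr.cost (m : Mem) : Expr → ℕ
  | .lit z => size z
  | .get e => e.cost m + size (m (e.val m))
  | .add a b => a.cost m + b.cost m + size (a.val m + b.val m)
  | .sub a b => a.cost m + b.cost m + size (a.val m - b.val m)
  | .mul a b => a.cost m + b.cost m + size (a.val m * b.val m)
  | .div a b => a.cost m + b.cost m + size (a.val m / b.val m)

/-- The memory and the output written so far. -/
structure State where
  mem : Mem
  out : List ℤ

/-- The input is stored in the cells `0, 1, 2, …`; all other cells hold `0`; no output yet. -/
def State.init (input : List ℤ) : State where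
  mem := fun j => if 0 ≤ j then input.getD j.toNat 0 else 0
  out := []

def State.write (s : State) (j z : ℤ) : State :=
  { s with mem := Function.update s.mem j z }

/-- An outcome of a computation: the final state with the time spent, or `none` if the bound on
the number of iterations of a loop was exceeded. -/
abbrev Outcome := Option (State × ℕ)

/-- Adds `t` to the time of an outcome. -/
def Outcome.delay (t : ℕ) (o : Outcome) : Outcome := o.map fun r => (r.1, t + r.2)

/-- Runs `g` from the state that an outcome ends in, adding up the times. -/
noncomputable def andThen (μ : PMF Outcome) (g : State → PMF Outcome) : PMF Outcome :=
  μ.bind fun o => match o with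
    | none => PMF.pure none
    | some (s, t) => (g s).map (Outcome.delay t)

/-- Iterates `body` while the value of `e` is positive, for at most `fuel` iterations. Every
evaluation of the test is charged. -/
noncomputable def whileRun (e : Expr) (body : State → PMF Outcome) : ℕ → State → PMF Outcome
  | 0, s => if 0 < e.val s.mem then PMF.pure none else PMF.pure (some (s, e.cost s.mem))
  | fuel + 1, s =>
      if 0 < e.val s.mem then
        (andThen (body s) (whileRun e body fuel)).map (Outcome.delay (e.cost s.mem))
      else PMF.pure (some (s, e.cost s.mem))

/-- The law of the outcome of a program, started in a state, where every loop that is entered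
may be iterated at most `fuel` times. -/
noncomputable def Prog.run (fuel : ℕ) : Prog → State → PMF Outcome
  | .skip, s => PMF.pure (some (s, 1))
  | .set a e, s =>
      PMF.pure (some (s.write (a.val s.mem) (e.val s.mem), a.cost s.mem + e.cost s.mem))
  | .rand a e, s =>
      (PMF.uniformOfFintype (Fin ((e.val s.mem).toNat + 1))).map fun r =>
        some (s.write (a.val s.mem) (r : ℕ), a.cost s.mem + e.cost s.mem)
  | .emit e, s => PMF.pure (some ({ s with out := s.out ++ [e.val s.mem] }, e.cost s.mem))
  | .seq p q, s => andThen (p.run fuel s) (q.run fuel)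
  | .ite e p q, s =>
      (if 0 < e.val s.mem then p.run fuel s else q.run fuel s).map
        (Outcome.delay (e.cost s.mem))
  | .loop e p, s => whileRun e (p.run fuel) fuel s

/-- On the given input, `P` halts within time `T` whatever the outcomes of its random choices,
and `μ` is the law of its output. (Every iteration of a loop takes time at least `1`, so a
computation of time at most `T` is not affected by the bound `T` on the iterations.) -/
def Prog.OutputsWithin (P : Prog) (input : List ℤ) (T : ℕ) (μ : PMF (List ℤ)) : Prop :=
  (∀ o ∈ (P.run T (State.init input)).support, ∃ s t, o = some (s, t) ∧ t ≤ T) ∧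
  μ = (P.run T (State.init input)).map fun o => o.elim [] fun r => r.1.out

end RAM

namespace PrivateLearning

/-- A concept over `X` is a `{0,1}`-valued function; a concept class is a set of concepts. -/
abbrev Concept (X : Type*) := X → Bool

/-- Differential privacy, for databases with `n` entries; neighbouring databases differ on a
single entry. -/
def IsDP {E O : Type*} {n : ℕ} (A : (Fin n → E) → PMF O) (ε δ : ℝ) : Prop :=
  ∀ S S' : Fin n → E, (∃ i, ∀ j, j ≠ i → S j = S' j) → ∀ T : Set O,
    ((A S).toOuterMeasure T).toReal ≤
      Real.exp ε * ((A S').toOuterMeasure T).toReal + δ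

/-- The generalization error `Pr_{x ∼ D}[h x ≠ c x]`. -/
noncomputable def genError {X : Type*} [MeasurableSpace X] (D : Measure X) (c h : Concept X) : ℝ :=
  D.real {x | h x ≠ c x}

/-- The database obtained by labelling the points `x i` with the concept `c`. -/
def labelled {X : Type*} {n : ℕ} (c : Concept X) (x : Fin n → X) : Fin n → X × Bool :=
  fun i => (x i, c (x i))

/-- `A` is an `(α, β)`-PAC learner for the class `C` with sample complexity `n` over a finite
discrete domain, where an output `o` of `A` stands for the hypothesis `hyp o`: the probability,
over `n` i.i.d. examples and the randomness of `A`, of an error greater than `α` is at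
most `β`. -/
def IsPACLearner {X O : Type*} [Finite X] [MeasurableSpace X] [MeasurableSingletonClass X] {n : ℕ}
    (A : (Fin n → X × Bool) → PMF O) (hyp : O → Concept X) (C : Set (Concept X))
    (α β : ℝ) : Prop :=
  ∀ D : Measure X, IsProbabilityMeasure D → ∀ c ∈ C,
    ∫⁻ x : Fin n → X, (A (labelled c x)).toOuterMeasure {o | α < genError D c (hyp o)}
      ∂(Measure.pi fun _ => D) ≤ ENNReal.ofReal β

/-- The conjunctions of at most `k` concepts from `H`. -/
def conjClass {X : Type*} (H : Set (Concept X)) (k : ℕ) : Set (Concept X) :=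
  {f | ∃ l : List (Concept X), l.length ≤ k ∧ (∀ h ∈ l, h ∈ H) ∧ f = fun x => l.all fun h => h x}

open Classical in
/-- The halfplane `c * y ≥ a * x + b`. -/
noncomputable def halfplane (a b c : ℝ) : Concept (ℝ × ℝ) :=
  fun p => decide (c * p.2 ≥ a * p.1 + b)

def halfplanes : Set (Concept (ℝ × ℝ)) := {f | ∃ a b c : ℝ, f = halfplane a b c}

/-- Convex polygons with `k` edges: intersections of (at most) `k` halfplanes. -/
def convexGons (k : ℕ) : Set (Concept (ℝ × ℝ)) := conjClass halfplanes k

/-- The grid `{0, …, d}²`. -/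
abbrev Grid (d : ℕ) := Fin (d + 1) × Fin (d + 1)

def Grid.toPlane {d : ℕ} (p : Grid d) : ℝ × ℝ := (((p.1 : ℕ) : ℝ), ((p.2 : ℕ) : ℝ))

/-- The convex polygons with `k` edges, as concepts over the grid. -/
def gridConvexGons (k d : ℕ) : Set (Concept (Grid d)) :=
  (fun c => fun p : Grid d => c p.toPlane) '' convexGons k

/-- The consecutive triples in a list of integers. -/
def triples : List ℤ → List (ℤ × ℤ × ℤ)
  | a :: b :: c :: l => (a, b, c) :: triples l
  | _ => []

/-- The hypothesis that an output `a₁, b₁, c₁, a₂, b₂, c₂, …` describes: the conjunction of the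
halfplanes `cᵢ * y ≥ aᵢ * x + bᵢ`. -/
noncomputable def gridHypothesis {d : ℕ} (out : List ℤ) : Concept (Grid d) :=
  fun p => (triples out).all fun t => halfplane t.1 t.2.1 t.2.2 p.toPlane

/-- The input of the learner: the parameters, followed by the coordinates and the label of each
example. The machine gets `α, β, ε, δ` rounded to reciprocals of integers. -/
noncomputable def learnerInput {n d : ℕ} (k : ℕ) (α β ε δ : ℝ) (S : Fin n → Grid d × Bool) :
    List ℤ :=
  [(n : ℤ), (d : ℤ), (k : ℤ), ⌈1 / α⌉, ⌈1 / β⌉, ⌈1 / ε⌉, ⌈1 / δ⌉] ++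
    (List.ofFn S).flatMap fun e =>
      [((e.1.1 : ℕ) : ℤ), ((e.1.2 : ℕ) : ℤ), if e.2 then 1 else 0]

/-- The sample size `(k / (α ε)) log (1/α) log (1/δ) log ((d k / β) log (1/α))`. -/
noncomputable def sampleBound (k d : ℕ) (α β ε δ : ℝ) : ℝ :=
  k / (α * ε) * Real.log (1 / α) * Real.log (1 / δ) * Real.log (d * k / β * Real.log (1 / α))

end PrivateLearning

/-!
The learner is a greedy set cover in which every choice is made by the exponential mechanism. A target
polygon is an intersection of `k` halfplanes, so one of these cuts off a fraction `1 / k` of the negative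
examples that remain, and no positive example. In each of `T = O(k * log (1 / α))` rounds the learner
scores a halfplane by the number of the remaining negative examples that it cuts off, capped at `θ t`,
minus the number of positive ones, selects one with probability proportional to
`((N + 1) / N) ^ score`, or none, which has the fixed score `θ t - gap`, and discards the examples that the
selected halfplane cuts off. The output is the list of the selected halfplanes.

*Privacy.* The total privacy loss does not grow with the number of rounds (`Greedy.pr_le`). A given example
influences the law of a round only through the candidates that cut it off, and once such a candidate is
selected the example is gone. If `p` is the probability that the round cuts the example off, then the
total weights in two neighbouring runs differ by a factor of at most `exp (p / N)`. So the loss is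
governed by the sum of these probabilities along the run, and the event that this sum exceeds `L` while
the example is still present has probability at most `exp (-L)`. With `L = log (3 / δ)` and
`N` of order `log (1 / δ) / ε` this gives `(ε, δ)`-privacy.

*Learning.* On the grid every halfplane agrees with one of polynomially many candidates `(a, b, c)` with
`c = ± 2 * d ^ 2` and bounded integers `a`, `b` (`Params.exists_candidate`). A pigeonhole argument
(`Params.exists_good`) shows that as long as many negative examples remain, a candidate attains the full score
`θ t`; hence with high probability every round removes about `θ t` negative examples and at most `2 * gap`
positive ones, or few negative examples remain anyway (`Params.inv_step`). The number of remaining negative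
examples is halved in every phase of `2 * k` rounds, and the empirical error in the end is at most
`3 * α / 16` (`Params.error_le`). A union bound over all lists of candidates (`measure_small_error_le`,
`Params.algorithm_learns`) bounds the error.

*Running time.* The number of candidates is polynomial in `d`, not in `log d`, so the candidates cannot be
enumerated. For a fixed slope, the weight as a function of the intercept is constant between the at most `n`
values at which the candidate starts to cut off another example. The sum of these weights over all
intercepts depends on the slope, and it is an affine function of it as long as the order of these values
does not change (`sum_cut_affine`), thus between `n ^ 2` break points. In an interval of `m` slopes, the total
weights of a slope and of its mirror image add up to a constant `S`, so that a uniform number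
below `m * S` can be decoded into a candidate by one division (`pickPair`). This finds every candidate of weight
`x` at exactly `2 * x` of the positions, and therefore a uniform position follows the law of the
exponential mechanism exactly (`Params.map_pick_eq_sel`). All weights are scaled to integers of polynomially
many bits.

The program is verified in a Hoare logic for deterministic programs with time bounds (`Tri`), and `Computes`
deals with the random choices.
-/

namespace RAM

/-! ### Reasoning about deterministic programs -/

instance : Add Expr := ⟨Expr.add⟩
instance : Sub Expr := ⟨Expr.sub⟩
instance : Mul Expr := ⟨Expr.mul⟩
instance : Div Expr := ⟨Expr.div⟩

/-- The content of the cell with the fixed address `a`. -/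
def reg (a : ℤ) : Expr := .get (.lit a)

/-- Assignment to the cell with the fixed address `a`. -/
def asg (a : ℤ) (e : Expr) : Prog := .set (.lit a) e

infixr:60 " ;; " => Prog.seq

section Val
variable (m : Mem) (a b : Expr) (z : ℤ)
@[simp] theorem val_lit : (Expr.lit z).val m = z := rfl
@[simp] theorem val_get : (Expr.get a).val m = m (a.val m) := rfl
@[simp] theorem val_reg : (reg z).val m = m z := rfl
@[simp] theorem val_add : (a + b).val m = a.val m + b.val m := rfl
@[simp] theorem val_sub : (a - b).val m = a.val m - b.val m := rfl
@[simp] theorem val_mul : (a * b).val m = a.val m * b.val m := rfl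
@[simp] theorem val_div : (a / b).val m = a.val m / b.val m := rfl
end Val

@[simp] theorem write_mem (s : State) (j z i : ℤ) :
    (s.write j z).mem i = if i = j then z else s.mem i := by
  simp [State.write, Function.update_apply]

@[simp] theorem write_out (s : State) (j z : ℤ) : (s.write j z).out = s.out := rfl

theorem size_le_iff {z : ℤ} {w : ℕ} : size z ≤ w + 1 ↔ |z| < 2 ^ w := by
  unfold size
  rw [Nat.add_le_add_iff_right, Nat.size_le, Int.abs_eq_natAbs]
  exact_mod_cast Iff.rfl

theorem one_le_size (z : ℤ) : 1 ≤ size z := by unfold size; omega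

theorem size_add_le (a b : ℤ) : size (a + b) ≤ size a + size b := by
  have ha := one_le_size a
  have hb := one_le_size b
  obtain ⟨x, hx⟩ : ∃ x, size a = x + 1 := ⟨size a - 1, by omega⟩
  obtain ⟨y, hy⟩ : ∃ y, size b = y + 1 := ⟨size b - 1, by omega⟩
  have h1 := size_le_iff.1 hx.le
  have h2 := size_le_iff.1 hy.le
  have : size a + size b = (x + y + 1) + 1 := by omega
  rw [this, size_le_iff]
  have h3 : (2:ℤ) ^ x ≤ 2 ^ (x + y) := pow_le_pow_right₀ (by norm_num) (by omega)
  have h4 : (2:ℤ) ^ y ≤ 2 ^ (x + y) := pow_le_pow_right₀ (by norm_num) (by omega)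
  have := abs_add_le a b
  rw [pow_succ]; linarith

theorem size_neg (a : ℤ) : size (-a) = size a := by simp [size]

theorem size_sub_le (a b : ℤ) : size (a - b) ≤ size a + size b := by
  rw [sub_eq_add_neg, ← size_neg b]; exact size_add_le a (-b)

theorem size_mul_le (a b : ℤ) : size (a * b) ≤ size a + size b := by
  have ha := one_le_size a
  have hb := one_le_size b
  obtain ⟨x, hx⟩ : ∃ x, size a = x + 1 := ⟨size a - 1, by omega⟩
  obtain ⟨y, hy⟩ : ∃ y, size b = y + 1 := ⟨size b - 1, by omega⟩
  have h1 := size_le_iff.1 hx.le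
  have h2 := size_le_iff.1 hy.le
  have h5 : size (a * b) ≤ (x + y) + 1 := by
    rw [size_le_iff, abs_mul, pow_add]
    exact mul_lt_mul'' h1 h2 (abs_nonneg _) (abs_nonneg _)
  omega

theorem size_div_le (a b : ℤ) : size (a / b) ≤ size a + size b := by
  have : size (a / b) ≤ size a := by
    unfold size
    have := Nat.size_le_size (Int.natAbs_ediv_le_natAbs a b)
    omega
  omega

/-- The number of nodes of an expression. -/
def Expr.nodes : Expr → ℕ
  | .lit _ => 1
  | .get e => e.nodes + 1
  | .add a b => a.nodes + b.nodes + 1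
  | .sub a b => a.nodes + b.nodes + 1
  | .mul a b => a.nodes + b.nodes + 1
  | .div a b => a.nodes + b.nodes + 1

/-- All constants in the expression have absolute value less than `128`. -/
def Expr.small : Expr → Bool
  | .lit z => z.natAbs < 128
  | .get e => e.small
  | .add a b => a.small && b.small
  | .sub a b => a.small && b.small
  | .mul a b => a.small && b.small
  | .div a b => a.small && b.small

/-- All cells hold integers with at most `w` bits. -/
def Bdd (w : ℕ) (m : Mem) : Prop := ∀ j, |m j| < 2 ^ w

theorem Expr.one_le_nodes (e : Expr) : 1 ≤ e.nodes := by cases e <;> simp [nodes]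

/-- The four operations are subadditive in bit length. -/
theorem Expr.size_val_le {w : ℕ} {m : Mem} (hw : 7 ≤ w) (hm : Bdd w m) :
    ∀ e : Expr, e.small = true → size (e.val m) ≤ e.nodes * (w + 1)
  | .lit z, h => by
      simp only [Expr.small, decide_eq_true_eq] at h
      simp only [val_lit, nodes, one_mul]
      rw [size_le_iff, Int.abs_eq_natAbs]
      have : 2 ^ 7 ≤ 2 ^ w := Nat.pow_le_pow_right (by norm_num) hw
      have : z.natAbs < 2 ^ w := by omega
      exact_mod_cast this
  | .get e, h => by
      have := size_le_iff.2 (hm (e.val m))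
      simp only [val_get, nodes]
      nlinarith
  | .add a b, h => by
      simp only [Expr.small, Bool.and_eq_true] at h
      have h1 := a.size_val_le hw hm h.1
      have h2 := b.size_val_le hw hm h.2
      have := size_add_le (a.val m) (b.val m)
      simp only [nodes, Expr.val]
      nlinarith
  | .sub a b, h => by
      simp only [Expr.small, Bool.and_eq_true] at h
      have h1 := a.size_val_le hw hm h.1
      have h2 := b.size_val_le hw hm h.2
      have := size_sub_le (a.val m) (b.val m)
      simp only [nodes, Expr.val]
      nlinarith
  | .mul a b, h => by
      simp only [Expr.small, Bool.and_eq_true] at h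
      have h1 := a.size_val_le hw hm h.1
      have h2 := b.size_val_le hw hm h.2
      have := size_mul_le (a.val m) (b.val m)
      simp only [nodes, Expr.val]
      nlinarith
  | .div a b, h => by
      simp only [Expr.small, Bool.and_eq_true] at h
      have h1 := a.size_val_le hw hm h.1
      have h2 := b.size_val_le hw hm h.2
      have := size_div_le (a.val m) (b.val m)
      simp only [nodes, Expr.val]
      nlinarith

/-- By `Expr.size_val_le`, every node costs at most the size of its subtree times the word length. -/
theorem Expr.cost_le {w : ℕ} {m : Mem} (hw : 7 ≤ w) (hm : Bdd w m) :
    ∀ e : Expr, e.small = true → e.cost m ≤ e.nodes ^ 2 * (w + 1)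
  | .lit z, h => by simpa [nodes, Expr.cost] using Expr.size_val_le hw hm (.lit z) h
  | .get e, h => by
      have h1 := e.cost_le hw hm h
      have h2 := Expr.size_val_le hw hm (.get e) h
      simp only [nodes, Expr.cost, Expr.val] at *
      nlinarith [e.one_le_nodes]
  | .add a b, h => by
      have h2 := Expr.size_val_le hw hm (.add a b) h
      simp only [Expr.small, Bool.and_eq_true] at h
      have h3 := a.cost_le hw hm h.1
      have h4 := b.cost_le hw hm h.2
      have := Nat.zero_le (a.nodes * b.nodes * (w + 1))
      simp only [nodes, Expr.cost, Expr.val] at *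
      nlinarith
  | .sub a b, h => by
      have h2 := Expr.size_val_le hw hm (.sub a b) h
      simp only [Expr.small, Bool.and_eq_true] at h
      have h3 := a.cost_le hw hm h.1
      have h4 := b.cost_le hw hm h.2
      have := Nat.zero_le (a.nodes * b.nodes * (w + 1))
      simp only [nodes, Expr.cost, Expr.val] at *
      nlinarith
  | .mul a b, h => by
      have h2 := Expr.size_val_le hw hm (.mul a b) h
      simp only [Expr.small, Bool.and_eq_true] at h
      have h3 := a.cost_le hw hm h.1
      have h4 := b.cost_le hw hm h.2
      have := Nat.zero_le (a.nodes * b.nodes * (w + 1))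
      simp only [nodes, Expr.cost, Expr.val] at *
      nlinarith
  | .div a b, h => by
      have h2 := Expr.size_val_le hw hm (.div a b) h
      simp only [Expr.small, Bool.and_eq_true] at h
      have h3 := a.cost_le hw hm h.1
      have h4 := b.cost_le hw hm h.2
      have := Nat.zero_le (a.nodes * b.nodes * (w + 1))
      simp only [nodes, Expr.cost, Expr.val] at *
      nlinarith

theorem Expr.one_le_cost (e : Expr) (m : Mem) : 1 ≤ e.cost m := by
  cases e <;> simp only [Expr.cost] <;> have := one_le_size <;>
    first
    | exact this _
    | exact (this _).trans (Nat.le_add_left _ _)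

/-- Total correctness with a time bound: whenever the fuel `F` is at least `c`, the program `p`
started in `s` makes no random choice and halts within time `c` in a state that satisfies `Q`. -/
def Tri (F : ℕ) (p : Prog) (s : State) (c : ℕ) (Q : State → Prop) : Prop :=
  c ≤ F → ∃ s' t, p.run F s = PMF.pure (some (s', t)) ∧ t ≤ c ∧ Q s'

variable {F : ℕ}

theorem Tri.mono {p : Prog} {s : State} {c c' : ℕ} {Q Q' : State → Prop} (h : Tri F p s c Q)
    (hc : c ≤ c') (hQ : ∀ s', Q s' → Q' s') : Tri F p s c' Q' := fun hF => by
  obtain ⟨s', t, h1, h2, h3⟩ := h (hc.trans hF)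
  exact ⟨s', t, h1, h2.trans hc, hQ _ h3⟩

theorem andThen_pure (s : State) (t : ℕ) (g : State → PMF Outcome) :
    andThen (PMF.pure (some (s, t))) g = (g s).map (Outcome.delay t) := by
  simp [andThen, PMF.pure_bind]

theorem Tri.seq {p q : Prog} {s : State} {c₁ c₂ : ℕ} {R Q : State → Prop} (h₁ : Tri F p s c₁ R)
    (h₂ : ∀ s', R s' → Tri F q s' c₂ Q) : Tri F (p ;; q) s (c₁ + c₂) Q := fun hF => by
  obtain ⟨s', t, e1, ht, hR⟩ := h₁ (by omega)
  obtain ⟨s'', t', e2, ht', hQ⟩ := h₂ s' hR (by omega)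
  refine ⟨s'', t + t', ?_, by omega, hQ⟩
  simp [Prog.run, e1, andThen_pure, e2, PMF.pure_map, Outcome.delay]

theorem Tri.ite {e : Expr} {p q : Prog} {s : State} {g c : ℕ} {Q : State → Prop}
    (hg : e.cost s.mem ≤ g)
    (h₁ : 0 < e.val s.mem → Tri F p s c Q) (h₂ : ¬ 0 < e.val s.mem → Tri F q s c Q) :
    Tri F (.ite e p q) s (g + c) Q := fun hF => by
  by_cases h : 0 < e.val s.mem
  · obtain ⟨s', t, e1, ht, hR⟩ := h₁ h (by omega)
    exact ⟨s', e.cost s.mem + t, by simp [Prog.run, h, e1, PMF.pure_map, Outcome.delay],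
      by omega, hR⟩
  · obtain ⟨s', t, e1, ht, hR⟩ := h₂ h (by omega)
    exact ⟨s', e.cost s.mem + t, by simp [Prog.run, h, e1, PMF.pure_map, Outcome.delay],
      by omega, hR⟩

/-- The rule for loops, with an invariant that carries a bound on the number of iterations. -/
theorem Tri.loop {e : Expr} {p : Prog} {g c : ℕ} {Q : State → Prop} (I : ℕ → State → Prop)
    (hg : ∀ v s, I v s → e.cost s.mem ≤ g)
    (hstep : ∀ v s, I v s → 0 < e.val s.mem → 0 < v ∧ Tri F p s c (I (v - 1)))
    (hend : ∀ v s, I v s → ¬ 0 < e.val s.mem → Q s) {v : ℕ} {s : State} (h : I v s) :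
    Tri F (.loop e p) s (v * (g + c) + g) Q := fun hF => by
  suffices H : ∀ (f v : ℕ) (s : State), I v s → v ≤ f → v * (g + c) + g ≤ F →
      ∃ s' t, whileRun e (p.run F) f s = PMF.pure (some (s', t)) ∧ t ≤ v * (g + c) + g ∧ Q s' by
    have hg1 : 1 ≤ g := (e.one_le_cost s.mem).trans (hg v s h)
    exact H F v s h (by nlinarith) hF
  intro f
  induction f with
  | zero =>
    intro v s h hv hF
    have h0 : ¬ 0 < e.val s.mem := fun h' => by have := (hstep v s h h').1; omega
    exact ⟨s, e.cost s.mem, by simp [whileRun, h0], (hg v s h).trans (by omega), hend v s h h0⟩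
  | succ f ih =>
    intro v s h hv hF
    by_cases h0 : 0 < e.val s.mem
    · obtain ⟨hv0, hT⟩ := hstep v s h h0
      obtain ⟨v, rfl⟩ : ∃ v', v = v' + 1 := ⟨v - 1, by omega⟩
      have hexp : (v + 1) * (g + c) + g = (v * (g + c) + g) + (g + c) := by ring
      obtain ⟨s', t, e1, ht, hI⟩ := hT (by omega)
      obtain ⟨s'', t', e2, ht', hQ⟩ := ih v s' hI (by omega) (by omega)
      refine ⟨s'', e.cost s.mem + (t + t'), ?_, ?_, hQ⟩
      · simp [whileRun, h0, e1, andThen_pure, e2, PMF.pure_map, Outcome.delay]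
      · have := hg _ s h
        omega
    · exact ⟨s, e.cost s.mem, by simp [whileRun, h0], (hg v s h).trans (by omega),
        hend v s h h0⟩

/-- The bound, in units of the word length, on the cost of a program without loops. -/
def Prog.cst : Prog → ℕ
  | .skip => 1
  | .set a e => a.nodes ^ 2 + e.nodes ^ 2
  | .rand _ _ => 0
  | .emit e => e.nodes ^ 2
  | .seq p q => p.cst + q.cst
  | .ite e p q => e.nodes ^ 2 + max p.cst q.cst
  | .loop _ _ => 0

/-- The program contains no loop, no random assignment, and no constant beyond `127`. -/
def Prog.straight : Prog → Bool
  | .skip => true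
  | .set a e => a.small && e.small
  | .rand _ _ => false
  | .emit e => e.small
  | .seq p q => p.straight && q.straight
  | .ite e p q => e.small && p.straight && q.straight
  | .loop _ _ => false

/-- The weakest precondition of a program without loops, including that every value that it
stores has at most `w` bits. -/
def Prog.wp (w : ℕ) : Prog → (State → Prop) → State → Prop
  | .skip, Q, s => Q s
  | .set a e, Q, s => |e.val s.mem| < 2 ^ w ∧ Q (s.write (a.val s.mem) (e.val s.mem))
  | .rand _ _, _, _ => False
  | .emit e, Q, s => Q { s with out := s.out ++ [e.val s.mem] }
  | .seq p q, Q, s => p.wp w (q.wp w Q) s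
  | .ite e p q, Q, s => (0 < e.val s.mem → p.wp w Q s) ∧ (¬ 0 < e.val s.mem → q.wp w Q s)
  | .loop _ _, _, _ => False

theorem Bdd.write {w : ℕ} {s : State} (h : Bdd w s.mem) {j z : ℤ} (hz : |z| < 2 ^ w) :
    Bdd w (s.write j z).mem := fun i => by
  rw [write_mem]; split_ifs
  · exact hz
  · exact h i

/-- A program without loops satisfies its weakest precondition, in time proportional to the word
length, and keeps the memory within the word length. -/
theorem Tri.of_wp {w : ℕ} (hw : 7 ≤ w) : ∀ (p : Prog) (Q : State → Prop) (s : State),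
    p.straight = true → Bdd w s.mem → p.wp w Q s →
    Tri F p s (p.cst * (w + 1)) (fun s' => Q s' ∧ Bdd w s'.mem)
  | .skip, Q, s, _, hB, h => fun _ => ⟨s, 1, rfl, by simp [Prog.cst], h, hB⟩
  | .set a e, Q, s, hs, hB, h => fun _ => by
      simp only [Prog.straight, Bool.and_eq_true] at hs
      refine ⟨_, _, rfl, ?_, h.2, hB.write h.1⟩
      have h1 := a.cost_le hw hB hs.1
      have h2 := e.cost_le hw hB hs.2
      rw [Prog.cst, add_mul]; omega
  | .emit e, Q, s, hs, hB, h => fun _ =>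
      ⟨_, _, rfl, e.cost_le hw hB hs, h, hB⟩
  | .seq p q, Q, s, hs, hB, h => by
      simp only [Prog.straight, Bool.and_eq_true] at hs
      rw [Prog.cst, add_mul]
      exact (Tri.of_wp hw p _ s hs.1 hB h).seq fun s' h' => Tri.of_wp hw q Q s' hs.2 h'.2 h'.1
  | .ite e p q, Q, s, hs, hB, h => by
      simp only [Prog.straight, Bool.and_eq_true] at hs
      rw [Prog.cst, add_mul]
      refine Tri.ite (e.cost_le hw hB hs.1.1) (fun h0 => ?_) (fun h0 => ?_)
      · exact (Tri.of_wp hw p Q s hs.1.2 hB (h.1 h0)).mono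
          (Nat.mul_le_mul_right _ (le_max_left _ _)) fun _ => id
      · exact (Tri.of_wp hw q Q s hs.2 hB (h.2 h0)).mono
          (Nat.mul_le_mul_right _ (le_max_right _ _)) fun _ => id

/-- `Tri.of_wp` with a rounded time bound. -/
theorem Tri.block {w C : ℕ} {p : Prog} {Q : State → Prop} {s : State} (hw : 7 ≤ w)
    (hs : p.straight = true) (hC : p.cst ≤ C) (hB : Bdd w s.mem) (h : p.wp w Q s) :
    Tri F p s (C * (w + 1)) (fun s' => Q s' ∧ Bdd w s'.mem) :=
  (Tri.of_wp hw p Q s hs hB h).mono (Nat.mul_le_mul_right _ hC) fun _ => id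

/-- The cells above the address `a` are the same in both memories. -/
def Same (a : ℤ) (m m' : Mem) : Prop := ∀ j, a < j → m' j = m j

theorem Same.refl (a : ℤ) (m : Mem) : Same a m m := fun _ _ => rfl

theorem Same.trans {a : ℤ} {m m' m'' : Mem} (h : Same a m m') (h' : Same a m' m'') :
    Same a m m'' := fun j hj => (h' j hj).trans (h j hj)

theorem Same.mono {a b : ℤ} {m m' : Mem} (h : Same a m m') (hab : a ≤ b) : Same b m m' :=
  fun j hj => h j (by omega)

open RAM.Expr

/-! ### The weights of the candidates with a fixed slope -/

/-!
The input occupies the cells with nonnegative addresses; the label in the cell `9 + 3 * i` is replaced by `2`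
when the example `i` is eliminated. The negative addresses serve as registers. Those from `-1` to `-9`
hold `N`, `M`, `Am`, `Bm`, `gap`, `T`, the number of the round, `θ`, and twice the weight of choosing
no candidate; `-10` and `-11` are scratch. A pass through the candidates uses only registers from `-19`
downwards: the sign of `c` in `-19`, the position in `-20`, the result in `-21` (found), `-22` (`A`), `-24`
(`B`), `-23` (`c`), an interval of slopes and its weight in `-25` to `-28`, a walk through the thresholds of the slope `-30` in
`-31` to `-34`, a scan of the examples in `-40` to `-46`, and the search for the next break point in
`-50` to `-53`. The parts of such a pass leave all registers above their own unchanged, which is what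
`Same` expresses.
-/

/-- Reads the label and the key of example `mem[-40]`. -/
def scanLoad : Prog :=
  asg (-45) (get (lit 9 + lit 3 * reg (-40))) ;;
  asg (-44) (reg (-19) * reg (-2) * get (lit 8 + lit 3 * reg (-40)) -
    reg (-30) * get (lit 7 + lit 3 * reg (-40))) ;;
  asg (-46) (reg (-1) * (reg (-1) + lit 1))

/-- Finds the factor `mem[-46]` that the example contributes to the weight. -/
def scanCase : Prog :=
  .ite (reg (-33) - reg (-44))
    (.ite (lit 1 - reg (-45))
      (.ite (reg (-43))
        (asg (-43) (reg (-43) - lit 1) ;; asg (-46) ((reg (-1) + lit 1) * (reg (-1) + lit 1)))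
        .skip)
      (.ite (lit 2 - reg (-45)) (asg (-46) (reg (-1) * reg (-1))) .skip))
    (.ite (reg (-41) - (reg (-44) + lit 1)) (asg (-41) (reg (-44) + lit 1)) .skip)

/-- One step of the scan. -/
def scanBody : Prog :=
  scanLoad ;; scanCase ;; asg (-42) (reg (-42) * reg (-46)) ;; asg (-40) (reg (-40) + lit 1)

/-- For the slope `mem[-30]`, the sign `mem[-19]` and the threshold `mem[-33]`: computes the weight
of the candidate and the next threshold at which it may change. -/
def scan : Prog :=
  (asg (-40) (lit 0) ;; asg (-41) (reg (-4)) ;; asg (-42) (lit 1) ;; asg (-43) (reg (-8))) ;;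
  .loop (reg 0 - reg (-40)) scanBody

/-- The part of the reward cap `θ` that is left and the weight, after the first examples, where
`P i` is `1` if example `i` is an eliminated negative one and `2` if it is an eliminated
positive one. -/
def weightRec (N θ : ℕ) (P : ℕ → ℕ) : ℕ → ℕ × ℕ
  | 0 => (θ, 1)
  | i + 1 =>
      let q := weightRec N θ P i
      if P i = 1 then
        if 0 < q.1 then (q.1 - 1, q.2 * ((N + 1) * (N + 1))) else (q.1, q.2 * (N * (N + 1)))
      else if P i = 2 then (q.1, q.2 * (N * N)) else (q.1, q.2 * (N * (N + 1)))

/-- The data of a search for a candidate halfplane `(A, B, c)`, that is `c * y ≥ A * x + B`. The `n` examples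
are `(X i, Y i)`, with the state `L i`: `0` for a remaining negative example, `1` for a remaining
positive one, `2` for an eliminated one. The weight of a candidate is, up to scaling, a power of
`(N + 1) / N`, and `θ` is the cap on the reward. The candidates have `c = M` or `c = -M`, slopes `A` in
`[-Am, Am)` and intercepts `B` in `[-Bm, Bm)`. -/
structure Data where
  n : ℕ
  N : ℕ
  θ : ℕ
  M : ℤ
  Am : ℤ
  Bm : ℤ
  X : ℕ → ℤ
  Y : ℕ → ℤ
  L : ℕ → ℕ

namespace Data
variable (D : Data)

/-- The least intercept at which the candidate with slope `A` and factor `c` eliminates the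
example `i` is one more than its key. -/
def key (c A : ℤ) (i : ℕ) : ℤ := c * D.Y i - A * D.X i

/-- What the candidate `(A, B, c)` does to example `i`: `1` if it eliminates a negative example, `2` if it
eliminates a positive one, `0` if nothing. -/
def pat (c A B : ℤ) (i : ℕ) : ℕ := if D.key c A i < B ∧ D.L i ≤ 1 then D.L i + 1 else 0

/-- The weight of the candidate `(A, B, c)`. -/
def wt (c A B : ℤ) : ℕ := (weightRec D.N D.θ (D.pat c A B) D.n).2

/-- The least break point after `B`, among those of the first examples and the end `Bm`. -/
def nextB (c A B : ℤ) : ℕ → ℤ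
  | 0 => D.Bm
  | i + 1 => if D.key c A i < B then nextB c A B i else min (nextB c A B i) (D.key c A i + 1)

/-- The memory holds the examples and the parameters of the search. -/
structure Holds (m : Mem) : Prop where
  n : m 0 = D.n
  N : m (-1) = D.N
  M : m (-2) = D.M
  Am : m (-3) = D.Am
  Bm : m (-4) = D.Bm
  θ : m (-8) = D.θ
  X : ∀ i < D.n, m (7 + 3 * (i : ℤ)) = D.X i
  Y : ∀ i < D.n, m (8 + 3 * (i : ℤ)) = D.Y i
  L : ∀ i < D.n, m (9 + 3 * (i : ℤ)) = D.L i

variable {D}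

theorem Holds.same {m m' : Mem} (h : D.Holds m) (a : ℤ) (hs : Same a m m') (ha : a < -8) :
    D.Holds m' where
  n := (hs _ (by omega)).trans h.n
  N := (hs _ (by omega)).trans h.N
  M := (hs _ (by omega)).trans h.M
  Am := (hs _ (by omega)).trans h.Am
  Bm := (hs _ (by omega)).trans h.Bm
  θ := (hs _ (by omega)).trans h.θ
  X i hi := (hs _ (by omega)).trans (h.X i hi)
  Y i hi := (hs _ (by omega)).trans (h.Y i hi)
  L i hi := (hs _ (by omega)).trans (h.L i hi)

variable (D)

/-- The parameters are in range, and all numbers that occur in the search have at most `w`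
bits. -/
structure Fits (w : ℕ) : Prop where
  w7 : 7 ≤ w
  n1 : 1 ≤ D.n
  N1 : 1 ≤ D.N
  L2 : ∀ i < D.n, D.L i ≤ 2
  nn : (D.n : ℤ) * D.n < 2 ^ w
  Am1 : 1 ≤ D.Am
  key_lt : ∀ sg : ℤ, |sg| = 1 → ∀ A, -D.Am ≤ A → A < D.Am → ∀ i < D.n, |D.key (sg * D.M) A i| < D.Bm
  big : 64 * D.Am * D.Bm * ((D.N + 1) * (D.N + 1)) ^ D.n < 2 ^ w

variable {D}

theorem weightRec_le (N θ : ℕ) (P : ℕ → ℕ) (i : ℕ) :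
    (weightRec N θ P i).2 ≤ ((N + 1) * (N + 1)) ^ i := by
  induction i with
  | zero => simp [weightRec]
  | succ i ih =>
    rw [pow_succ]
    simp only [weightRec]
    split_ifs <;> exact Nat.mul_le_mul ih (by nlinarith)

theorem weightRec_pos {N : ℕ} (hN : 1 ≤ N) (θ : ℕ) (P : ℕ → ℕ) (i : ℕ) :
    0 < (weightRec N θ P i).2 := by
  induction i with
  | zero => simp [weightRec]
  | succ i ih =>
    simp only [weightRec]
    split_ifs <;> positivity

theorem weightRec_fst_le (N θ : ℕ) (P : ℕ → ℕ) (i : ℕ) : (weightRec N θ P i).1 ≤ θ := by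
  induction i with
  | zero => simp [weightRec]
  | succ i ih =>
    simp only [weightRec]
    split_ifs <;> omega

/-- The state of the registers in the scan, before example `i`. -/
structure ScanInv (D : Data) (w : ℕ) (sg A b : ℤ) (m₀ : Mem) (i : ℕ) (s : State) : Prop where
  bdd : Bdd w s.mem
  same : Same (-40) m₀ s.mem
  idx : s.mem (-40) = i
  nb : s.mem (-41) = D.nextB (sg * D.M) A b i
  wt : s.mem (-42) = (weightRec D.N D.θ (D.pat (sg * D.M) A b) i).2
  rem : s.mem (-43) = (weightRec D.N D.θ (D.pat (sg * D.M) A b) i).1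
  le : i ≤ D.n

theorem Fits.consts {w : ℕ} (hF : D.Fits w) : D.Am < 2 ^ w ∧ 4 * D.Bm < 2 ^ w ∧ 1 ≤ D.Bm ∧
    ∀ i ≤ D.n, ((D.N + 1) * (D.N + 1)) ^ i < 2 ^ w := by
  have hk := hF.key_lt 1 rfl 0 (by have := hF.Am1; omega) (by have := hF.Am1; omega) 0 hF.n1
  have hB : 1 ≤ D.Bm := by have := abs_nonneg (D.key (1 * D.M) 0 0); omega
  have hA := hF.Am1
  have hb := hF.big
  have hw : (1:ℤ) ≤ ((D.N + 1) * (D.N + 1) : ℤ) ^ D.n := one_le_pow₀ (by nlinarith)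
  set W := ((D.N + 1) * (D.N + 1) : ℤ) ^ D.n
  have h1 : 1 * 1 ≤ D.Am * D.Bm := mul_le_mul hA hB (by norm_num) (by omega)
  have h3 : 64 * (D.Am * D.Bm) * 1 ≤ 64 * (D.Am * D.Bm) * W := by gcongr
  have h4 : 64 * 1 * W ≤ 64 * (D.Am * D.Bm) * W := by gcongr; omega
  have h5 : D.Am * 1 ≤ D.Am * D.Bm := by gcongr
  have h6 : 1 * D.Bm ≤ D.Am * D.Bm := by gcongr
  rw [mul_assoc 64] at hb
  refine ⟨by linarith, by linarith, hB, fun i hi => ?_⟩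
  have : ((D.N + 1) * (D.N + 1)) ^ i ≤ ((D.N + 1) * (D.N + 1)) ^ D.n :=
    Nat.pow_le_pow_right (by positivity) hi
  have : (((D.N + 1) * (D.N + 1)) ^ i : ℤ) ≤ W := by simp only [W]; exact_mod_cast this
  have : (((D.N + 1) * (D.N + 1)) ^ i : ℤ) < 2 ^ w := by linarith
  exact_mod_cast this

theorem scanBody_spec {F w : ℕ} (hF : D.Fits w) {sg A b : ℤ} {m₀ : Mem} (hsg : |sg| = 1)
    (hA : -D.Am ≤ A) (hA' : A < D.Am) (hH : D.Holds m₀) (h19 : m₀ (-19) = sg) (h30 : m₀ (-30) = A)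
    (h33 : m₀ (-33) = b) {i : ℕ} {s : State} (h : ScanInv D w sg A b m₀ i s) (hi : i < D.n) :
    Tri F scanBody s (2000 * (w + 1)) (ScanInv D w sg A b m₀ (i + 1)) := by
  have hH' := hH.same _ h.same (by norm_num)
  have e19 : s.mem (-19) = sg := (h.same _ (by norm_num)).trans h19
  have e30 : s.mem (-30) = A := (h.same _ (by norm_num)).trans h30
  have e33 : s.mem (-33) = b := (h.same _ (by norm_num)).trans h33
  obtain ⟨-, c2, c3, c4⟩ := hF.consts
  have hL := hF.L2 i hi
  have hk := abs_lt.1 (hF.key_lt sg hsg A hA hA' i hi)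
  have hN : ((D.N : ℤ) + 1) * (D.N + 1) < 2 ^ w := by
    have := c4 1 hF.n1
    rw [pow_one] at this
    exact_mod_cast this
  have hP : (128 : ℤ) ≤ 2 ^ w := by
    calc (128:ℤ) = 2 ^ 7 := by norm_num
      _ ≤ 2 ^ w := pow_le_pow_right₀ (by norm_num) hF.w7
  have hf : (D.N : ℤ) * (D.N + 1) ≤ (D.N + 1) * (D.N + 1) := by nlinarith
  have hf2 : (D.N : ℤ) * D.N ≤ (D.N + 1) * (D.N + 1) := by nlinarith
  have hr := weightRec_fst_le D.N D.θ (D.pat (sg * D.M) A b) i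
  have hθ : (D.θ : ℤ) < 2 ^ w := by
    have := h.bdd (-8)
    rw [hH'.θ] at this
    simpa using this
  have n7 : ((7 + 3 * (i:ℤ)) = -45) = False := by simp; omega
  have n8 : ((8 + 3 * (i:ℤ)) = -45) = False := by simp; omega
  have hkd : sg * D.M * D.Y i - A * D.X i = D.key (sg * D.M) A i := rfl
  -- after `scanLoad`, the label, the key and the factor of an unaffected example are in registers
  refine (Tri.seq (c₁ := 1000 * (w + 1)) (c₂ := 1000 * (w + 1)) (Tri.block (Q := fun s' =>
    s'.mem (-45) = D.L i ∧ s'.mem (-44) = D.key (sg * D.M) A i ∧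
    s'.mem (-46) = (D.N : ℤ) * (D.N + 1) ∧ (∀ j, -44 < j → s'.mem j = s.mem j))
    hF.w7 (by rfl) (by decide) h.bdd ?_) fun s₁ h₁ => ?_).mono (by omega) fun _ => id
  · simp only [scanLoad, asg, Prog.wp, val_lit, val_get, val_reg, val_add, val_sub, val_mul,
      write_mem, h.idx, e19, e30, hH'.M, hH'.N]
    simp only [Int.reduceNeg, Int.reduceEq, ↓reduceIte, n7, n8,
      hH'.X i hi, hH'.Y i hi, hH'.L i hi, hkd]
    refine ⟨by rw [abs_lt]; constructor <;> linarith [(by exact_mod_cast hL : (D.L i : ℤ) ≤ 2)],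
      by rw [abs_lt]; constructor <;> linarith,
      by rw [abs_of_nonneg (by positivity)]; linarith, trivial, trivial, trivial, ?_⟩
    intro j hj
    split_ifs <;> omega
  obtain ⟨⟨f45, f44, f46, fr⟩, fB⟩ := h₁
  have f41 := (fr (-41) (by norm_num)).trans h.nb
  have f42 := (fr (-42) (by norm_num)).trans h.wt
  have f43 := (fr (-43) (by norm_num)).trans h.rem
  have f40 := (fr (-40) (by norm_num)).trans h.idx
  have f33 := (fr (-33) (by norm_num)).trans e33
  have f1 := (fr (-1) (by norm_num)).trans hH'.N
  have fs : Same (-40) m₀ s₁.mem := fun j hj => (fr j (by omega)).trans (h.same j hj)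
  -- the cases of `scanCase` are those of the recursions of `weightRec` and `nextB`
  refine (Tri.seq (c₁ := 500 * (w + 1)) (c₂ := 500 * (w + 1)) (Tri.block (Q := fun s' =>
    s'.mem (-40) = i ∧ Same (-40) m₀ s'.mem ∧ s'.mem (-41) = D.nextB (sg * D.M) A b (i + 1) ∧
    s'.mem (-42) * s'.mem (-46) = (weightRec D.N D.θ (D.pat (sg * D.M) A b) (i + 1)).2 ∧
    s'.mem (-43) = (weightRec D.N D.θ (D.pat (sg * D.M) A b) (i + 1)).1)
    hF.w7 (by rfl) (by decide) fB ?_) fun s₂ h₂ => ?_).mono (by omega) fun _ => id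
  · have hsame : ∀ (j z : ℤ) (t : State), j ≤ -40 → Same (-40) m₀ t.mem →
        Same (-40) m₀ (t.write j z).mem := fun j z t hj ht i hi => by
      rw [write_mem, if_neg (by omega)]; exact ht i hi
    simp only [scanCase, asg, Prog.wp, val_lit, val_reg, val_add, val_sub, val_mul, write_mem,
      f45, f44, f46, f41, f42, f43, f40, f33, f1, Int.reduceNeg, Int.reduceEq, ↓reduceIte]
    have hpos : (0:ℤ) ≤ (weightRec D.N D.θ (D.pat (sg * D.M) A b) i).2 := by positivity
    refine ⟨fun hc => ⟨fun h0 => ⟨fun hr0 => ?_, fun hr0 => ?_⟩,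
      fun h0 => ⟨fun h1 => ?_, fun h1 => ?_⟩⟩, fun hc => ⟨fun h1 => ?_, fun h1 => ?_⟩⟩
    · have hc' : D.key (sg * D.M) A i < b := by omega
      have h0' : D.L i = 0 := by omega
      have hr0' : 0 < (weightRec D.N D.θ (D.pat (sg * D.M) A b) i).1 := by omega
      refine ⟨by rw [abs_lt]; constructor <;> omega,
        by rw [abs_of_nonneg (by positivity)]; linarith, trivial,
        hsame _ _ _ (by norm_num) (hsame _ _ _ (by norm_num) fs), ?_, ?_, ?_⟩ <;>
      simp [nextB, weightRec, pat, hc', h0', hr0']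
    · have hc' : D.key (sg * D.M) A i < b := by omega
      have h0' : D.L i = 0 := by omega
      have hr0' : ¬ 0 < (weightRec D.N D.θ (D.pat (sg * D.M) A b) i).1 := by omega
      refine ⟨trivial, fs, ?_, ?_, ?_⟩ <;>
      simp [nextB, weightRec, pat, hc', h0', -not_lt, hr0']
    · have hc' : D.key (sg * D.M) A i < b := by omega
      have h0' : D.L i = 1 := by omega
      refine ⟨by rw [abs_of_nonneg (by positivity)]; linarith, trivial,
        hsame _ _ _ (by norm_num) fs, ?_, ?_, ?_⟩ <;>
      simp [nextB, weightRec, pat, hc', h0']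
    · have hc' : D.key (sg * D.M) A i < b := by omega
      have h0' : D.L i = 2 := by omega
      refine ⟨trivial, fs, ?_, ?_, ?_⟩ <;>
      simp [nextB, weightRec, pat, hc', h0']
    · have hc' : ¬ D.key (sg * D.M) A i < b := by omega
      refine ⟨by rw [abs_lt]; constructor <;> omega, trivial,
        hsame _ _ _ (by norm_num) fs, ?_, ?_, ?_⟩ <;>
      simp [nextB, weightRec, pat, hc', -not_lt]
      omega
    · have hc' : ¬ D.key (sg * D.M) A i < b := by omega
      refine ⟨trivial, fs, ?_, ?_, ?_⟩ <;>
      simp [nextB, weightRec, pat, hc', -not_lt]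
      omega
  obtain ⟨⟨g40, gs, g41, g42, g43⟩, gB⟩ := h₂
  have hi2 : ((i : ℤ) + 1) < 2 ^ w := by
    have h2 := hH'.n
    have h3 := h.bdd 0
    rw [h2, abs_lt] at h3
    have : (i : ℤ) + 1 ≤ D.n := by exact_mod_cast hi
    linarith
  have hw1 : ((weightRec D.N D.θ (D.pat (sg * D.M) A b) (i + 1)).2 : ℤ) < 2 ^ w := by
    exact_mod_cast (weightRec_le D.N D.θ (D.pat (sg * D.M) A b) (i + 1)).trans_lt (c4 _ hi)
  refine (Tri.block (C := 500) (Q := fun s' => s'.mem (-40) = (i + 1 : ℕ) ∧ Same (-40) m₀ s'.mem ∧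
    s'.mem (-41) = D.nextB (sg * D.M) A b (i + 1) ∧
    s'.mem (-42) = (weightRec D.N D.θ (D.pat (sg * D.M) A b) (i + 1)).2 ∧
    s'.mem (-43) = (weightRec D.N D.θ (D.pat (sg * D.M) A b) (i + 1)).1)
    hF.w7 (by rfl) (by decide) gB ?_).mono le_rfl
    fun s' h' => ⟨h'.2, h'.1.2.1, h'.1.1, h'.1.2.2.1, h'.1.2.2.2.1, h'.1.2.2.2.2, hi⟩
  simp only [asg, Prog.wp, val_lit, val_reg, val_add, val_mul, write_mem, g40, g41, g42, g43,
    Int.reduceNeg, Int.reduceEq, ↓reduceIte]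
  refine ⟨by rwa [abs_of_nonneg (by positivity)], by rwa [abs_of_nonneg (by positivity)],
    by push_cast; rfl, fun j hj => ?_, trivial, trivial, trivial⟩
  simp only [write_mem]
  split_ifs <;> first | omega | exact gs j hj

/-- One pass through the examples computes the weight of the candidate with threshold `b`, and the end
of the interval of thresholds on which the weight is the same. -/
theorem scan_spec {F w : ℕ} (hF : D.Fits w) {sg A b : ℤ} {s : State} (hsg : |sg| = 1)
    (hA : -D.Am ≤ A) (hA' : A < D.Am) (hH : D.Holds s.mem) (h19 : s.mem (-19) = sg)
    (h30 : s.mem (-30) = A) (h33 : s.mem (-33) = b) (hB : Bdd w s.mem) :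
    Tri F scan s ((D.n + 1) * (3000 * (w + 1))) (fun s' => Bdd w s'.mem ∧ Same (-40) s.mem s'.mem ∧
      s'.mem (-41) = D.nextB (sg * D.M) A b D.n ∧ s'.mem (-42) = D.wt (sg * D.M) A b) := by
  obtain ⟨-, c2, c3, c4⟩ := hF.consts
  refine (Tri.seq (c₁ := 100 * (w + 1)) (c₂ := D.n * (100 * (w + 1) + 2000 * (w + 1)) +
    100 * (w + 1)) (Tri.block (Q := fun s' => Same (-40) s.mem s'.mem ∧
      s'.mem (-40) = 0 ∧ s'.mem (-41) = D.Bm ∧ s'.mem (-42) = 1 ∧ s'.mem (-43) = D.θ)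
      hF.w7 (by rfl) (by decide) hB ?_) fun s' hs' => ?_).mono (by nlinarith) fun _ => id
  · have hb := hB (-4)
    have ht := hB (-8)
    have h0 : (0:ℤ) < 2 ^ w := by positivity
    have h1 : (1:ℤ) < 2 ^ w := by linarith
    simp only [asg, Prog.wp, val_lit, val_reg, write_mem, hH.Bm, hH.θ, Int.reduceNeg, Int.reduceEq,
      ↓reduceIte, abs_zero, abs_one] at hb ht ⊢
    refine ⟨h0, hb, h1, ht, fun j hj => ?_, trivial, trivial, trivial, trivial⟩
    simp only [write_mem]
    split_ifs <;> omega
  · obtain ⟨⟨i1, i2, i3, i4, i5⟩, i6⟩ := hs'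
    have hs' : ScanInv D w sg A b s.mem 0 s' :=
      ⟨i6, i1, by simpa using i2, by simpa [nextB] using i3, by simpa [weightRec] using i4,
        by simpa [weightRec] using i5, by omega⟩
    refine Tri.loop (fun v s' => ScanInv D w sg A b s.mem (D.n - v) s' ∧ v ≤ D.n) ?_ ?_ ?_
      (v := D.n) ⟨by simpa using hs', le_rfl⟩
    · intro v s' hs'
      exact (Expr.cost_le hF.w7 hs'.1.bdd _ rfl).trans (Nat.mul_le_mul_right _ (by decide))
    · intro v s' hs' hg
      have e0 : s'.mem 0 = D.n := (hs'.1.same _ (by norm_num)).trans hH.n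
      simp only [val_sub, val_reg, hs'.1.idx, e0] at hg
      have hv : 0 < v := by by_contra h; obtain rfl : v = 0 := by omega
                            simp at hg
      refine ⟨hv, (scanBody_spec hF hsg hA hA' hH h19 h30 h33 hs'.1 (by omega)).mono le_rfl
        fun s'' h'' => ⟨?_, by omega⟩⟩
      rwa [show D.n - v + 1 = D.n - (v - 1) by omega] at h''
    · intro v s' hs' hg
      have e0 : s'.mem 0 = D.n := (hs'.1.same _ (by norm_num)).trans hH.n
      simp only [val_sub, val_reg, hs'.1.idx, e0] at hg
      have hv : D.n - v = D.n := by have := hs'.1.le; omega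
      have h := hs'.1
      rw [hv] at h
      exact ⟨h.bdd, h.same, h.nb, h.wt⟩

end Data

/-! ### Selecting an intercept -/

/-- The sum of `w` over the integers in `[a, b)`. -/
noncomputable def cum (w : ℤ → ℕ) (a b : ℤ) : ℕ := ∑ B ∈ Finset.Ico a b, w B

theorem cum_self (w : ℤ → ℕ) (a : ℤ) : cum w a a = 0 := by simp [cum]

theorem cum_succ (w : ℤ → ℕ) {a b : ℤ} (h : a ≤ b) : cum w a (b + 1) = cum w a b + w b := by
  unfold cum
  rw [← Finset.insert_Ico_right_eq_Ico_add_one h, Finset.sum_insert (by simp), add_comm]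

theorem cum_add (w : ℤ → ℕ) {a b c : ℤ} (h : a ≤ b) (h' : b ≤ c) :
    cum w a b + cum w b c = cum w a c := by
  unfold cum
  rw [← Finset.sum_union (Finset.Ico_disjoint_Ico_consecutive a b c),
    Finset.Ico_union_Ico_eq_Ico h h']

theorem cum_const {w : ℤ → ℕ} {a b : ℤ} {x : ℕ} (hab : a ≤ b) (h : ∀ B, a ≤ B → B < b → w B = x) :
    (cum w a b : ℤ) = x * (b - a) := by
  unfold cum
  rw [Finset.sum_congr rfl fun B hB => h B (Finset.mem_Ico.1 hB).1 (Finset.mem_Ico.1 hB).2]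
  simp [Int.toNat_of_nonneg (sub_nonneg.2 hab), mul_comm]

theorem cum_mono (w : ℤ → ℕ) {a b c : ℤ} (h : b ≤ c) : cum w a b ≤ cum w a c :=
  Finset.sum_le_sum_of_subset (Finset.Ico_subset_Ico_right h)

/-- Among the integers `lo, lo + 1, …`, with weights `w`, the position `r` of the cumulated weight
falls on `B`. -/
def Falls (w : ℤ → ℕ) (lo : ℤ) (r B : ℤ) : Prop :=
  lo ≤ B ∧ (cum w lo B : ℤ) ≤ r ∧ r < cum w lo B + w B

/-- A position falls on at most one integer. -/
theorem Falls.unique {w : ℤ → ℕ} {lo r B B' : ℤ} (h : Falls w lo r B) (h' : Falls w lo r B') :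
    B = B' := by
  have key : ∀ {B B' : ℤ}, Falls w lo r B → Falls w lo r B' → ¬ B < B' := by
    intro B B' h h' hlt
    have h1 := cum_succ w h.1
    have h2 := cum_mono w (a := lo) (show B + 1 ≤ B' by omega)
    have := h.2.2
    have := h'.2.1
    omega
  have := key h h'
  have := key h' h
  omega

/-- The integer in `[lo, lo + k)` on which the position `r` falls. -/
noncomputable def pick (w : ℤ → ℕ) (lo : ℤ) : ℕ → ℕ → ℤ
  | 0, _ => lo
  | k + 1, r => if r < cum w lo (lo + k) then pick w lo k r else lo + k

theorem falls_pick (w : ℤ → ℕ) (lo : ℤ) : ∀ (k r : ℕ), r < cum w lo (lo + k) →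
    Falls w lo r (pick w lo k r)
  | 0, r, h => by simp [cum_self] at h
  | k + 1, r, h => by
      rw [pick]
      split_ifs with h1
      · exact falls_pick w lo k r h1
      · have := cum_succ w (show lo ≤ lo + (k:ℤ) by omega)
        rw [Nat.cast_add, Nat.cast_one, ← add_assoc] at h
        refine ⟨by omega, by omega, by omega⟩

/-- Every integer is met by as many positions as its weight. -/
theorem sum_pick {R : Type*} [CommSemiring R] (w : ℤ → ℕ) (lo : ℤ) (φ : ℤ → R) : ∀ k : ℕ,
    ∑ r ∈ Finset.range (cum w lo (lo + k)), φ (pick w lo k r) =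
      ∑ B ∈ Finset.Ico lo (lo + k), w B * φ B
  | 0 => by simp [cum_self]
  | k + 1 => by
      have h : lo + ((k + 1 : ℕ) : ℤ) = lo + k + 1 := by push_cast; ring
      rw [h, cum_succ w (by omega), Finset.sum_range_add,
        ← Finset.insert_Ico_right_eq_Ico_add_one (by omega), Finset.sum_insert (by simp),
        ← sum_pick w lo φ k, add_comm]
      congr 1
      · rw [Finset.sum_congr rfl (g := fun _ => φ (lo + k)) fun r _ => by simp [pick]]
        simp
      · refine Finset.sum_congr rfl fun r hr => ?_
        rw [pick, if_pos (Finset.mem_range.1 hr)]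

/-- Processes the cell of the thresholds from `mem[-33]` to `mem[-41]`. -/
def bStep : Prog :=
  asg (-34) (reg (-42) * (reg (-41) - reg (-33))) ;;
  .ite (reg (-31) + lit 1)
    (.ite (reg (-34) - reg (-31)) (asg (-32) (reg (-33) + reg (-31) / reg (-42))) .skip) .skip ;;
  asg (-31) (reg (-31) - reg (-34)) ;;
  asg (-33) (reg (-41))

/-- Subtracts from `mem[-31]` the weights of all candidates with slope `mem[-30]`, and puts into
`mem[-32]` the intercept on which `mem[-31]` falls. -/
def bWalk : Prog :=
  asg (-33) (lit 0 - reg (-4)) ;; .loop (reg (-4) - reg (-33)) (scan ;; bStep)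

namespace Data
variable {D : Data}

theorem weightRec_congr (N θ : ℕ) {P P' : ℕ → ℕ} {n : ℕ} (h : ∀ i < n, P i = P' i) :
    weightRec N θ P n = weightRec N θ P' n := by
  induction n with
  | zero => rfl
  | succ n ih =>
    simp only [weightRec]
    rw [ih fun i hi => h i (by omega), h n (by omega)]

theorem lt_nextB {c A b : ℤ} (hb : b < D.Bm) (i : ℕ) : b < D.nextB c A b i := by
  induction i with
  | zero => exact hb
  | succ i ih =>
    rw [nextB]
    split_ifs <;> omega

theorem nextB_le (c A b : ℤ) (i : ℕ) : D.nextB c A b i ≤ D.Bm := by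
  induction i with
  | zero => exact le_rfl
  | succ i ih =>
    rw [nextB]
    split_ifs <;> omega

theorem nextB_le_key {c A b : ℤ} {i j : ℕ} (hj : j < i) (hb : b ≤ D.key c A j) :
    D.nextB c A b i ≤ D.key c A j + 1 := by
  induction i with
  | zero => omega
  | succ i ih =>
    rw [nextB]
    rcases Nat.lt_succ_iff_lt_or_eq.1 hj with h | rfl
    · have := ih h
      split_ifs <;> omega
    · rw [if_neg (by omega)]; omega

theorem nextB_eq (c A b : ℤ) (i : ℕ) :
    D.nextB c A b i = D.Bm ∨ ∃ j < i, b ≤ D.key c A j ∧ D.nextB c A b i = D.key c A j + 1 := by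
  induction i with
  | zero => exact .inl rfl
  | succ i ih =>
    rw [nextB]
    have h' : D.nextB c A b i = D.Bm ∨
        ∃ j < i + 1, b ≤ D.key c A j ∧ D.nextB c A b i = D.key c A j + 1 :=
      ih.imp id fun ⟨j, h1, h2⟩ => ⟨j, by omega, h2⟩
    split_ifs with h
    · exact h'
    · rcases min_choice (D.nextB c A b i) (D.key c A i + 1) with h1 | h1 <;> rw [h1]
      · exact h'
      · exact .inr ⟨i, by omega, by omega, rfl⟩

/-- The weight does not change between consecutive break points. -/
theorem wt_eq {c A b B : ℤ} (h1 : b ≤ B) (h2 : B < D.nextB c A b D.n) :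
    D.wt c A B = D.wt c A b := by
  unfold wt
  rw [weightRec_congr D.N D.θ fun i hi => ?_]
  have : D.key c A i < B ↔ D.key c A i < b := by
    refine ⟨fun h => ?_, fun h => by omega⟩
    by_contra hb
    have := nextB_le_key hi (not_lt.1 hb)
    omega
  simp only [pat, this]

/-- The number of examples whose key is at least `b`. -/
def keysFrom (D : Data) (c A b : ℤ) : ℕ :=
  ((Finset.range D.n).filter fun i => b ≤ D.key c A i).card

theorem keysFrom_le (c A b : ℤ) : D.keysFrom c A b ≤ D.n :=
  (Finset.card_filter_le _ _).trans (by simp)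

/-- Every iteration of `bWalk`, except the last, passes the key of an example; this bounds the number of
iterations. -/
theorem keysFrom_nextB {c A b : ℤ} (hb : b < D.Bm) (h : D.nextB c A b D.n < D.Bm) :
    D.keysFrom c A (D.nextB c A b D.n) < D.keysFrom c A b := by
  have hlt := lt_nextB (c := c) (A := A) hb D.n
  refine Finset.card_lt_card (Finset.ssubset_iff_of_subset ?_ |>.2 ?_)
  · intro i hi
    simp only [Finset.mem_filter] at hi ⊢
    exact ⟨hi.1, by omega⟩
  · rcases nextB_eq (D := D) c A b D.n with h' | ⟨j, hj, h1, h2⟩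
    · omega
    · exact ⟨j, by simp [hj, h1], by simp [hj]; omega⟩

/-- The state of the registers when the thresholds below `mem[-33]` have been processed. -/
structure BInv (D : Data) (w : ℕ) (c A r : ℤ) (m₀ : Mem) (v : ℕ) (s : State) : Prop where
  bdd : Bdd w s.mem
  same : Same (-31) m₀ s.mem
  ge : -D.Bm ≤ s.mem (-33)
  le : s.mem (-33) ≤ D.Bm
  rest : s.mem (-31) = r - cum (D.wt c A) (-D.Bm) (s.mem (-33))
  sel : 0 ≤ r → r < cum (D.wt c A) (-D.Bm) (s.mem (-33)) →
    Falls (D.wt c A) (-D.Bm) r (s.mem (-32))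
  meas : s.mem (-33) < D.Bm → D.keysFrom c A (s.mem (-33)) < v

theorem bStep_spec {F w v : ℕ} (hF : D.Fits w) {c A r : ℤ} {m₀ : Mem}
    (hr : |r| + cum (D.wt c A) (-D.Bm) D.Bm < 2 ^ w) {s₀ s : State}
    (h : BInv D w c A r m₀ v s₀) (hlt : s₀.mem (-33) < D.Bm) (hs : Same (-40) s₀.mem s.mem)
    (hB : Bdd w s.mem) (h41 : s.mem (-41) = D.nextB c A (s₀.mem (-33)) D.n)
    (h42 : s.mem (-42) = D.wt c A (s₀.mem (-33))) :
    Tri F bStep s (500 * (w + 1)) (BInv D w c A r m₀ (v - 1)) := by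
  obtain ⟨-, c2, c3, c4⟩ := hF.consts
  have e33 := hs (-33) (by norm_num)
  have e31 := hs (-31) (by norm_num)
  have e32 := hs (-32) (by norm_num)
  rw [h.rest] at e31
  have hge := h.ge
  have hsel := h.sel
  have hmeas := h.meas hlt
  set b := s₀.mem (-33) with hb
  have hnb := lt_nextB (c := c) (A := A) hlt D.n
  have hnb' := nextB_le (D := D) c A b D.n
  have hkey := fun h => keysFrom_nextB (c := c) (A := A) hlt h
  set nb := D.nextB c A b D.n with hnbdef
  have hcell := cum_const hnb.le (fun B h1 h2 => wt_eq (D := D) (c := c) (A := A) h1 h2)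
  have hadd := cum_add (D.wt c A) hge hnb.le
  have hmono := cum_mono (D.wt c A) (a := -D.Bm) hnb'
  have hwpos : 0 < D.wt c A b := weightRec_pos hF.N1 _ _ _
  have hb0 := hB (-33)
  set x := D.wt c A b
  set G := cum (D.wt c A) (-D.Bm) D.Bm
  set p := cum (D.wt c A) (-D.Bm) b with hp
  set p' := cum (D.wt c A) (-D.Bm) nb
  have hcell' : (x : ℤ) * (nb - b) = p' - p := by rw [← hcell, ← hadd]; push_cast; ring
  have hr2 := abs_lt.1 (show |r| < 2 ^ w by linarith [(Nat.cast_nonneg G : (0:ℤ) ≤ G)])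
  have hrr := abs_le.1 (le_refl |r|)
  have hmono1 : (p':ℤ) ≤ G := by exact_mod_cast hmono
  have hpp : (p:ℤ) ≤ p' := by omega
  have hp0 : (0:ℤ) ≤ p := by positivity
  have hsel' : 0 ≤ r - p → r < p' →
      Falls (D.wt c A) (-D.Bm) r (b + (r - p) / x) ∧ (r - p) / x < nb - b := by
    intro h0 h1
    have hx : (0:ℤ) < x := by exact_mod_cast hwpos
    have hq0 : 0 ≤ (r - p) / x := Int.ediv_nonneg h0 hx.le
    have hq1 : (r - p) / x < nb - b := Int.ediv_lt_of_lt_mul hx (by rw [mul_comm, hcell']; omega)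
    have hq2 := Int.mul_ediv_add_emod (r - p) x
    have hq3 := Int.emod_nonneg (r - p) hx.ne'
    have hq4 := Int.emod_lt_of_pos (r - p) hx
    have hc2 := cum_const (w := D.wt c A) (a := b) (b := b + (r - p) / x) (by omega)
      (fun B h1 h2 => wt_eq (D := D) (c := c) (A := A) h1 (by omega))
    have hc3 := cum_add (D.wt c A) hge (show b ≤ b + (r - p) / x by omega)
    have hc4 := wt_eq (D := D) (c := c) (A := A) (b := b) (B := b + (r - p) / x) (by omega)
      (by omega)
    rw [add_sub_cancel_left] at hc2
    refine ⟨⟨by omega, ?_, ?_⟩, hq1⟩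
    · rw [← hc3]; push_cast; rw [hc2]; linarith
    · rw [← hc3, hc4]; push_cast; rw [hc2]; linarith
  refine (Tri.block (C := 500) (Q := fun s' => Same (-31) m₀ s'.mem ∧ s'.mem (-33) = nb ∧
    s'.mem (-31) = r - p' ∧ (0 ≤ r → r < p' → Falls (D.wt c A) (-D.Bm) r (s'.mem (-32))))
    hF.w7 (by rfl) (by decide) hB ?_).mono le_rfl
    fun s' h' => ⟨h'.2, h'.1.1, by omega, by omega, by rw [h'.1.2.1]; exact h'.1.2.2.1,
      by rw [h'.1.2.1]; exact h'.1.2.2.2, by rw [h'.1.2.1]; intro h; have := hkey h; omega⟩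
  have hsame : ∀ j, -31 < j → s.mem j = m₀ j := fun j hj =>
    (hs j (by omega)).trans (h.same j hj)
  simp only [bStep, asg, Prog.wp, val_lit, val_reg, val_add, val_mul, val_sub, val_div, write_mem,
    h41, h42, e33, e31, e32, Int.reduceNeg, Int.reduceEq, ↓reduceIte, hcell']
  have t1 : |(p':ℤ) - p| < 2 ^ w := by rw [abs_lt]; constructor <;> linarith [abs_nonneg r]
  have t2 : |r - p - (p' - p)| < 2 ^ w := by rw [abs_lt]; constructor <;> linarith
  have t3 : |nb| < 2 ^ w := by rw [abs_lt]; constructor <;> linarith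
  refine ⟨t1, fun h0 => ⟨fun h1 => ⟨?_, t2, t3, fun j hj => ?_, trivial, by ring,
    fun _ _ => (hsel' (by omega) (by omega)).1⟩, fun h1 => ⟨t2, t3, fun j hj => ?_, trivial, by ring,
    fun h2 h3 => by omega⟩⟩, fun h0 => ⟨t2, t3, fun j hj => ?_, trivial, by ring,
    fun h2 h3 => hsel h2 (by omega)⟩⟩
  · have h2 := hsel' (by omega) (by omega)
    have := h2.1.1
    rw [abs_lt]; constructor <;> linarith
  all_goals
    simp only [write_mem]
    split_ifs <;> first | omega | exact hsame j hj

/-- The total weight of the candidates with slope `A` and factor `c`. -/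
noncomputable def colWt (D : Data) (c A : ℤ) : ℕ := cum (D.wt c A) (-D.Bm) D.Bm

/-- The bound on the time of `bWalk`. -/
def bCost (n w : ℕ) : ℕ := (n + 2) * ((n + 1) * (3000 * (w + 1)) + 1000 * (w + 1))

/-- If the position is negative or too large then `bWalk` only subtracts the total weight. This is how total
weights are computed. -/
theorem bWalk_spec {F w : ℕ} (hF : D.Fits w) {sg A r : ℤ} {s : State} (hsg : |sg| = 1)
    (hA : -D.Am ≤ A) (hA' : A < D.Am) (hH : D.Holds s.mem) (h19 : s.mem (-19) = sg)
    (h30 : s.mem (-30) = A) (h31 : s.mem (-31) = r) (hB : Bdd w s.mem)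
    (hr : |r| + D.colWt (sg * D.M) A < 2 ^ w) :
    Tri F bWalk s (bCost D.n w) (fun s' => Bdd w s'.mem ∧ Same (-31) s.mem s'.mem ∧
      s'.mem (-31) = r - D.colWt (sg * D.M) A ∧
      (0 ≤ r → r < D.colWt (sg * D.M) A →
        Falls (D.wt (sg * D.M) A) (-D.Bm) r (s'.mem (-32)))) := by
  obtain ⟨-, c2, c3, c4⟩ := hF.consts
  refine (Tri.seq (c₁ := 100 * (w + 1)) (c₂ := (D.n + 1) * (100 * (w + 1) +
    ((D.n + 1) * (3000 * (w + 1)) + 500 * (w + 1))) + 100 * (w + 1))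
    (Tri.block (Q := fun s' => Same (-31) s.mem s'.mem ∧ s'.mem (-31) = r ∧ s'.mem (-33) = -D.Bm)
      hF.w7 (by rfl) (by decide) hB ?_) fun s' hs' => ?_).mono (by unfold bCost; nlinarith)
      fun _ => id
  · simp only [asg, Prog.wp, val_lit, val_reg, val_sub, write_mem, hH.Bm, h31, Int.reduceNeg,
      Int.reduceEq, ↓reduceIte]
    refine ⟨by rw [abs_lt]; constructor <;> linarith, fun j hj => ?_, trivial, by ring⟩
    simp only [write_mem]
    split_ifs <;> omega
  · obtain ⟨⟨i1, i2, i3⟩, i4⟩ := hs'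
    refine Tri.loop (fun v s' => BInv D w (sg * D.M) A r s.mem v s') ?_ ?_ ?_ (v := D.n + 1)
      ⟨i4, i1, i3.ge, by omega, by rw [i2, i3, cum_self]; simp, ?_, fun _ => by
        have := keysFrom_le (D := D) (sg * D.M) A (s'.mem (-33)); omega⟩
    · intro v s' hs'
      exact (Expr.cost_le hF.w7 hs'.bdd _ rfl).trans (Nat.mul_le_mul_right _ (by decide))
    · intro v s' hs' hg
      have hH' := hH.same _ hs'.same (by norm_num)
      simp only [val_sub, val_reg, hH'.Bm] at hg
      refine ⟨by have := hs'.meas (by omega); omega, ?_⟩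
      refine Tri.seq (scan_spec hF hsg hA hA' hH' ((hs'.same _ (by norm_num)).trans h19)
        ((hs'.same _ (by norm_num)).trans h30) rfl hs'.bdd) fun s'' h'' => ?_
      exact bStep_spec hF hr hs' (by omega) h''.2.1 h''.1 h''.2.2.1 h''.2.2.2
    · intro v s' hs' hg
      have hH' := hH.same _ hs'.same (by norm_num)
      simp only [val_sub, val_reg, hH'.Bm] at hg
      have e : s'.mem (-33) = D.Bm := by have := hs'.le; omega
      exact ⟨hs'.bdd, hs'.same, by rw [hs'.rest, e, colWt],
        fun h0 h1 => hs'.sel h0 (by rw [e]; exact h1)⟩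
    · rw [i3, cum_self]; intro h0 h1; simp at h1; omega

end Data

/-! ### The total weight as a function of the slope -/

/-- If `A ↦ κ A i` is affine for every `i`, and the (weak) order of the numbers `κ A₀ i` persists
for all `A ∈ I`, then the sum of any function of the sets `{i ∈ s | κ A i < B}` over all `B` in an
interval is affine in `A ∈ I`. -/
theorem sum_cut_affine {κ : ℤ → ℕ → ℤ} {I : Set ℤ} {lo hi A₀ A₁ A₂ A₃ A₄ : ℤ}
    (h₁ : A₁ ∈ I) (h₂ : A₂ ∈ I) (h₃ : A₃ ∈ I) (h₄ : A₄ ∈ I) (s : Finset ℕ)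
    (hord : ∀ i ∈ s, ∀ j ∈ s, κ A₀ i ≤ κ A₀ j → ∀ A ∈ I, κ A i ≤ κ A j)
    (haff : ∀ i ∈ s, κ A₁ i + κ A₂ i = κ A₃ i + κ A₄ i)
    (hlo : ∀ i ∈ s, ∀ A ∈ I, lo ≤ κ A i) (hhi : ∀ i ∈ s, ∀ A ∈ I, κ A i < hi)
    (f : Finset ℕ → ℤ) :
    ∑ B ∈ Finset.Ico lo hi, f (s.filter fun i => κ A₁ i < B) +
      ∑ B ∈ Finset.Ico lo hi, f (s.filter fun i => κ A₂ i < B) =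
    ∑ B ∈ Finset.Ico lo hi, f (s.filter fun i => κ A₃ i < B) +
      ∑ B ∈ Finset.Ico lo hi, f (s.filter fun i => κ A₄ i < B) := by
  induction hn : s.card generalizing s with
  | zero =>
    rw [Finset.card_eq_zero] at hn
    subst hn
    simp
  | succ n ih =>
    obtain ⟨m, hm, hmax⟩ := s.exists_max_image (κ A₀) (Finset.card_pos.1 (by omega))
    have key : ∀ A ∈ I, ∑ B ∈ Finset.Ico lo hi, f (s.filter fun i => κ A i < B) =
        ∑ B ∈ Finset.Ico lo hi, f ((s.erase m).filter fun i => κ A i < B) +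
          (hi - (κ A m + 1)) * (f s - f (s.erase m)) := by
      intro A hA
      have e : ∀ B ∈ Finset.Ico lo hi, f (s.filter fun i => κ A i < B) =
          f ((s.erase m).filter fun i => κ A i < B) +
            if κ A m + 1 ≤ B then f s - f (s.erase m) else 0 := by
        intro B hB
        split_ifs with h
        · have hall : ∀ i ∈ s, κ A i < B := fun i hi => by
            have := hord i hi m hm (hmax i hi) A hA
            omega
          rw [Finset.filter_true_of_mem hall, Finset.filter_true_of_mem fun i hi =>
            hall i (Finset.mem_of_mem_erase hi)]
          ring
        · rw [add_zero]
          congr 1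
          ext i
          simp only [Finset.mem_filter, Finset.mem_erase]
          exact ⟨fun ⟨h1, h2⟩ => ⟨⟨fun h3 => h (by subst h3; omega), h1⟩, h2⟩,
            fun ⟨h1, h2⟩ => ⟨h1.2, h2⟩⟩
      rw [Finset.sum_congr rfl e, Finset.sum_add_distrib]
      congr 1
      have := hlo m hm A hA
      have := hhi m hm A hA
      rw [← Finset.sum_filter, Finset.sum_const,
        show (Finset.Ico lo hi).filter (fun B => κ A m + 1 ≤ B) = Finset.Ico (κ A m + 1) hi by
          ext B; simp; omega]
      simp only [Int.card_Ico, nsmul_eq_mul]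
      rw [Int.toNat_of_nonneg (by omega)]
    have hmem := fun i (hi : i ∈ s.erase m) => Finset.mem_of_mem_erase hi
    have := ih (s.erase m) (fun i hi j hj => hord i (hmem i hi) j (hmem j hj))
      (fun i hi => haff i (hmem i hi)) (fun i hi => hlo i (hmem i hi))
      (fun i hi => hhi i (hmem i hi)) (by rw [Finset.card_erase_of_mem hm]; omega)
    rw [key A₁ h₁, key A₂ h₂, key A₃ h₃, key A₄ h₄]
    linear_combination this - (f s - f (s.erase m)) * haff m hm

namespace Data
variable {D : Data}

/-- The slope from which on the order of the keys of two examples may be different. The number `p`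
encodes an ordered pair of examples. For pairs with the same `X` the value is `1`, and it is irrelevant for the
reversed pair; such additional break points only refine the partition. -/
def brk (D : Data) (c : ℤ) (p : ℕ) : ℤ :=
  c * (D.Y (p / D.n) - D.Y (p % D.n)) / (D.X (p / D.n) - D.X (p % D.n)) + 1

/-- The least break point after `A`, among those of the first pairs and the end `Am`. -/
def nextA (D : Data) (c A : ℤ) : ℕ → ℤ
  | 0 => D.Am
  | p + 1 => if A < D.brk c p then min (nextA D c A p) (D.brk c p) else nextA D c A p

theorem lt_nextA {c A : ℤ} (hA : A < D.Am) (p : ℕ) : A < D.nextA c A p := by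
  induction p with
  | zero => exact hA
  | succ p ih =>
    rw [nextA]
    split_ifs <;> omega

theorem nextA_le (c A : ℤ) (p : ℕ) : D.nextA c A p ≤ D.Am := by
  induction p with
  | zero => exact le_rfl
  | succ p ih =>
    rw [nextA]
    split_ifs <;> omega

theorem nextA_le_brk {c A : ℤ} {p q : ℕ} (hq : q < p) (h : A < D.brk c q) :
    D.nextA c A p ≤ D.brk c q := by
  induction p with
  | zero => omega
  | succ p ih =>
    rw [nextA]
    rcases Nat.lt_succ_iff_lt_or_eq.1 hq with h | rfl
    · have := ih h
      split_ifs <;> omega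
    · rw [if_pos h]; omega

theorem nextA_eq (c A : ℤ) (p : ℕ) :
    D.nextA c A p = D.Am ∨ ∃ q < p, A < D.brk c q ∧ D.nextA c A p = D.brk c q := by
  induction p with
  | zero => exact .inl rfl
  | succ p ih =>
    rw [nextA]
    have h' : D.nextA c A p = D.Am ∨ ∃ q < p + 1, A < D.brk c q ∧ D.nextA c A p = D.brk c q :=
      ih.imp id fun ⟨j, h1, h2⟩ => ⟨j, by omega, h2⟩
    split_ifs with h
    · rcases min_choice (D.nextA c A p) (D.brk c p) with h1 | h1 <;> rw [h1]
      · exact h'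
      · exact .inr ⟨p, by omega, h, rfl⟩
    · exact h'

/-- The number of break points after `A`. -/
def brksFrom (D : Data) (c A : ℤ) : ℕ :=
  ((Finset.range (D.n * D.n)).filter fun p => A < D.brk c p).card

theorem brksFrom_le (c A : ℤ) : D.brksFrom c A ≤ D.n * D.n :=
  (Finset.card_filter_le _ _).trans (by simp)

/-- Every iteration of `aLoop`, except the last, passes a break point; this bounds the number of
iterations. -/
theorem brksFrom_nextA {c A : ℤ} (hA : A < D.Am) (h : D.nextA c A (D.n * D.n) < D.Am) :
    D.brksFrom c (D.nextA c A (D.n * D.n)) < D.brksFrom c A := by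
  have hlt := lt_nextA (c := c) hA (D.n * D.n)
  refine Finset.card_lt_card (Finset.ssubset_iff_of_subset ?_ |>.2 ?_)
  · intro i hi
    simp only [Finset.mem_filter] at hi ⊢
    exact ⟨hi.1, by omega⟩
  · rcases nextA_eq (D := D) c A (D.n * D.n) with h' | ⟨j, hj, h1, h2⟩
    · omega
    · exact ⟨j, by simp [hj, h1], by simp [hj]; omega⟩

/-- The order of the keys does not change between consecutive break points. -/
theorem key_le_key {c A A' : ℤ} {i j : ℕ} (hi : i < D.n) (hj : j < D.n) (h1 : A ≤ A')
    (h2 : A' < D.nextA c A (D.n * D.n)) (h : D.key c A i ≤ D.key c A j) :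
    D.key c A' i ≤ D.key c A' j := by
  unfold key at *
  by_cases hx : D.X j ≤ D.X i
  · nlinarith [mul_nonneg (sub_nonneg.2 h1) (sub_nonneg.2 hx)]
  · have hx' : 0 < D.X j - D.X i := by omega
    by_contra hlt
    have hn : 0 < D.n := by omega
    have hp : j * D.n + i < D.n * D.n := by nlinarith
    have hdiv : (j * D.n + i) / D.n = j := by
      rw [mul_comm, Nat.mul_add_div hn, Nat.div_eq_of_lt hi, add_zero]
    have hmod : (j * D.n + i) % D.n = i := by
      rw [mul_comm, Nat.mul_add_mod, Nat.mod_eq_of_lt hi]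
    have hb : D.brk c (j * D.n + i) = c * (D.Y j - D.Y i) / (D.X j - D.X i) + 1 := by
      rw [brk, hdiv, hmod]
    have h3 : A < D.brk c (j * D.n + i) := by
      rw [hb, Int.lt_add_one_iff, Int.le_ediv_iff_mul_le hx']
      nlinarith
    have h4 : ¬ A' < D.brk c (j * D.n + i) := by
      rw [hb, Int.lt_add_one_iff, Int.le_ediv_iff_mul_le hx']
      nlinarith
    have := nextA_le_brk hp h3
    omega

/-- Between consecutive break points the total weight is an affine function of the slope. -/
theorem colWt_add_colWt {w : ℕ} (hF : D.Fits w) {sg cur A A' : ℤ} (hsg : |sg| = 1)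
    (hcur : -D.Am ≤ cur) (h1 : cur ≤ A) (h2 : cur ≤ A')
    (h : A + A' = cur + (D.nextA (sg * D.M) cur (D.n * D.n) - 1)) :
    D.colWt (sg * D.M) A + D.colWt (sg * D.M) A' = D.colWt (sg * D.M) cur +
      D.colWt (sg * D.M) (D.nextA (sg * D.M) cur (D.n * D.n) - 1) := by
  have h3 : A < D.nextA (sg * D.M) cur (D.n * D.n) := by omega
  have h4 : A' < D.nextA (sg * D.M) cur (D.n * D.n) := by omega
  have hle := nextA_le (D := D) (sg * D.M) cur (D.n * D.n)
  set nx := D.nextA (sg * D.M) cur (D.n * D.n) with hnx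
  set c := sg * D.M with hc
  let f : Finset ℕ → ℤ := fun s =>
    (weightRec D.N D.θ (fun i => if i ∈ s ∧ D.L i ≤ 1 then D.L i + 1 else 0) D.n).2
  have e : ∀ A, (D.colWt c A : ℤ) = ∑ B ∈ Finset.Ico (-D.Bm) D.Bm,
      f ((Finset.range D.n).filter fun i => D.key c A i < B) := by
    intro A
    rw [colWt, cum, Nat.cast_sum]
    refine Finset.sum_congr rfl fun B _ => ?_
    simp only [f, wt]
    rw [weightRec_congr]
    intro i hi
    simp [pat, hi]
  have hb : ∀ i ∈ Finset.range D.n, ∀ A ∈ Set.Ico cur nx, |D.key c A i| < D.Bm :=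
    fun i hi A hA => hF.key_lt sg hsg A (by have := hA.1; omega) (by have := hA.2; omega) i
      (Finset.mem_range.1 hi)
  have := sum_cut_affine (κ := D.key c) (I := Set.Ico cur nx) (lo := -D.Bm) (hi := D.Bm)
    (A₀ := cur) (A₁ := A) (A₂ := A') (A₃ := cur) (A₄ := nx - 1) ⟨h1, h3⟩ ⟨h2, h4⟩
    ⟨le_rfl, by omega⟩ ⟨by omega, by omega⟩ (Finset.range D.n)
    (fun i hi j hj hij A hA => key_le_key (Finset.mem_range.1 hi) (Finset.mem_range.1 hj) hA.1
      hA.2 hij)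
    (fun i _ => by unfold key; linear_combination (-D.X i) * h)
    (fun i hi A hA => (abs_lt.1 (hb i hi A hA)).1.le) (fun i hi A hA => (abs_lt.1 (hb i hi A hA)).2)
    f
  rw [← e, ← e, ← e, ← e] at this
  exact_mod_cast this

/-! ### Selecting a slope -/

/-- The candidate for the position `u`, among those with slope in `[cur, cur + m)`. Every candidate
with weight `x` is met by `2 * x` positions: the total weights `G A` of the slopes `A` and
`2 * cur + m - 1 - A` add up to `S`, and the block of `S` positions that belongs to `A` is divided between
these two. -/
noncomputable def pickPair (D : Data) (c cur : ℤ) (m S u : ℕ) : ℤ × ℤ :=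
  let A := cur + (u / S : ℕ)
  let A' := cur + (cur + m - 1) - A
  if u % S < D.colWt c A then (A, pick (D.wt c A) (-D.Bm) (2 * D.Bm).toNat (u % S))
  else (A', pick (D.wt c A') (-D.Bm) (2 * D.Bm).toNat (u % S - D.colWt c A))

theorem sum_range_mul {R : Type*} [AddCommMonoid R] (m : ℕ) {S : ℕ} (hS : 0 < S)
    (g : ℕ → ℕ → R) : ∑ u ∈ Finset.range (m * S), g (u / S) (u % S) =
      ∑ a ∈ Finset.range m, ∑ r ∈ Finset.range S, g a r := by
  induction m with
  | zero => simp
  | succ m ih =>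
    rw [Nat.succ_mul, Finset.sum_range_add, ih, Finset.sum_range_succ]
    congr 1
    refine Finset.sum_congr rfl fun r hr => ?_
    have hr := Finset.mem_range.1 hr
    rw [mul_comm m S, Nat.mul_add_div hS, Nat.mul_add_mod, Nat.div_eq_of_lt hr,
      Nat.mod_eq_of_lt hr, add_zero]

/-- The sum of the weights of the candidates with slope `A`, each multiplied with `φ`. -/
noncomputable def colSum {R : Type*} [CommSemiring R] (D : Data) (c : ℤ) (φ : ℤ × ℤ → R) (A : ℤ) :
    R :=
  ∑ B ∈ Finset.Ico (-D.Bm) D.Bm, D.wt c A B * φ (A, B)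

/-- Every candidate with a slope in the interval is met by twice as many positions as its weight. -/
theorem sum_pickPair {R : Type*} [CommSemiring R] {w : ℕ} (hF : D.Fits w) {sg cur : ℤ} {m S : ℕ}
    (hsg : |sg| = 1) (hcur : -D.Am ≤ cur)
    (hm : (D.nextA (sg * D.M) cur (D.n * D.n)) = cur + m)
    (hS : S = D.colWt (sg * D.M) cur + D.colWt (sg * D.M) (cur + m - 1)) (hS0 : 0 < S)
    (φ : ℤ × ℤ → R) :
    ∑ u ∈ Finset.range (m * S), φ (D.pickPair (sg * D.M) cur m S u) =
      2 * ∑ A ∈ Finset.Ico cur (cur + m), D.colSum (sg * D.M) φ A := by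
  obtain ⟨-, -, hB, -⟩ := hF.consts
  have hadd := fun A A' => colWt_add_colWt hF (sg := sg) (cur := cur) (A := A) (A' := A') hsg hcur
  obtain ⟨c, hc⟩ : ∃ c, c = sg * D.M := ⟨_, rfl⟩
  rw [← hc] at hm hS hadd
  rw [← hc]
  have hBm : -D.Bm + ((2 * D.Bm).toNat : ℤ) = D.Bm := by omega
  have hcol : ∀ A, ∑ r ∈ Finset.range (D.colWt c A),
      φ (A, pick (D.wt c A) (-D.Bm) (2 * D.Bm).toNat r) = D.colSum c φ A := by
    intro A
    have := sum_pick (D.wt c A) (-D.Bm) (fun B => φ (A, B)) (2 * D.Bm).toNat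
    rw [hBm] at this
    exact this
  have h1 : ∀ a ∈ Finset.range m, ∑ r ∈ Finset.range S,
      (if r < D.colWt c (cur + (a : ℕ)) then φ (cur + (a : ℕ),
        pick (D.wt c (cur + (a : ℕ))) (-D.Bm) (2 * D.Bm).toNat r)
      else φ (cur + (cur + m - 1) - (cur + (a : ℕ)), pick (D.wt c (cur + (cur + m - 1) - (cur + (a : ℕ)))) (-D.Bm)
        (2 * D.Bm).toNat (r - D.colWt c (cur + (a : ℕ))))) =
      D.colSum c φ (cur + (a : ℕ)) + D.colSum c φ (cur + (m - 1 - a : ℕ)) := by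
    intro a ha
    have ha := Finset.mem_range.1 ha
    have hA' : cur + (cur + m - 1) - (cur + (a : ℕ)) = cur + (m - 1 - a : ℕ) := by omega
    rw [hA']
    have hadd := hadd (cur + a) (cur + (m - 1 - a : ℕ)) (by omega) (by omega) (by
      rw [hm, ← hA']; ring)
    rw [hm, ← hS] at hadd
    rw [← hadd, Finset.sum_range_add, ← hcol, ← hcol]
    congr 1
    · exact Finset.sum_congr rfl fun r hr => by rw [if_pos (Finset.mem_range.1 hr)]
    · refine Finset.sum_congr rfl fun r hr => ?_
      rw [if_neg (by simp), Nat.add_sub_cancel_left]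
  have h2 : ∑ A ∈ Finset.Ico cur (cur + m), D.colSum c φ A =
      ∑ a ∈ Finset.range m, D.colSum c φ (cur + (a : ℕ)) := by
    refine (Finset.sum_nbij' (fun a : ℕ => cur + (a : ℤ)) (fun A => (A - cur).toNat) ?_ ?_ ?_ ?_
      ?_).symm
    · intro a ha; simp at ha ⊢; omega
    · intro A hA; simp at hA ⊢; omega
    · intro a ha; simp
    · intro A hA; simp at hA ⊢; omega
    · intro a ha; rfl
  have h3 := sum_range_mul m hS0 fun a r => if r < D.colWt c (cur + (a : ℕ)) then
    φ (cur + (a : ℕ), pick (D.wt c (cur + (a : ℕ))) (-D.Bm) (2 * D.Bm).toNat r)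
      else φ (cur + (cur + m - 1) - (cur + (a : ℕ)), pick (D.wt c (cur + (cur + m - 1) - (cur + (a : ℕ)))) (-D.Bm)
        (2 * D.Bm).toNat (r - D.colWt c (cur + (a : ℕ))))
  rw [Finset.sum_congr rfl h1, Finset.sum_add_distrib,
    Finset.sum_range_reflect (fun a => D.colSum c φ (cur + (a : ℕ)))] at h3
  rw [h2, two_mul, ← h3]
  refine Finset.sum_congr rfl fun u _ => ?_
  rw [pickPair]
  split_ifs <;> rfl

theorem colSum_one (c A : ℤ) : D.colSum c (fun _ => (1 : ℕ)) A = D.colWt c A := by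
  simp [colSum, colWt, cum]

/-- The positions of an interval of slopes. -/
theorem two_mul_cum_colWt {w : ℕ} (hF : D.Fits w) {sg cur : ℤ} {m S : ℕ}
    (hsg : |sg| = 1) (hcur : -D.Am ≤ cur)
    (hm : (D.nextA (sg * D.M) cur (D.n * D.n)) = cur + m)
    (hS : S = D.colWt (sg * D.M) cur + D.colWt (sg * D.M) (cur + m - 1)) (hS0 : 0 < S) :
    m * S = 2 * cum (D.colWt (sg * D.M)) cur (cur + m) := by
  have := sum_pickPair (R := ℕ) hF hsg hcur hm hS hS0 fun _ => 1
  simpa [colSum_one, cum] using this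

theorem colWt_pos {w : ℕ} (hF : D.Fits w) (c A : ℤ) : 0 < D.colWt c A := by
  obtain ⟨-, -, hB, -⟩ := hF.consts
  exact Finset.sum_pos (fun B _ => weightRec_pos hF.N1 _ _ _) ⟨-D.Bm, Finset.mem_Ico.2 ⟨le_rfl, by omega⟩⟩

end Data

/-- One step of the search for the next break point: takes the pair number `mem[-50]` into
account. -/
def nextBody : Prog :=
  asg (-51) (reg (-50) / reg 0) ;;
  asg (-52) (reg (-50) - reg 0 * reg (-51)) ;;
  asg (-53) (reg (-19) * reg (-2) * (get (lit 8 + lit 3 * reg (-51)) -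
    get (lit 8 + lit 3 * reg (-52))) / (get (lit 7 + lit 3 * reg (-51)) -
    get (lit 7 + lit 3 * reg (-52))) + lit 1) ;;
  .ite (reg (-53) - reg (-25)) (.ite (reg (-26) - reg (-53)) (asg (-26) (reg (-53))) .skip) .skip ;;
  asg (-50) (reg (-50) + lit 1)

/-- Puts into `mem[-26]` the least break point of the slope after `mem[-25]`. -/
def next : Prog :=
  (asg (-50) (lit 0) ;; asg (-26) (reg (-3))) ;; .loop (reg 0 * reg 0 - reg (-50)) nextBody

/-- Puts into `mem[-28]` the weight of the slopes from `mem[-25]` to `mem[-26]`, and into `mem[-27]`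
the weight of the first one and the last one. -/
def colPre : Prog :=
  (asg (-30) (reg (-25)) ;; asg (-31) (lit (-1))) ;; bWalk ;;
  (asg (-27) (reg (-31)) ;; asg (-30) (reg (-26) - lit 1) ;; asg (-31) (lit (-1))) ;; bWalk ;;
  (asg (-27) (lit (-2) - (reg (-27) + reg (-31))) ;;
    asg (-28) ((reg (-26) - reg (-25)) * reg (-27)))

/-- Selects the candidate for the position `mem[-20]` in the interval of slopes. -/
def colSel : Prog :=
  (asg (-30) (reg (-25) + reg (-20) / reg (-27)) ;;
    asg (-31) (reg (-20) - reg (-27) * (reg (-20) / reg (-27)))) ;; bWalk ;;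
  .ite (reg (-31) + lit 1) (asg (-30) (reg (-25) + (reg (-26) - lit 1) - reg (-30)) ;; bWalk) .skip ;;
  (asg (-21) (lit 1) ;; asg (-22) (reg (-30)) ;; asg (-23) (reg (-19) * reg (-2)) ;;
    asg (-24) (reg (-32)))

/-- Subtracts from `mem[-20]` the weights of all candidates with sign `mem[-19]`. If the position
`mem[-20]` falls on one of them, then this candidate is put into `mem[-22]`, `mem[-24]`, `mem[-23]`, and
`mem[-21]` is set to `1`. -/
def aLoop : Prog :=
  .loop (reg (-3) - reg (-25)) (next ;; colPre ;;
    .ite (reg (-20) + lit 1) (.ite (reg (-28) - reg (-20)) colSel .skip) .skip ;;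
    (asg (-20) (reg (-20) - reg (-28)) ;; asg (-25) (reg (-26))))

namespace Data
variable {D : Data}

/-- The state of the registers in the search for the next break point, before pair `p`. -/
structure NextInv (D : Data) (w : ℕ) (c cur : ℤ) (m₀ : Mem) (p : ℕ) (s : State) : Prop where
  bdd : Bdd w s.mem
  same : Same (-26) m₀ s.mem
  idx : s.mem (-50) = p
  nx : s.mem (-26) = D.nextA c cur p
  le : p ≤ D.n * D.n

theorem brk_abs {w : ℕ} (hF : D.Fits w) {sg : ℤ} (hsg : |sg| = 1) {p : ℕ} (hp : p < D.n * D.n) :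
    |D.brk (sg * D.M) p| < 2 ^ w := by
  obtain ⟨-, c2, c3, -⟩ := hF.consts
  have hA := hF.Am1
  have hk := fun i hi => abs_lt.1 (hF.key_lt sg hsg 0 (by omega) (by omega) i hi)
  have h1 := hk (p / D.n) (Nat.div_lt_of_lt_mul hp)
  have h2 := hk (p % D.n) (Nat.mod_lt _ (by have := hF.n1; omega))
  simp only [key, zero_mul, sub_zero] at h1 h2
  rw [brk, mul_sub]
  have h3 := Int.abs_ediv_le_abs (sg * D.M * D.Y (p / D.n) - sg * D.M * D.Y (p % D.n))
    (D.X (p / D.n) - D.X (p % D.n))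
  have h4 : |sg * D.M * D.Y (p / D.n) - sg * D.M * D.Y (p % D.n)| ≤ 2 * D.Bm := by
    rw [abs_le]; constructor <;> linarith
  have h5 := abs_le.1 (h3.trans h4)
  rw [abs_lt]; constructor <;> linarith

theorem nextBody_spec {F w : ℕ} (hF : D.Fits w) {sg cur : ℤ} {m₀ : Mem} (hsg : |sg| = 1)
    (hH : D.Holds m₀) (h19 : m₀ (-19) = sg) (h25 : m₀ (-25) = cur)
    {p : ℕ} {s : State} (h : NextInv D w (sg * D.M) cur m₀ p s) (hp : p < D.n * D.n) :
    Tri F nextBody s (2000 * (w + 1)) (NextInv D w (sg * D.M) cur m₀ (p + 1)) := by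
  have hH' := hH.same _ h.same (by norm_num)
  have e19 : s.mem (-19) = sg := (h.same _ (by norm_num)).trans h19
  have e25 : s.mem (-25) = cur := (h.same _ (by norm_num)).trans h25
  have hn := hF.n1
  have hi : p / D.n < D.n := Nat.div_lt_of_lt_mul hp
  have hj : p % D.n < D.n := Nat.mod_lt _ (by omega)
  have hij := Nat.div_add_mod p D.n
  have hnw : (D.n : ℤ) < 2 ^ w := by
    have := h.bdd 0
    rw [hH'.n] at this
    simpa using this
  have hmod : (p : ℤ) - D.n * ((p / D.n : ℕ) : ℤ) = ((p % D.n : ℕ) : ℤ) := by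
    rw [sub_eq_iff_eq_add']
    exact_mod_cast hij.symm
  have hdiv : (p : ℤ) / D.n = ((p / D.n : ℕ) : ℤ) := (Int.natCast_div p D.n).symm
  have hbrk := brk_abs hF hsg hp
  have b1 : |((p / D.n : ℕ) : ℤ)| < 2 ^ w := by
    rw [abs_of_nonneg (by positivity)]; linarith [(by exact_mod_cast hi : ((p / D.n : ℕ) : ℤ) < D.n)]
  have b2 : |((p % D.n : ℕ) : ℤ)| < 2 ^ w := by
    rw [abs_of_nonneg (by positivity)]; linarith [(by exact_mod_cast hj : ((p % D.n : ℕ) : ℤ) < D.n)]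
  have b3 : |(p : ℤ) + 1| < 2 ^ w := by
    rw [abs_of_nonneg (by positivity)]
    have := hF.nn
    linarith [(by exact_mod_cast hp : (p : ℤ) + 1 ≤ D.n * D.n)]
  have n7 : ∀ i : ℕ, ((7 + 3 * (i:ℤ)) = -52) = False ∧ ((7 + 3 * (i:ℤ)) = -51) = False ∧
    ((8 + 3 * (i:ℤ)) = -52) = False ∧ ((8 + 3 * (i:ℤ)) = -51) = False := fun i => by
      simp only [eq_iff_iff, iff_false]; omega
  have hb : sg * D.M * (D.Y (p / D.n) - D.Y (p % D.n)) / (D.X (p / D.n) - D.X (p % D.n)) + 1 =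
    D.brk (sg * D.M) p := rfl
  refine (Tri.block (C := 2000) (Q := fun s' => Same (-26) m₀ s'.mem ∧ s'.mem (-50) = (p + 1 : ℕ) ∧
    s'.mem (-26) = D.nextA (sg * D.M) cur (p + 1))
    hF.w7 (by rfl) (by decide) h.bdd ?_).mono le_rfl
    fun s' h' => ⟨h'.2, h'.1.1, h'.1.2.1, h'.1.2.2, hp⟩
  simp only [nextBody, asg, Prog.wp, val_lit, val_get, val_reg, val_add, val_sub, val_mul, val_div,
      write_mem, h.idx, e19, e25, hH'.M, hH'.n]
  simp only [Int.reduceNeg, Int.reduceEq, ↓reduceIte, h.nx, hdiv, hmod, n7,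
      hH'.X _ hi, hH'.Y _ hi, hH'.X _ hj, hH'.Y _ hj, hb]
  have hsame : ∀ (j z : ℤ) (t : State), j ≤ -26 → Same (-26) m₀ t.mem →
      Same (-26) m₀ (t.write j z).mem := fun j z t hj ht i hi => by
    rw [write_mem, if_neg (by omega)]; exact ht i hi
  simp only [nextA]
  refine ⟨b1, b2, hbrk, fun h1 => ⟨fun h2 => ⟨hbrk, b3, ?_, by push_cast; rfl, ?_⟩,
    fun h2 => ⟨b3, ?_, by push_cast; rfl, ?_⟩⟩, fun h1 => ⟨b3, ?_, by push_cast; rfl, ?_⟩⟩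
  · repeat refine hsame _ _ _ (by norm_num) ?_
    exact h.same
  · rw [if_pos (by omega)]; omega
  · repeat refine hsame _ _ _ (by norm_num) ?_
    exact h.same
  · rw [if_pos (by omega)]; omega
  · repeat refine hsame _ _ _ (by norm_num) ?_
    exact h.same
  · rw [if_neg (by omega)]

theorem next_spec {F w : ℕ} (hF : D.Fits w) {sg cur : ℤ} {s : State} (hsg : |sg| = 1)
    (hH : D.Holds s.mem) (h19 : s.mem (-19) = sg) (h25 : s.mem (-25) = cur) (hB : Bdd w s.mem) :
    Tri F next s ((D.n * D.n + 1) * (3000 * (w + 1))) (fun s' => Bdd w s'.mem ∧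
      Same (-26) s.mem s'.mem ∧ s'.mem (-26) = D.nextA (sg * D.M) cur (D.n * D.n)) := by
  have h0 : (0:ℤ) < 2 ^ w := by positivity
  refine (Tri.seq (c₁ := 100 * (w + 1)) (c₂ := (D.n * D.n) * (100 * (w + 1) + 2000 * (w + 1)) +
    100 * (w + 1)) (Tri.block (Q := fun s' => Same (-26) s.mem s'.mem ∧
      s'.mem (-50) = 0 ∧ s'.mem (-26) = D.Am)
      hF.w7 (by rfl) (by decide) hB ?_) fun s' hs' => ?_).mono (by nlinarith) fun _ => id
  · have hb := hB (-3)
    simp only [asg, Prog.wp, val_lit, val_reg, write_mem, hH.Am, Int.reduceNeg, Int.reduceEq,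
      ↓reduceIte, abs_zero] at hb ⊢
    refine ⟨h0, hb, fun j hj => ?_, trivial, trivial⟩
    simp only [write_mem]
    split_ifs <;> omega
  · obtain ⟨⟨i1, i2, i3⟩, i6⟩ := hs'
    have hs' : NextInv D w (sg * D.M) cur s.mem 0 s' :=
      ⟨i6, i1, by simpa using i2, by simpa [nextA] using i3, by omega⟩
    refine Tri.loop (fun v s' => NextInv D w (sg * D.M) cur s.mem (D.n * D.n - v) s' ∧
      v ≤ D.n * D.n) ?_ ?_ ?_ (v := D.n * D.n) ⟨by simpa using hs', le_rfl⟩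
    · intro v s' hs'
      exact (Expr.cost_le hF.w7 hs'.1.bdd _ rfl).trans (Nat.mul_le_mul_right _ (by decide))
    · intro v s' hs' hg
      have e0 : s'.mem 0 = D.n := (hs'.1.same _ (by norm_num)).trans hH.n
      simp only [val_sub, val_mul, val_reg, hs'.1.idx, e0] at hg
      have hv : 0 < v := by
        by_contra h
        obtain rfl : v = 0 := by omega
        simp at hg
      refine ⟨hv, (nextBody_spec hF hsg hH h19 h25 hs'.1 (by omega)).mono le_rfl
        fun s'' h'' => ⟨?_, by omega⟩⟩
      rwa [show D.n * D.n - v + 1 = D.n * D.n - (v - 1) by omega] at h''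
    · intro v s' hs' hg
      have e0 : s'.mem 0 = D.n := (hs'.1.same _ (by norm_num)).trans hH.n
      have hle := hs'.1.le
      have hx := hs'.1.idx
      simp only [val_sub, val_mul, val_reg, e0, hx] at hg
      have hv : D.n * D.n - v = D.n * D.n := by
        have : ((D.n * D.n : ℕ) : ℤ) ≤ (D.n * D.n - v : ℕ) := by push_cast at hg ⊢; linarith
        omega
      have h := hs'.1
      rw [hv] at h
      exact ⟨h.bdd, h.same, h.nx⟩

theorem colPre_spec {F w : ℕ} (hF : D.Fits w) {sg cur nx : ℤ} {s : State} (hsg : |sg| = 1)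
    (hH : D.Holds s.mem) (h19 : s.mem (-19) = sg) (h25 : s.mem (-25) = cur)
    (h26 : s.mem (-26) = nx) (hcur : -D.Am ≤ cur) (hlt : cur < nx) (hnx : nx ≤ D.Am)
    (hB : Bdd w s.mem) {S : ℕ}
    (hS : S = D.colWt (sg * D.M) cur + D.colWt (sg * D.M) (nx - 1)) (hw : (nx - cur) * S < 2 ^ w) :
    Tri F colPre s (2 * bCost D.n w + 1000 * (w + 1)) (fun s' => Bdd w s'.mem ∧
      Same (-27) s.mem s'.mem ∧ s'.mem (-27) = S ∧ s'.mem (-28) = (nx - cur) * S) := by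
  have hAm := hF.Am1
  obtain ⟨hA, -, -, -⟩ := hF.consts
  have hP : (128 : ℤ) ≤ 2 ^ w := by
    calc (128:ℤ) = 2 ^ 7 := by norm_num
      _ ≤ 2 ^ w := pow_le_pow_right₀ (by norm_num) hF.w7
  have p1 := colWt_pos hF (sg * D.M) cur
  have p2 := colWt_pos hF (sg * D.M) (nx - 1)
  set g₁ := D.colWt (sg * D.M) cur with hg1
  set g₂ := D.colWt (sg * D.M) (nx - 1) with hg2
  have hS2 : (S : ℤ) ≤ (nx - cur) * S := le_mul_of_one_le_left (by positivity) (by omega)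
  have hS3 : (S : ℤ) = g₁ + g₂ := by rw [hS]; push_cast; ring
  have step : ∀ (a b : ℕ) (x y : ℕ), a + (b + (x + (b + y))) ≤ 2 * b + (a + x + y) := by
    intros; omega
  refine (Tri.seq (c₁ := 100 * (w + 1)) (Tri.block (Q := fun s' => Same (-27) s.mem s'.mem ∧
      s'.mem (-30) = cur ∧ s'.mem (-31) = -1) hF.w7 (by rfl) (by decide) hB ?_) fun s₁ h₁ =>
    Tri.seq (c₁ := bCost D.n w) (R := fun s' => Bdd w s'.mem ∧ Same (-27) s.mem s'.mem ∧
      s'.mem (-31) = -1 - g₁) ?_ fun s₂ h₂ =>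
    Tri.seq (c₁ := 200 * (w + 1)) (Tri.block (Q := fun s' => Same (-27) s.mem s'.mem ∧
      s'.mem (-27) = -1 - g₁ ∧ s'.mem (-30) = nx - 1 ∧ s'.mem (-31) = -1)
      hF.w7 (by rfl) (by decide) h₂.1 ?_) fun s₃ h₃ =>
    Tri.seq (c₁ := bCost D.n w) (c₂ := 500 * (w + 1)) (R := fun s' => Bdd w s'.mem ∧
      Same (-27) s.mem s'.mem ∧ s'.mem (-27) = -1 - g₁ ∧ s'.mem (-31) = -1 - g₂) ?_ fun s₄ h₄ =>
    (Tri.block (Q := fun s' => Same (-27) s.mem s'.mem ∧ s'.mem (-27) = S ∧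
      s'.mem (-28) = (nx - cur) * S) hF.w7 (by rfl) (by decide) h₄.1 ?_).mono le_rfl
      fun s' h' => ⟨h'.2, h'.1⟩).mono (by omega) fun _ => id
  · simp only [asg, Prog.wp, val_lit, val_reg, write_mem, h25, Int.reduceNeg, Int.reduceEq,
      ↓reduceIte]
    refine ⟨by rw [abs_lt]; constructor <;> linarith, by rw [abs_lt]; constructor <;> linarith,
      fun j hj => ?_, trivial, trivial⟩
    simp only [write_mem]
    split_ifs <;> omega
  · obtain ⟨⟨f1, f2, f3⟩, f4⟩ := h₁
    refine (bWalk_spec hF hsg hcur (by omega) (hH.same _ f1 (by norm_num))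
      ((f1 _ (by norm_num)).trans h19) f2 f3 f4 ?_).mono le_rfl fun s' h' =>
      ⟨h'.1, f1.trans (h'.2.1.mono (by norm_num)), h'.2.2.1⟩
    rw [← hg1, abs_neg, abs_one]; linarith
  · obtain ⟨f1, f2, f3⟩ := h₂
    simp only [asg, Prog.wp, val_lit, val_reg, val_sub, write_mem, f3, f2 (-26) (by norm_num), h26,
      Int.reduceNeg, Int.reduceEq, ↓reduceIte]
    refine ⟨by rw [abs_lt]; constructor <;> linarith, by rw [abs_lt]; constructor <;> linarith,
      by rw [abs_lt]; constructor <;> linarith, fun j hj => ?_, trivial, trivial, trivial⟩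
    simp only [write_mem]
    split_ifs <;> first | omega | exact f2 j hj
  · obtain ⟨⟨f1, f2, f3, f5⟩, f4⟩ := h₃
    refine (bWalk_spec hF hsg (by omega) (by omega) (hH.same _ f1 (by norm_num))
      ((f1 _ (by norm_num)).trans h19) f3 f5 f4 ?_).mono le_rfl fun s' h' =>
      ⟨h'.1, f1.trans (h'.2.1.mono (by norm_num)), (h'.2.1 _ (by norm_num)).trans f2, h'.2.2.1⟩
    rw [← hg2, abs_neg, abs_one]; linarith
  · obtain ⟨f1, f2, f3, f5⟩ := h₄
    have e : (-2 : ℤ) - (-1 - g₁ + (-1 - g₂)) = S := by rw [hS3]; ring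
    simp only [asg, Prog.wp, val_lit, val_reg, val_sub, val_add, val_mul, write_mem, f3, f5,
      f2 (-26) (by norm_num), f2 (-25) (by norm_num), h26, h25,
      Int.reduceNeg, Int.reduceEq, ↓reduceIte, e]
    refine ⟨by rw [abs_lt]; constructor <;> linarith, by rw [abs_lt]; constructor <;> linarith,
      fun j hj => ?_, trivial, trivial⟩
    simp only [write_mem]
    split_ifs <;> first | omega | exact f2 j hj

/-- The intercept that `bWalk` finds is the one that `pick` describes. -/
theorem Falls_eq_pick {c A B : ℤ} {r : ℕ} (hB : 1 ≤ D.Bm) (hr : r < D.colWt c A)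
    (h : Falls (D.wt c A) (-D.Bm) r B) :
    B = pick (D.wt c A) (-D.Bm) (2 * D.Bm).toNat r := by
  refine h.unique (falls_pick _ _ _ _ ?_)
  rwa [show -D.Bm + ((2 * D.Bm).toNat : ℤ) = D.Bm by omega]

theorem colSel_spec {F w : ℕ} (hF : D.Fits w) {sg cur nx : ℤ} {s : State} (hsg : |sg| = 1)
    (hH : D.Holds s.mem) (h19 : s.mem (-19) = sg) (h25 : s.mem (-25) = cur)
    (h26 : s.mem (-26) = nx) (hcur : -D.Am ≤ cur) {m : ℕ} (hm : nx = cur + m) (hnx : nx ≤ D.Am)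
    (hnext : nx = D.nextA (sg * D.M) cur (D.n * D.n))
    (hB : Bdd w s.mem) {S u : ℕ} (h27 : s.mem (-27) = S) (h20 : s.mem (-20) = u)
    (hS : S = D.colWt (sg * D.M) cur + D.colWt (sg * D.M) (nx - 1)) (hw : 2 * (m * S : ℤ) < 2 ^ w)
    (hu : u < m * S) :
    Tri F colSel s (2 * bCost D.n w + 1000 * (w + 1)) (fun s' => Bdd w s'.mem ∧
      (∀ j, -29 < j → j ≠ -21 → j ≠ -22 → j ≠ -23 → j ≠ -24 → s'.mem j = s.mem j) ∧
      s'.mem (-21) = 1 ∧ s'.mem (-23) = sg * D.M ∧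
      (s'.mem (-22), s'.mem (-24)) = D.pickPair (sg * D.M) cur m S u) := by
  have hAm := hF.Am1
  obtain ⟨hA, hBw, hB1, -⟩ := hF.consts
  have hP : (128 : ℤ) ≤ 2 ^ w := by
    calc (128:ℤ) = 2 ^ 7 := by norm_num
      _ ≤ 2 ^ w := pow_le_pow_right₀ (by norm_num) hF.w7
  have p1 := colWt_pos hF (sg * D.M) cur
  have hS0 : 0 < S := by omega
  have ha : u / S < m := Nat.div_lt_of_lt_mul (by rwa [mul_comm])
  have hr : u % S < S := Nat.mod_lt _ hS0
  have hmS : S ≤ m * S := Nat.le_mul_of_pos_left _ ((Nat.zero_le _).trans_lt ha)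
  have hSw : 2 * (S : ℤ) < 2 ^ w := by
    have : (S : ℤ) ≤ m * S := by exact_mod_cast hmS
    omega
  have hdm := Nat.div_add_mod u S
  have hdiv : (u : ℤ) / S = ((u / S : ℕ) : ℤ) := (Int.natCast_div u S).symm
  have hpp : ∀ A A' : ℤ, A = cur + (u / S : ℕ) → A' = cur + (cur + m - 1) - A →
      D.pickPair (sg * D.M) cur m S u = if u % S < D.colWt (sg * D.M) A
      then (A, pick (D.wt (sg * D.M) A) (-D.Bm) (2 * D.Bm).toNat (u % S))
      else (A', pick (D.wt (sg * D.M) A') (-D.Bm) (2 * D.Bm).toNat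
        (u % S - D.colWt (sg * D.M) A)) := by
    rintro A A' rfl rfl
    rfl
  obtain ⟨q, hq⟩ : ∃ q, q = u / S := ⟨_, rfl⟩
  obtain ⟨r, hrdef⟩ : ∃ r, r = u % S := ⟨_, rfl⟩
  rw [← hq] at ha hdm hdiv hpp
  rw [← hrdef] at hr hdm hpp
  have hmod : (u : ℤ) - S * q = r := by
    rw [sub_eq_iff_eq_add']
    exact_mod_cast hdm.symm
  have hM := hB (-2)
  rw [hH.M] at hM
  obtain ⟨A, hAdef⟩ : ∃ A, A = cur + (q : ℤ) := ⟨_, rfl⟩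
  obtain ⟨A', hA'def⟩ : ∃ A', A' = cur + (cur + m - 1) - A := ⟨_, rfl⟩
  have hsum := colWt_add_colWt hF (sg := sg) (cur := cur) (A := A)
    (A' := A') hsg hcur (by omega) (by omega) (by rw [← hnext, hm]; omega)
  rw [← hnext, ← hS] at hsum
  replace hpp := hpp A A' hAdef hA'def
  refine (Tri.seq (c₁ := 200 * (w + 1)) (Tri.block (Q := fun s' => Same (-29) s.mem s'.mem ∧
      s'.mem (-30) = A ∧ s'.mem (-31) = r) hF.w7 (by rfl) (by decide) hB ?_) fun s₁ h₁ =>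
    Tri.seq (c₁ := bCost D.n w) (R := fun s' => Bdd w s'.mem ∧ Same (-29) s.mem s'.mem ∧
      s'.mem (-30) = A ∧ s'.mem (-31) = r - D.colWt (sg * D.M) A ∧
      (r < D.colWt (sg * D.M) A →
        s'.mem (-32) = pick (D.wt (sg * D.M) A) (-D.Bm) (2 * D.Bm).toNat r)) ?_ fun s₂ h₂ =>
    Tri.seq (c₁ := 100 * (w + 1) + (200 * (w + 1) + bCost D.n w)) (c₂ := 200 * (w + 1))
      (R := fun s' => Bdd w s'.mem ∧ Same (-29) s.mem s'.mem ∧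
        (s'.mem (-30), s'.mem (-32)) = D.pickPair (sg * D.M) cur m S u) ?_ fun s₃ h₃ =>
    (Tri.block (Q := fun s' =>
      (∀ j, -29 < j → j ≠ -21 → j ≠ -22 → j ≠ -23 → j ≠ -24 → s'.mem j = s.mem j) ∧
      s'.mem (-21) = 1 ∧ s'.mem (-23) = sg * D.M ∧
      (s'.mem (-22), s'.mem (-24)) = D.pickPair (sg * D.M) cur m S u)
      hF.w7 (by rfl) (by decide) h₃.1 ?_).mono le_rfl
      fun s' h' => ⟨h'.2, h'.1⟩).mono (by omega) fun _ => id
  · simp only [asg, Prog.wp, val_lit, val_reg, val_add, val_sub, val_mul, val_div, write_mem, h25,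
      h20, h27, hdiv, hmod, ← hAdef, Int.reduceNeg, Int.reduceEq, ↓reduceIte]
    refine ⟨by rw [abs_lt]; constructor <;> omega,
      by rw [abs_lt]; constructor <;> omega, fun j hj => ?_, trivial, trivial⟩
    simp only [write_mem]
    split_ifs <;> omega
  · obtain ⟨⟨f1, f2, f3⟩, f4⟩ := h₁
    refine (bWalk_spec hF hsg (by omega) (by omega) (hH.same _ f1 (by norm_num))
      ((f1 _ (by norm_num)).trans h19) f2 f3 f4 ?_).mono le_rfl fun s' h' =>
      ⟨h'.1, f1.trans (h'.2.1.mono (by norm_num)), (h'.2.1 _ (by norm_num)).trans f2, h'.2.2.1,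
        fun hlt => Falls_eq_pick hB1 hlt (h'.2.2.2 (by positivity) (by exact_mod_cast hlt))⟩
    rw [abs_of_nonneg (by positivity)]
    omega
  · obtain ⟨f1, f2, f3, f4, f5⟩ := h₂
    refine Tri.ite (Expr.cost_le hF.w7 f1 _ rfl |>.trans (Nat.mul_le_mul_right _ (by decide)))
      (fun hc => ?_) (fun hc => ?_)
    · simp only [val_add, val_reg, val_lit, f4] at hc
      refine Tri.seq (Tri.block (Q := fun s' => Same (-29) s.mem s'.mem ∧ s'.mem (-30) = A' ∧
        s'.mem (-31) = r - D.colWt (sg * D.M) A) hF.w7 (by rfl) (by decide) f1 ?_) fun s₃ h₃ => ?_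
      · simp only [asg, Prog.wp, val_lit, val_reg, val_add, val_sub, write_mem,
          f2 (-25) (by norm_num), f2 (-26) (by norm_num), h25, h26, f3, f4, hm, ← hA'def,
          Int.reduceNeg, Int.reduceEq, ↓reduceIte]
        refine ⟨by rw [abs_lt]; constructor <;> omega, fun j hj => ?_, trivial, trivial⟩
        simp only [write_mem]
        split_ifs <;> first | omega | exact f2 j hj
      · obtain ⟨⟨g1, g2, g3⟩, g4⟩ := h₃
        have hcast : (r : ℤ) - D.colWt (sg * D.M) A = (r - D.colWt (sg * D.M) A : ℕ) := by omega
        have hlt : r - D.colWt (sg * D.M) A < D.colWt (sg * D.M) A' := by omega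
        rw [hcast] at g3
        refine (bWalk_spec hF hsg (by omega) (by omega) (hH.same _ g1 (by norm_num))
          ((g1 _ (by norm_num)).trans h19) g2 g3 g4 ?_).mono le_rfl fun s' h' =>
          ⟨h'.1, g1.trans (h'.2.1.mono (by norm_num)), ?_⟩
        · rw [abs_of_nonneg (by positivity)]
          omega
        · rw [hpp, if_neg (by omega), (h'.2.1 _ (by norm_num)).trans g2,
            Falls_eq_pick hB1 hlt (h'.2.2.2 (by positivity) (by exact_mod_cast hlt))]
    · simp only [val_add, val_reg, val_lit, f4] at hc
      refine (Tri.of_wp hF.w7 .skip (fun s' => s' = s₂) s₂ rfl f1 rfl).mono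
        (by simp [Prog.cst]; nlinarith) ?_
      rintro s' ⟨rfl, -⟩
      exact ⟨f1, f2, by rw [hpp, if_pos (by omega), f3, f5 (by omega)]⟩
  · obtain ⟨f1, f2, f3⟩ := h₃
    have b30 := f1 (-30)
    have b32 := f1 (-32)
    simp only [asg, Prog.wp, val_lit, val_reg, val_mul, write_mem,
      f2 (-19) (by norm_num), f2 (-2) (by norm_num), h19, hH.M,
      Int.reduceNeg, Int.reduceEq, ↓reduceIte]
    refine ⟨by rw [abs_one]; linarith, b30, by rw [abs_mul, hsg, one_mul]; exact hM, b32,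
      fun j hj h1 h2 h3 h4 => ?_, trivial, trivial, f3⟩
    split_ifs <;> first | omega | exact f2 j hj

end Data

/-- `Tri` for a loop of which at most `f` iterations may be executed. -/
def TriLoop (F f : ℕ) (e : Expr) (p : Prog) (s : State) (c : ℕ) (Q : State → Prop) : Prop :=
  c ≤ F → ∃ s' t, whileRun e (p.run F) f s = PMF.pure (some (s', t)) ∧ t ≤ c ∧ Q s'

theorem TriLoop.exit {F f : ℕ} {e : Expr} {p : Prog} {s : State} {c : ℕ} {Q : State → Prop}
    (h : ¬ 0 < e.val s.mem) (hc : e.cost s.mem ≤ c) (hQ : Q s) : TriLoop F f e p s c Q :=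
  fun _ => ⟨s, e.cost s.mem, by cases f <;> simp [whileRun, h], hc, hQ⟩

theorem TriLoop.next {F f : ℕ} {e : Expr} {p : Prog} {s : State} {g c₁ c₂ : ℕ} {R Q : State → Prop}
    (h : 0 < e.val s.mem) (hg : e.cost s.mem ≤ g) (h₁ : Tri F p s c₁ R)
    (h₂ : ∀ s', R s' → TriLoop F f e p s' c₂ Q) :
    TriLoop F (f + 1) e p s (g + c₁ + c₂) Q := fun hF => by
  obtain ⟨s', t, e1, ht, hR⟩ := h₁ (by omega)
  obtain ⟨s'', t', e2, ht', hQ⟩ := h₂ s' hR (by omega)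
  refine ⟨s'', e.cost s.mem + (t + t'), ?_, by omega, hQ⟩
  simp [whileRun, h, e1, andThen_pure, e2, PMF.pure_map, Outcome.delay]

theorem TriLoop.mono {F f : ℕ} {e : Expr} {p : Prog} {s : State} {c c' : ℕ} {Q Q' : State → Prop}
    (h : TriLoop F f e p s c Q) (hc : c ≤ c') (hQ : ∀ s', Q s' → Q' s') :
    TriLoop F f e p s c' Q' := fun hF => by
  obtain ⟨s', t, h1, h2, h3⟩ := h (hc.trans hF)
  exact ⟨s', t, h1, h2.trans hc, hQ _ h3⟩

namespace Data
variable {D : Data}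

/-- The bound on the time of one iteration of `aLoop`. -/
def aCost (n w : ℕ) : ℕ := (n * n + 1) * (3000 * (w + 1)) + 4 * bCost n w + 4000 * (w + 1)

/-- `dec` meets every candidate with slope in `[cur, Am)` and factor `c` at `2 * x` of the positions
below `2 * cum (colWt c) cur Am`, where `x` is the weight of the candidate. -/
def Decodes (D : Data) (c cur : ℤ) (dec : ℕ → ℤ × ℤ) : Prop :=
  ∀ φ : ℤ × ℤ → ENNReal, ∑ u ∈ Finset.range (2 * cum (D.colWt c) cur D.Am), φ (dec u) =
    2 * ∑ A ∈ Finset.Ico cur D.Am, D.colSum c φ A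

/-- The effect of a pass through the candidates from the state `s` to the state `s'`: the position
moves on by `tot`, and if it falls on a candidate then this candidate is selected. -/
structure Passes (w : ℕ) (tot : ℕ) (sel : ℕ → ℤ × ℤ × ℤ) (u : ℤ) (s s' : State) : Prop where
  bdd : Bdd w s'.mem
  pos : s'.mem (-20) = u - tot
  keep : u < 0 ∨ tot ≤ u → ∀ j, j = -21 ∨ j = -22 ∨ j = -23 ∨ j = -24 → s'.mem j = s.mem j
  flag : 0 ≤ u → u < tot → s'.mem (-21) = 1
  sel : ∀ v : ℕ, u = v → v < tot → (s'.mem (-22), s'.mem (-24), s'.mem (-23)) = sel v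

theorem Passes.trans {w t₁ t₂ : ℕ} {sel₁ sel₂ sel : ℕ → ℤ × ℤ × ℤ} {u : ℤ} {s s' s'' : State}
    (h₁ : Passes w t₁ sel₁ u s s') (h₂ : Passes w t₂ sel₂ (u - t₁) s' s'')
    (hsel : ∀ p, sel p = if p < t₁ then sel₁ p else sel₂ (p - t₁)) :
    Passes w (t₁ + t₂) sel u s s'' where
  bdd := h₂.bdd
  pos := by rw [h₂.pos]; push_cast; ring
  keep h j hj := by
    push_cast at h
    rw [h₂.keep (by omega) j hj, h₁.keep (by omega) j hj]
  flag h0 h1 := by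
    push_cast at h1
    by_cases h : u < t₁
    · rw [h₂.keep (by omega) _ (by simp), h₁.flag h0 h]
    · exact h₂.flag (by omega) (by omega)
  sel v h0 h1 := by
    rw [hsel]
    split_ifs with h
    · rw [h₂.keep (by omega) _ (by simp), h₂.keep (by omega) _ (by simp),
        h₂.keep (by omega) _ (by simp), h₁.sel v h0 h]
    · exact h₂.sel _ (by omega) (by omega)

theorem aBody_spec {F w : ℕ} (hF : D.Fits w) {sg cur u : ℤ} {s : State} (hsg : |sg| = 1)
    (hH : D.Holds s.mem) (h19 : s.mem (-19) = sg) (h25 : s.mem (-25) = cur)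
    (hcur : -D.Am ≤ cur) (hlt : cur < D.Am) (hB : Bdd w s.mem) {m S : ℕ} (h20 : s.mem (-20) = u)
    (hm : D.nextA (sg * D.M) cur (D.n * D.n) = cur + m)
    (hS : S = D.colWt (sg * D.M) cur + D.colWt (sg * D.M) (cur + m - 1))
    (hw : |u| + 2 * (m * S) < 2 ^ w) :
    Tri F (RAM.next ;; colPre ;;
    .ite (reg (-20) + lit 1) (.ite (reg (-28) - reg (-20)) colSel .skip) .skip ;;
    (asg (-20) (reg (-20) - reg (-28)) ;; asg (-25) (reg (-26)))) s (aCost D.n w)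
      (fun s' => Same (-20) s.mem s'.mem ∧ s'.mem (-25) = cur + m ∧
        Passes w (m * S) (fun v => ((D.pickPair (sg * D.M) cur m S v).1,
          (D.pickPair (sg * D.M) cur m S v).2, sg * D.M)) u s s') := by
  have hlt' := lt_nextA (c := sg * D.M) hlt (D.n * D.n)
  have hle' := nextA_le (D := D) (sg * D.M) cur (D.n * D.n)
  have hu := abs_lt.1 (hB (-20))
  rw [h20] at hu
  have hmS : (0 : ℤ) ≤ m * S := by positivity
  have hua := abs_nonneg u
  refine (Tri.seq (next_spec hF hsg hH h19 h25 hB) fun s₁ h₁ => ?_ : Tri F _ _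
    ((D.n * D.n + 1) * (3000 * (w + 1)) + ((2 * bCost D.n w + 1000 * (w + 1)) +
      ((100 * (w + 1) + (100 * (w + 1) + (2 * bCost D.n w + 1000 * (w + 1)))) + 200 * (w + 1)))) _).mono
      (by unfold aCost; omega) fun _ => id
  obtain ⟨B1, S1, e26⟩ := h₁
  rw [hm] at e26
  refine Tri.seq (colPre_spec (S := S) hF hsg (hH.same _ S1 (by norm_num)) ((S1 _ (by norm_num)).trans h19)
    ((S1 _ (by norm_num)).trans h25) e26 hcur (by omega) (by omega) B1 hS (by
      rw [add_sub_cancel_left]; linarith)) fun s₂ h₂ => ?_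
  obtain ⟨B2, S2, e27, e28⟩ := h₂
  rw [add_sub_cancel_left] at e28
  have f20 : s₂.mem (-20) = u := (S2 _ (by norm_num)).trans ((S1 _ (by norm_num)).trans h20)
  have f25 : s₂.mem (-25) = cur := (S2 _ (by norm_num)).trans ((S1 _ (by norm_num)).trans h25)
  have f26 : s₂.mem (-26) = cur + m := (S2 _ (by norm_num)).trans e26
  have S12 : ∀ j, -26 < j → s₂.mem j = s.mem j := fun j hj =>
    (S2 _ (by omega)).trans (S1 _ (by omega))
  refine Tri.seq (R := fun s' => Bdd w s'.mem ∧
      (∀ j, -29 < j → j ≠ -21 → j ≠ -22 → j ≠ -23 → j ≠ -24 → s'.mem j = s₂.mem j) ∧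
      (u < 0 ∨ m * S ≤ u → ∀ j, j = -21 ∨ j = -22 ∨ j = -23 ∨ j = -24 → s'.mem j = s.mem j) ∧
      (0 ≤ u → u < m * S → s'.mem (-21) = 1) ∧
      ∀ v : ℕ, u = v → v < m * S → (s'.mem (-22), s'.mem (-24), s'.mem (-23)) =
        ((D.pickPair (sg * D.M) cur m S v).1, (D.pickPair (sg * D.M) cur m S v).2, sg * D.M))
    ?_ fun s₃ h₃ => ?_
  · have keep : ∀ s', s' = s₂ → ∀ j, j = -21 ∨ j = -22 ∨ j = -23 ∨ j = -24 →
        s'.mem j = s.mem j := by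
      rintro _ rfl j hj
      exact S12 j (by omega)
    have hskip : ∀ Q : State → Prop, Q s₂ →
        Tri F .skip s₂ (2 * bCost D.n w + 1000 * (w + 1)) Q := fun Q hQ =>
      (Tri.of_wp hF.w7 .skip (fun s' => s' = s₂) s₂ rfl B2 rfl).mono
        (by simp [Prog.cst]; omega) (by rintro s' ⟨rfl, -⟩; exact hQ)
    refine Tri.ite (Expr.cost_le hF.w7 B2 _ rfl |>.trans (Nat.mul_le_mul_right _ (by decide)))
      (fun hc => Tri.ite (Expr.cost_le hF.w7 B2 _ rfl |>.trans
        (Nat.mul_le_mul_right _ (by decide))) (fun hc2 => ?_) (fun hc2 => ?_)) (fun hc => ?_)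
    · simp only [val_add, val_sub, val_reg, val_lit, f20, e28] at hc hc2
      obtain ⟨v, rfl⟩ : ∃ v : ℕ, u = v := ⟨u.toNat, by omega⟩
      have hv : v < m * S := by
        have : (v : ℤ) < m * S := by omega
        exact_mod_cast this
      refine (colSel_spec hF hsg (hH.same (-26) S12 (by norm_num))
        ((S12 _ (by norm_num)).trans h19) f25 f26 hcur rfl (by omega) hm.symm B2 e27 f20 hS
        (by linarith) hv).mono le_rfl fun s' h' => ⟨h'.1, h'.2.1, fun h => ?_, fun _ _ => h'.2.2.1,
          fun v' h1 h2 => ?_⟩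
      · omega
      · obtain rfl : v = v' := by exact_mod_cast h1
        rw [← h'.2.2.2.2, h'.2.2.2.1]
    · simp only [val_add, val_sub, val_reg, val_lit, f20, e28] at hc hc2
      exact hskip _ ⟨B2, fun _ _ _ _ _ _ => rfl, fun _ => keep _ rfl, fun h1 h2 => by omega,
        fun v h1 h2 => by have : (v : ℤ) < m * S := by exact_mod_cast h2
                          omega⟩
    · simp only [val_add, val_reg, val_lit, f20] at hc
      refine (hskip _ ⟨B2, fun _ _ _ _ _ _ => rfl, fun _ => keep _ rfl, fun h1 h2 => by omega,
        fun v h1 h2 => by omega⟩).mono (by omega) fun _ => id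
  · obtain ⟨B3, S3, k1, k2, k3⟩ := h₃
    have g20 := (S3 (-20) (by norm_num) (by norm_num) (by norm_num) (by norm_num) (by norm_num)).trans f20
    have g26 := (S3 (-26) (by norm_num) (by norm_num) (by norm_num) (by norm_num) (by norm_num)).trans f26
    have g28 := (S3 (-28) (by norm_num) (by norm_num) (by norm_num) (by norm_num) (by norm_num)).trans e28
    have b26 := B3 (-26)
    rw [g26] at b26
    refine (Tri.block (Q := fun s' => Same (-20) s.mem s'.mem ∧ s'.mem (-25) = cur + m ∧
      s'.mem (-20) = u - m * S ∧
      ∀ j, j = -21 ∨ j = -22 ∨ j = -23 ∨ j = -24 → s'.mem j = s₃.mem j)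
      hF.w7 (by rfl) (by decide) B3 ?_).mono le_rfl
      fun s' h' => ⟨h'.1.1, h'.1.2.1, h'.2, by rw [h'.1.2.2.1]; push_cast; rfl, fun h j hj =>
        (h'.1.2.2.2 j hj).trans (k1 (by push_cast at h; exact h) j hj),
        fun h1 h2 => (h'.1.2.2.2 _ (by simp)).trans (k2 h1 (by push_cast at h2; exact h2)),
        fun v h1 h2 => by
          rw [h'.1.2.2.2 _ (by simp), h'.1.2.2.2 _ (by simp), h'.1.2.2.2 _ (by simp)]
          exact k3 v h1 h2⟩
    simp only [asg, Prog.wp, val_lit, val_reg, val_sub, write_mem, g20, g26, g28,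
      Int.reduceNeg, Int.reduceEq, ↓reduceIte]
    refine ⟨by rw [abs_lt]; rcases abs_cases u with h | h <;> constructor <;> linarith, b26,
      fun j hj => ?_, trivial, trivial, fun j hj => ?_⟩
    · simp only [write_mem]
      rw [if_neg (by omega), if_neg (by omega), S3 j (by omega) (by omega) (by omega) (by omega) (by omega),
        S12 j (by omega)]
    · rw [if_neg (by omega), if_neg (by omega)]

/-- Induction over the intervals of slopes between consecutive break points, of which at most `v`
remain. -/
theorem aLoop_aux {F w : ℕ} (hF : D.Fits w) {sg : ℤ} (hsg : |sg| = 1) :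
    ∀ (v : ℕ) (cur : ℤ), -D.Am ≤ cur → cur ≤ D.Am →
      (cur < D.Am → D.brksFrom (sg * D.M) cur < v) →
      ∃ dec, D.Decodes (sg * D.M) cur dec ∧ ∀ f, v ≤ f → ∀ (s : State) (u : ℤ), D.Holds s.mem →
        s.mem (-19) = sg → s.mem (-25) = cur → s.mem (-20) = u → Bdd w s.mem →
        |u| + 4 * cum (D.colWt (sg * D.M)) cur D.Am < 2 ^ w →
        TriLoop F f (reg (-3) - reg (-25)) (RAM.next ;; colPre ;;
          .ite (reg (-20) + lit 1) (.ite (reg (-28) - reg (-20)) colSel .skip) .skip ;;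
          (asg (-20) (reg (-20) - reg (-28)) ;; asg (-25) (reg (-26)))) s
          (v * (100 * (w + 1) + aCost D.n w) + 100 * (w + 1)) (fun s' => Same (-20) s.mem s'.mem ∧
          Passes w (2 * cum (D.colWt (sg * D.M)) cur D.Am)
            (fun p => ((dec p).1, (dec p).2, sg * D.M)) u s s') := by
  intro v
  induction v with
  | zero =>
    intro cur h1 h2 h3
    have hcur : cur = D.Am := by by_contra h; have := h3 (by omega); omega
    subst hcur
    refine ⟨fun _ => 0, fun φ => by simp [cum_self], fun f _ s u hH h19 h25 h20 hB hw => ?_⟩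
    refine TriLoop.exit (by simp [hH.Am, h25])
      ((Expr.cost_le hF.w7 hB _ rfl).trans ((Nat.mul_le_mul_right _ (by decide : _ ≤ 100)).trans
        (by omega))) ⟨Same.refl _ _, hB, by simp [cum_self, h20], fun _ _ _ => rfl, ?_, ?_⟩
    · intro h1 h2; simp [cum_self] at h2; omega
    · intro v h1 h2; simp [cum_self] at h2
  | succ v ih =>
    intro cur h1 h2 h3
    rcases h2.lt_or_eq with hlt | hcur
    swap
    · subst hcur
      refine ⟨fun _ => 0, fun φ => by simp [cum_self], fun f _ s u hH h19 h25 h20 hB hw => ?_⟩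
      refine TriLoop.exit (by simp [hH.Am, h25])
        ((Expr.cost_le hF.w7 hB _ rfl).trans ((Nat.mul_le_mul_right _ (by decide : _ ≤ 100)).trans
          (by omega))) ⟨Same.refl _ _, hB, by simp [cum_self, h20], fun _ _ _ => rfl, ?_, ?_⟩
      · intro h1 h2; simp [cum_self] at h2; omega
      · intro v h1 h2; simp [cum_self] at h2
    have hlt' := lt_nextA (c := sg * D.M) hlt (D.n * D.n)
    have hle' := nextA_le (D := D) (sg * D.M) cur (D.n * D.n)
    have hbrk := fun h => brksFrom_nextA (D := D) (c := sg * D.M) hlt h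
    obtain ⟨m, hm⟩ : ∃ m : ℕ, D.nextA (sg * D.M) cur (D.n * D.n) = cur + m :=
      ⟨(D.nextA (sg * D.M) cur (D.n * D.n) - cur).toNat, by omega⟩
    obtain ⟨S, hS⟩ : ∃ S, S = D.colWt (sg * D.M) cur + D.colWt (sg * D.M) (cur + m - 1) := ⟨_, rfl⟩
    have hS0 : 0 < S := by have := colWt_pos hF (sg * D.M) cur; omega
    have hmS := two_mul_cum_colWt hF hsg h1 hm hS hS0
    have hadd := cum_add (D.colWt (sg * D.M)) (show cur ≤ cur + m by omega)
      (show cur + m ≤ D.Am by omega)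
    rw [hm] at hbrk hle' hlt'
    obtain ⟨dec, hdec, hrun⟩ := ih (cur + m) (by omega) hle' fun h => by
      have := h3 hlt
      have := hbrk h
      omega
    refine ⟨fun p => if p < m * S then D.pickPair (sg * D.M) cur m S p else dec (p - m * S),
      fun φ => ?_, fun f hf s u hH h19 h25 h20 hB hw => ?_⟩
    · rw [← hadd, mul_add, ← hmS, Finset.sum_range_add,
        Finset.sum_congr rfl (g := fun p => φ (D.pickPair (sg * D.M) cur m S p)) fun p hp => by
          beta_reduce; rw [if_pos (Finset.mem_range.1 hp)],
        sum_pickPair hF hsg h1 hm hS hS0, ← Finset.Ico_union_Ico_eq_Ico (show cur ≤ cur + m by omega) hle',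
        Finset.sum_union (Finset.Ico_disjoint_Ico_consecutive _ _ _), mul_add, ← hdec φ]
      congr 1
      refine Finset.sum_congr rfl fun p _ => ?_
      beta_reduce
      rw [if_neg (by omega), Nat.add_sub_cancel_left]
    · obtain ⟨f, rfl⟩ : ∃ f', f = f' + 1 := ⟨f - 1, by omega⟩
      have hmS' : (m * S : ℤ) = 2 * cum (D.colWt (sg * D.M)) cur (cur + m) := by exact_mod_cast hmS
      have hadd' : (cum (D.colWt (sg * D.M)) cur (cur + m) : ℤ) +
        cum (D.colWt (sg * D.M)) (cur + m) D.Am = cum (D.colWt (sg * D.M)) cur D.Am := by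
          exact_mod_cast hadd
      have hnn : (0:ℤ) ≤ cum (D.colWt (sg * D.M)) (cur + m) D.Am := by positivity
      have hnn2 : (0:ℤ) ≤ m * S := by positivity
      refine (TriLoop.next (g := 100 * (w + 1)) (by simp [hH.Am, h25]; exact hlt)
        ((Expr.cost_le hF.w7 hB _ rfl).trans (Nat.mul_le_mul_right _ (by decide)))
        (aBody_spec hF hsg hH h19 h25 h1 hlt hB h20 hm hS (by linarith))
        fun s' h' => (hrun f (by omega) s' (u - (m * S : ℕ)) (hH.same _ h'.1 (by norm_num))
          ((h'.1 _ (by norm_num)).trans h19) h'.2.1 h'.2.2.pos h'.2.2.bdd ?_).mono le_rfl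
          fun s'' h'' => ⟨h'.1.trans h''.1, ?_⟩).mono (le_of_eq (by ring)) fun _ => id
      · push_cast
        have := abs_sub u (m * S)
        rw [abs_of_nonneg hnn2] at this
        linarith
      · rw [← hadd, mul_add, ← hmS]
        exact h'.2.2.trans h''.2 fun p => by beta_reduce; split_ifs <;> rfl

end Data

/-- Passes once through all candidates. -/
def walk : Prog :=
  (asg (-19) (lit 1) ;; asg (-25) (lit 0 - reg (-3))) ;; aLoop ;;
  (asg (-19) (lit (-1)) ;; asg (-25) (lit 0 - reg (-3))) ;; aLoop

namespace Data
variable {D : Data}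

/-- The bound on the time of `aLoop`. -/
def aTotal (n w : ℕ) : ℕ := (n * n + 1) * (100 * (w + 1) + aCost n w) + 100 * (w + 1)

theorem aLoop_spec {F w : ℕ} (hF : D.Fits w) {sg : ℤ} (hsg : |sg| = 1) :
    ∃ dec, D.Decodes (sg * D.M) (-D.Am) dec ∧ ∀ (s : State) (u : ℤ), D.Holds s.mem →
      s.mem (-19) = sg → s.mem (-25) = -D.Am → s.mem (-20) = u → Bdd w s.mem →
      |u| + 4 * cum (D.colWt (sg * D.M)) (-D.Am) D.Am < 2 ^ w →
      Tri F aLoop s (aTotal D.n w) (fun s' => Same (-20) s.mem s'.mem ∧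
          Passes w (2 * cum (D.colWt (sg * D.M)) (-D.Am) D.Am)
            (fun p => ((dec p).1, (dec p).2, sg * D.M)) u s s') := by
  have hA := hF.Am1
  have hb : D.brksFrom (sg * D.M) (-D.Am) < D.n * D.n + 1 := Nat.lt_succ_of_le (brksFrom_le _ _)
  obtain ⟨dec, h, h'⟩ := aLoop_aux (F := F) hF hsg (D.n * D.n + 1) (-D.Am) le_rfl (by omega)
    fun _ => hb
  refine ⟨dec, h, fun s u h1 h2 h3 h4 h5 h6 hc => h' F ?_ s u h1 h2 h3 h4 h5 h6 hc⟩
  have : D.n * D.n + 1 ≤ (D.n * D.n + 1) * (100 * (w + 1) + aCost D.n w) :=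
    Nat.le_mul_of_pos_right _ (by omega)
  unfold aTotal at hc
  omega

/-- The candidates `(A, B, c)`. -/
noncomputable def cands (D : Data) : Finset (ℤ × ℤ × ℤ) :=
  Finset.Ico (-D.Am) D.Am ×ˢ Finset.Ico (-D.Bm) D.Bm ×ˢ {D.M, -D.M}

/-- The total weight of the candidates. -/
noncomputable def total (D : Data) : ℕ := ∑ h ∈ D.cands, D.wt h.2.2 h.1 h.2.1

theorem sum_cands {R : Type*} [CommSemiring R] (hM : 0 < D.M) (φ : ℤ × ℤ × ℤ → R) :
    ∑ h ∈ D.cands, (D.wt h.2.2 h.1 h.2.1 : R) * φ h =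
      ∑ A ∈ Finset.Ico (-D.Am) D.Am, D.colSum (1 * D.M) (fun q => φ (q.1, q.2, 1 * D.M)) A +
      ∑ A ∈ Finset.Ico (-D.Am) D.Am, D.colSum (-1 * D.M) (fun q => φ (q.1, q.2, -1 * D.M)) A := by
  have hne : D.M ≠ -D.M := by omega
  simp only [cands, Finset.sum_product, Finset.sum_pair hne, Finset.sum_add_distrib, colSum,
    one_mul, neg_one_mul]

theorem total_eq (hM : 0 < D.M) : D.total = cum (D.colWt (1 * D.M)) (-D.Am) D.Am +
    cum (D.colWt (-1 * D.M)) (-D.Am) D.Am := by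
  have := sum_cands (R := ℕ) hM fun _ => 1
  simpa [colSum_one, cum, total] using this

/-- The bound on the time of `walk`. -/
def wCost (n w : ℕ) : ℕ := 2 * aTotal n w + 200 * (w + 1)

/-- A pass through the candidates finds each of them at twice as many positions as its weight. -/
theorem walk_spec {F w : ℕ} (hF : D.Fits w) (hM : 0 < D.M) :
    ∃ dec : ℕ → ℤ × ℤ × ℤ, (∀ φ : ℤ × ℤ × ℤ → ENNReal,
        ∑ u ∈ Finset.range (2 * D.total), φ (dec u) =
          2 * ∑ h ∈ D.cands, D.wt h.2.2 h.1 h.2.1 * φ h) ∧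
      ∀ (s : State) (u : ℤ), D.Holds s.mem → s.mem (-20) = u → Bdd w s.mem →
      |u| + 4 * D.total < 2 ^ w →
      Tri F walk s (wCost D.n w) (fun s' => Same (-19) s.mem s'.mem ∧
        Passes w (2 * D.total) dec u s s') := by
  obtain ⟨d₁, h₁, r₁⟩ := aLoop_spec (F := F) (D := D) hF (sg := 1) rfl
  obtain ⟨d₂, h₂, r₂⟩ := aLoop_spec (F := F) (D := D) hF (sg := -1) rfl
  have htot := total_eq hM
  obtain ⟨cA, -, -, -⟩ := hF.consts
  have hA1 := hF.Am1
  set t₁ := cum (D.colWt (1 * D.M)) (-D.Am) D.Am with ht1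
  set t₂ := cum (D.colWt (-1 * D.M)) (-D.Am) D.Am with ht2
  have hP : (128 : ℤ) ≤ 2 ^ w := by
    calc (128:ℤ) = 2 ^ 7 := by norm_num
      _ ≤ 2 ^ w := pow_le_pow_right₀ (by norm_num) hF.w7
  refine ⟨fun u => if u < 2 * t₁ then ((d₁ u).1, (d₁ u).2, 1 * D.M) else
    ((d₂ (u - 2 * t₁)).1, (d₂ (u - 2 * t₁)).2, -1 * D.M), fun φ => ?_, fun s u hH h20 hB hw => ?_⟩
  · have e₁ := h₁ fun q => φ (q.1, q.2, 1 * D.M)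
    have e₂ := h₂ fun q => φ (q.1, q.2, -1 * D.M)
    rw [← ht1] at e₁
    rw [← ht2] at e₂
    rw [sum_cands hM, htot, mul_add, mul_add, Finset.sum_range_add, ← e₁, ← e₂]
    congr 1
    · exact Finset.sum_congr rfl fun p hp => by
        beta_reduce; rw [if_pos (Finset.mem_range.1 hp)]
    · refine Finset.sum_congr rfl fun p _ => ?_
      beta_reduce
      rw [if_neg (by omega), Nat.add_sub_cancel_left]
  · have hu := hB (-20)
    rw [h20] at hu
    have hua := abs_nonneg u
    rw [htot] at hw ⊢
    push_cast at hw
    have key : ∀ (z : ℤ) (s₀ : State), |z| ≤ 1 → D.Holds s₀.mem → Bdd w s₀.mem →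
        (asg (-19) (lit z) ;; asg (-25) (lit 0 - reg (-3))).straight = true →
        Tri F (asg (-19) (lit z) ;; asg (-25) (lit 0 - reg (-3))) s₀ (100 * (w + 1)) (fun s' =>
          (Same (-19) s₀.mem s'.mem ∧ s'.mem (-19) = z ∧ s'.mem (-25) = -D.Am ∧
            ∀ j, j = -20 ∨ j = -21 ∨ j = -22 ∨ j = -23 ∨ j = -24 → s'.mem j = s₀.mem j) ∧
            Bdd w s'.mem) := by
      intro z s₀ hz hH₀ hB₀ hst
      refine Tri.block hF.w7 hst (by simp [Prog.cst, asg, Expr.nodes]; decide) hB₀ ?_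
      simp only [asg, Prog.wp, val_lit, val_reg, val_sub, write_mem, hH₀.Am, Int.reduceNeg,
        Int.reduceEq, ↓reduceIte]
      refine ⟨by linarith, by rw [abs_lt]; constructor <;> linarith, fun j hj => ?_, trivial, by ring,
        fun j hj => ?_⟩
      · simp only [write_mem]
        split_ifs <;> omega
      · split_ifs <;> omega
    refine (Tri.seq (key 1 s (by norm_num) hH hB rfl) fun s₁ f₁ =>
      Tri.seq (r₁ s₁ u (hH.same _ f₁.1.1 (by norm_num)) f₁.1.2.1 f₁.1.2.2.1
        ((f₁.1.2.2.2 _ (by simp)).trans h20) f₁.2 (by linarith)) fun s₂ f₂ =>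
      Tri.seq (key (-1) s₂ (by norm_num) (hH.same (-19) (f₁.1.1.trans (f₂.1.mono (by norm_num)))
        (by norm_num)) f₂.2.bdd rfl) fun s₃ f₃ =>
      (r₂ s₃ (u - (2 * t₁ : ℕ)) (hH.same (-19) ((f₁.1.1.trans (f₂.1.mono (by norm_num))).trans f₃.1.1)
        (by norm_num)) f₃.1.2.1 f₃.1.2.2.1 ((f₃.1.2.2.2 _ (by simp)).trans f₂.2.pos) f₃.2 ?_).mono
        le_rfl fun s₄ f₄ => ⟨((f₁.1.1.trans (f₂.1.mono (by norm_num))).trans f₃.1.1).trans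
          (f₄.1.mono (by norm_num)), ?_⟩).mono (by unfold wCost; omega) fun _ => id
    · push_cast
      have := abs_sub u (2 * t₁)
      rw [abs_of_nonneg (by positivity : (0:ℤ) ≤ 2 * t₁)] at this
      linarith
    · rw [mul_add]
      have p₁ : Passes w (2 * t₁) (fun p => ((d₁ p).1, (d₁ p).2, 1 * D.M)) u s s₂ :=
        ⟨f₂.2.bdd, f₂.2.pos, fun h j hj => (f₂.2.keep h j hj).trans (f₁.1.2.2.2 j (by omega)),
          f₂.2.flag, f₂.2.sel⟩
      have p₂ : Passes w (2 * t₂) (fun p => ((d₂ p).1, (d₂ p).2, -1 * D.M)) (u - (2 * t₁ : ℕ))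
          s₂ s₄ :=
        ⟨f₄.2.bdd, f₄.2.pos, fun h j hj => (f₄.2.keep h j hj).trans (f₃.1.2.2.2 j (by omega)),
          f₄.2.flag, f₄.2.sel⟩
      exact p₁.trans p₂ fun p => rfl

end Data
end RAM

namespace PrivateLearning

/-! ### Greedy selection -/

/-- A greedy selection process over examples `ι` and candidates `Hs`: in round `t`, with the set `R`
of examples remaining, it selects a candidate `h` with probability proportional to `W t R h`, or none
with probability proportional to `V t`, and then discards the examples that `h` cuts off. -/
structure Greedy (ι H : Type*) where
  Hs : Finset H
  cut : H → ι → Prop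
  W : ℕ → Finset ι → H → ℕ
  V : ℕ → ℕ
  V_pos : ∀ t, 0 < V t

namespace Greedy
variable {ι H : Type*} (G : Greedy ι H)

/-- The weight of an outcome of a round. -/
def wt (t : ℕ) (R : Finset ι) : Option H → ℕ
  | none => G.V t
  | some h => G.W t R h

/-- The total weight in a round. -/
def tot (t : ℕ) (R : Finset ι) : ℕ := ∑ o ∈ Finset.insertNone G.Hs, G.wt t R o

theorem tot_eq (t : ℕ) (R : Finset ι) : G.tot t R = G.V t + ∑ h ∈ G.Hs, G.W t R h := by
  simp [tot, wt]

theorem tot_pos (t : ℕ) (R : Finset ι) : 0 < G.tot t R := by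
  rw [tot_eq]; have := G.V_pos t; omega

open Classical in
/-- The law of the outcome of a round. -/
noncomputable def sel (t : ℕ) (R : Finset ι) : PMF (Option H) :=
  PMF.ofFinset (fun o => if o ∈ Finset.insertNone G.Hs then (G.wt t R o : ENNReal) / G.tot t R else 0)
    (Finset.insertNone G.Hs) (by
      rw [Finset.sum_congr rfl fun o ho => if_pos ho]
      simp only [div_eq_mul_inv]
      rw [← Finset.sum_mul, ← Nat.cast_sum]
      exact ENNReal.mul_inv_cancel (by exact_mod_cast (G.tot_pos t R).ne') (ENNReal.natCast_ne_top _))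
    fun o ho => if_neg ho

theorem sel_apply {t : ℕ} {R : Finset ι} {o : Option H} (ho : o ∈ Finset.insertNone G.Hs) :
    G.sel t R o = (G.wt t R o : ENNReal) / G.tot t R := by
  simp [sel, ho]

theorem sel_eq_zero {t : ℕ} {R : Finset ι} {o : Option H} (ho : o ∉ Finset.insertNone G.Hs) :
    G.sel t R o = 0 := by
  simp only [sel, PMF.ofFinset_apply, if_neg ho]

open Classical in
/-- The examples that remain after an outcome. -/
noncomputable def next (R : Finset ι) : Option H → Finset ι
  | none => R
  | some h => R.filter fun i => ¬ G.cut h i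

/-- The law of the list of candidates that are selected in `k` rounds from round `t` on. -/
noncomputable def run : ℕ → ℕ → Finset ι → PMF (List H)
  | 0, _, _ => PMF.pure []
  | k + 1, t, R => (G.sel t R).bind fun o => (run k (t + 1) (G.next R o)).map (o.toList ++ ·)

theorem run_succ_toOuterMeasure (k t : ℕ) (R : Finset ι) (T : Set (List H)) :
    (G.run (k + 1) t R).toOuterMeasure T = ∑ o ∈ Finset.insertNone G.Hs,
      G.sel t R o * (G.run k (t + 1) (G.next R o)).toOuterMeasure ((o.toList ++ ·) ⁻¹' T) := by
  rw [run, PMF.toOuterMeasure_bind_apply, tsum_eq_sum fun o ho => by rw [sel_eq_zero G ho, zero_mul]]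
  simp only [PMF.toOuterMeasure_map_apply]

/-- The probability that the process selects a list from `T`. -/
noncomputable def pr (k t : ℕ) (R : Finset ι) (T : Set (List H)) : ℝ :=
  ((G.run k t R).toOuterMeasure T).toReal

theorem toOuterMeasure_le_one {α : Type*} (p : PMF α) (T : Set α) : p.toOuterMeasure T ≤ 1 := by
  rw [PMF.toOuterMeasure_apply, ← p.tsum_coe]
  exact ENNReal.tsum_le_tsum fun a => Set.indicator_le_self _ _ a

theorem pr_le_one (k t : ℕ) (R : Finset ι) (T : Set (List H)) : G.pr k t R T ≤ 1 := by
  have := ENNReal.toReal_mono ENNReal.one_ne_top (toOuterMeasure_le_one (G.run k t R) T)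
  simpa [pr] using this

theorem pr_nonneg (k t : ℕ) (R : Finset ι) (T : Set (List H)) : 0 ≤ G.pr k t R T :=
  ENNReal.toReal_nonneg

theorem pr_succ (k t : ℕ) (R : Finset ι) (T : Set (List H)) :
    G.pr (k + 1) t R T = ∑ o ∈ Finset.insertNone G.Hs,
      (G.wt t R o : ℝ) / G.tot t R * G.pr k (t + 1) (G.next R o) ((o.toList ++ ·) ⁻¹' T) := by
  rw [pr, run_succ_toOuterMeasure, ENNReal.toReal_sum]
  · refine Finset.sum_congr rfl fun o ho => ?_
    rw [sel_apply G ho, ENNReal.toReal_mul, ENNReal.toReal_div]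
    simp [pr]
  · intro o ho
    refine ENNReal.mul_ne_top (PMF.apply_ne_top _ _) ?_
    exact ((toOuterMeasure_le_one _ _).trans_lt ENNReal.one_lt_top).ne

section Privacy
variable [DecidableEq ι]

/-- Example `i` affects the weights only of the candidates that cut it off, and only by a factor
of at most `1 + 1 / N`. -/
def Stable (N : ℕ) (i : ι) : Prop :=
  ∀ t (R R' : Finset ι), R.erase i = R'.erase i → ∀ h ∈ G.Hs,
    N * G.W t R h ≤ (N + 1) * G.W t R' h ∧ (¬ G.cut h i → G.W t R h = G.W t R' h)

variable {G}

theorem next_erase {i : ι} {R R' : Finset ι} (hR : R.erase i = R'.erase i) (o : Option H) :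
    (G.next R o).erase i = (G.next R' o).erase i := by
  cases o with
  | none => exact hR
  | some h =>
    ext j
    have := Finset.ext_iff.1 hR j
    simp only [Finset.mem_erase, next, Finset.mem_filter] at this ⊢
    tauto

theorem next_eq {i : ι} {R R' : Finset ι} (hR : R.erase i = R'.erase i) {h : H} (hc : G.cut h i) :
    G.next R (some h) = G.next R' (some h) := by
  ext j
  have := Finset.ext_iff.1 hR j
  simp only [Finset.mem_erase, next, Finset.mem_filter] at this ⊢
  by_cases hj : j = i
  · subst hj; simp [hc]
  · tauto

/-- The privacy loss that the presence of one example causes does not grow with the number of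
rounds. The probability `p` that the current round cuts off the example is charged to the budget `L`:
the total weights of the two processes differ by a factor of at most `exp (p / N)`, and the event that
the budget is exceeded before the example is cut off has probability at most `exp (-L)`, because
`(1 - p) * exp p ≤ 1`. -/
theorem pr_le {N : ℕ} (hN : 0 < N) {i : ι} (hG : G.Stable N i) (k : ℕ) :
    ∀ (t : ℕ) (R R' : Finset ι) (L : ℝ) (T : Set (List H)), R.erase i = R'.erase i →
      G.pr k t R T ≤ Real.exp ((L + 2) / N) * G.pr k t R' T + Real.exp (-L) := by
  have hN' : (0:ℝ) < N := by exact_mod_cast hN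
  induction k with
  | zero =>
    intro t R R' L T _
    have h0 := pr_nonneg G 0 t R' T
    have h1 := pr_le_one G 0 t R T
    have e : G.pr 0 t R T = G.pr 0 t R' T := rfl
    rcases lt_or_ge L 0 with hL | hL
    · have := Real.one_le_exp (show 0 ≤ -L by linarith)
      have := mul_nonneg (Real.exp_nonneg ((L + 2) / N)) h0
      linarith
    · have h2 : 1 ≤ Real.exp ((L + 2) / N) := Real.one_le_exp (by positivity)
      have := Real.exp_nonneg (-L)
      rw [e]
      nlinarith
  | succ k ih =>
    intro t R R' L T hR
    rcases lt_or_ge L 0 with hL | hL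
    · have := Real.one_le_exp (show 0 ≤ -L by linarith)
      have := mul_nonneg (Real.exp_nonneg ((L + 2) / N)) (pr_nonneg G (k + 1) t R' T)
      have := pr_le_one G (k + 1) t R T
      linarith
    classical
    set O := Finset.insertNone G.Hs
    let cutO : Option H → Prop := fun o => ∃ h, o = some h ∧ G.cut h i
    have hZ : (0:ℝ) < G.tot t R := by exact_mod_cast G.tot_pos t R
    have hZ' : (0:ℝ) < G.tot t R' := by exact_mod_cast G.tot_pos t R'
    -- the weights of the outcomes
    have hw : ∀ o ∈ O, (N : ℝ) * G.wt t R o ≤ (N + 1) * G.wt t R' o ∧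
        (N : ℝ) * G.wt t R' o ≤ (N + 1) * G.wt t R o ∧ (¬ cutO o → G.wt t R o = G.wt t R' o) := by
      intro o ho
      cases o with
      | none =>
        have : (0:ℝ) ≤ G.V t := by positivity
        exact ⟨by simp only [wt]; nlinarith, by simp only [wt]; nlinarith, fun _ => rfl⟩
      | some h =>
        have hh : h ∈ G.Hs := Finset.some_mem_insertNone.1 ho
        refine ⟨?_, ?_, fun hc => (hG t R R' hR h hh).2 fun hc' => hc ⟨h, rfl, hc'⟩⟩
        · exact_mod_cast (hG t R R' hR h hh).1
        · exact_mod_cast (hG t R' R hR.symm h hh).1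
    set p : ℝ := ∑ o ∈ O.filter cutO, (G.wt t R o : ℝ) / G.tot t R with hp
    have hsum : ∑ o ∈ O, (G.wt t R o : ℝ) / G.tot t R = 1 := by
      rw [← Finset.sum_div, ← Nat.cast_sum]
      exact div_self hZ.ne'
    have hsplit : p + ∑ o ∈ O.filter fun o => ¬ cutO o, (G.wt t R o : ℝ) / G.tot t R = 1 := by
      rw [← hsum, Finset.sum_filter_add_sum_filter_not]
    have hp0 : 0 ≤ p := Finset.sum_nonneg fun o _ => by positivity
    have hp1 : p ≤ 1 := by
      have : 0 ≤ ∑ o ∈ O.filter fun o => ¬ cutO o, (G.wt t R o : ℝ) / G.tot t R :=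
        Finset.sum_nonneg fun o _ => by positivity
      linarith
    -- the total weights
    have hZZ : (G.tot t R' : ℝ) ≤ G.tot t R * Real.exp (p / N) := by
      have h1 : (G.tot t R' : ℝ) ≤ G.tot t R + p * G.tot t R / N := by
        have e1 : p * G.tot t R = ∑ o ∈ O.filter cutO, (G.wt t R o : ℝ) := by
          rw [hp, Finset.sum_mul]
          exact Finset.sum_congr rfl fun o _ => div_mul_cancel₀ _ hZ.ne'
        rw [e1, tot, tot, Finset.sum_filter, Finset.sum_div, Nat.cast_sum, Nat.cast_sum,
          ← Finset.sum_add_distrib]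
        refine Finset.sum_le_sum fun o ho => ?_
        obtain ⟨-, h2, h3⟩ := hw o ho
        split_ifs with hc
        · rw [← mul_le_mul_iff_right₀ hN']
          calc _ ≤ _ := h2
            _ = _ := by field_simp
        · rw [h3 hc]; simp
      have h2 := Real.add_one_le_exp (p / N)
      calc (G.tot t R' : ℝ) ≤ G.tot t R * (p / N + 1) := by rw [mul_add, mul_one]; convert h1 using 1; ring
        _ ≤ _ := by gcongr
    have hprob : ∀ o ∈ O, (¬ cutO o → (G.wt t R o : ℝ) / G.tot t R ≤
        Real.exp (p / N) * (G.wt t R' o / G.tot t R')) ∧ (G.wt t R o : ℝ) / G.tot t R ≤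
        (1 + 1 / N) * Real.exp (p / N) * (G.wt t R' o / G.tot t R') := by
      intro o ho
      obtain ⟨h1, -, h3⟩ := hw o ho
      have key : (1:ℝ) / G.tot t R ≤ Real.exp (p / N) * (1 / G.tot t R') := by
        rw [mul_one_div, div_le_div_iff₀ hZ hZ']; linarith
      refine ⟨fun hc => ?_, ?_⟩
      · rw [h3 hc, div_eq_mul_one_div, div_eq_mul_one_div (G.wt t R' o : ℝ) (G.tot t R')]
        calc _ ≤ (G.wt t R' o : ℝ) * (Real.exp (p / N) * (1 / G.tot t R')) := by gcongr
          _ = _ := by ring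
      · have h4 : (G.wt t R o : ℝ) ≤ (1 + 1 / N) * G.wt t R' o := by
          rw [← mul_le_mul_iff_right₀ hN']
          calc _ ≤ _ := h1
            _ = _ := by field_simp
        rw [div_eq_mul_one_div, div_eq_mul_one_div (G.wt t R' o : ℝ) (G.tot t R')]
        calc _ ≤ ((1 + 1 / N) * G.wt t R' o : ℝ) * (Real.exp (p / N) * (1 / G.tot t R')) := by gcongr
          _ = _ := by ring
    rw [pr_succ, pr_succ]
    set q : Option H → ℝ := fun o => G.pr k (t + 1) (G.next R o) ((o.toList ++ ·) ⁻¹' T)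
    set q' : Option H → ℝ := fun o => G.pr k (t + 1) (G.next R' o) ((o.toList ++ ·) ⁻¹' T)
    have hq' : ∀ o, 0 ≤ q' o := fun o => pr_nonneg ..
    have step : ∀ o ∈ O, (G.wt t R o : ℝ) / G.tot t R * q o ≤
        Real.exp ((L + 2) / N) * (G.wt t R' o / G.tot t R' * q' o) +
          if cutO o then 0 else (G.wt t R o : ℝ) / G.tot t R * Real.exp (-(L - p)) := by
      intro o ho
      obtain ⟨h1, h2⟩ := hprob o ho
      split_ifs with hc
      · obtain ⟨h, rfl, hc⟩ := hc
        have e : q (some h) = q' (some h) := by simp only [q, q', next_eq hR hc]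
        have h3 : (1 + 1 / (N:ℝ)) * Real.exp (p / N) ≤ Real.exp ((L + 2) / N) := by
          calc _ ≤ Real.exp (1 / N) * Real.exp (p / N) := by
                gcongr; rw [add_comm]; exact Real.add_one_le_exp _
            _ = Real.exp ((1 + p) / N) := by rw [← Real.exp_add]; ring_nf
            _ ≤ _ := Real.exp_le_exp.2 (div_le_div_of_nonneg_right (by linarith) hN'.le)
        rw [e, add_zero, ← mul_assoc]
        refine mul_le_mul_of_nonneg_right (h2.trans ?_) (hq' _)
        gcongr
      · have h3 := ih (t + 1) (G.next R o) (G.next R' o) (L - p) ((o.toList ++ ·) ⁻¹' T)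
          (next_erase hR o)
        calc (G.wt t R o : ℝ) / G.tot t R * q o ≤ (G.wt t R o : ℝ) / G.tot t R *
              (Real.exp ((L - p + 2) / N) * q' o + Real.exp (-(L - p))) := by gcongr
          _ = Real.exp ((L - p + 2) / N) * ((G.wt t R o : ℝ) / G.tot t R) * q' o +
              (G.wt t R o : ℝ) / G.tot t R * Real.exp (-(L - p)) := by ring
          _ ≤ Real.exp ((L - p + 2) / N) * (Real.exp (p / N) * (G.wt t R' o / G.tot t R')) * q' o +
              (G.wt t R o : ℝ) / G.tot t R * Real.exp (-(L - p)) := by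
                have := hq' o
                gcongr
                exact h1 hc
          _ = _ := by
                rw [← mul_assoc, ← Real.exp_add,
                  show (L - p + 2) / N + p / N = (L + 2) / (N:ℝ) by ring, mul_assoc]
    refine (Finset.sum_le_sum step).trans ?_
    rw [Finset.sum_add_distrib, ← Finset.mul_sum]
    gcongr
    have e2 : ∑ o ∈ O, (if cutO o then 0 else (G.wt t R o : ℝ) / G.tot t R * Real.exp (-(L - p))) =
        (1 - p) * Real.exp (-(L - p)) := by
      rw [show 1 - p = ∑ o ∈ O.filter fun o => ¬ cutO o, (G.wt t R o : ℝ) / G.tot t R by linarith,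
        Finset.sum_mul, Finset.sum_filter]
      exact Finset.sum_congr rfl fun o _ => by simp only [ite_not]
    rw [e2, show -L = -p + -(L - p) by ring, Real.exp_add]
    have := Real.add_one_le_exp (-p)
    gcongr
    linarith

end Privacy
end Greedy

namespace Greedy
variable {ι H : Type*}

/-- Two processes that differ only in the example `i` agree once this example has been removed. -/
theorem run_congr {G G' : Greedy ι H} {i : ι} (hHs : G.Hs = G'.Hs) (hV : ∀ t, G.V t = G'.V t)
    (hc : ∀ h, ∀ j ≠ i, G.cut h j ↔ G'.cut h j)
    (hW : ∀ t (R : Finset ι) h, i ∉ R → G.W t R h = G'.W t R h) (k : ℕ) :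
    ∀ t (R : Finset ι), i ∉ R → G.run k t R = G'.run k t R := by
  induction k with
  | zero => intro t R _; rfl
  | succ k ih =>
    intro t R hR
    have hwt : ∀ o, G.wt t R o = G'.wt t R o := by
      rintro (_ | h)
      · exact hV t
      · exact hW t R h hR
    have htot : G.tot t R = G'.tot t R := by simp only [tot, hHs, hwt]
    have hsel : G.sel t R = G'.sel t R := by
      ext o
      simp only [sel, PMF.ofFinset_apply, hwt, htot]
      rw [hHs]
    have hnext : ∀ o, G.next R o = G'.next R o := by
      rintro (_ | h)
      · rfl
      · classical exact Finset.filter_congr fun j hj => not_congr (hc h j fun e => hR (e ▸ hj))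
    have hni : ∀ o, i ∉ G'.next R o := by
      rintro (_ | h)
      · exact hR
      · classical exact fun hh => hR (Finset.mem_filter.1 hh).1
    simp only [run, hsel, hnext]
    congr 1
    funext o
    rw [ih _ _ (hni o)]

/-- Neighbouring databases are compared through the database in which the differing example has been
removed, which is `pr_le` in both directions. -/
theorem pr_le_of_neighbours [DecidableEq ι] {G G' : Greedy ι H} {i : ι} {N : ℕ} (hN : 0 < N)
    (hG : G.Stable N i) (hG' : G'.Stable N i) (hHs : G.Hs = G'.Hs) (hV : ∀ t, G.V t = G'.V t)
    (hc : ∀ h, ∀ j ≠ i, G.cut h j ↔ G'.cut h j)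
    (hW : ∀ t (R : Finset ι) h, i ∉ R → G.W t R h = G'.W t R h) {ε δ : ℝ} (hδ : 0 < δ)
    (hε : ε < 1) (hNε : 2 * (Real.log (3 / δ) + 2) / N ≤ ε) (k t : ℕ) (R : Finset ι)
    (T : Set (List H)) :
    G.pr k t R T ≤ Real.exp ε * G'.pr k t R T + δ := by
  set L := Real.log (3 / δ) with hL
  have h1 := pr_le hN hG k t R (R.erase i) L T (by simp)
  have h2 := pr_le hN hG' k t (R.erase i) R L T (by simp)
  have e : G.pr k t (R.erase i) T = G'.pr k t (R.erase i) T := by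
    rw [pr, pr, run_congr hHs hV hc hW k t _ (by simp)]
  have eL : Real.exp (-L) = δ / 3 := by
    rw [Real.exp_neg, hL, Real.exp_log (by positivity), inv_div]
  have h3 : Real.exp ((L + 2) / N) ≤ Real.exp (ε / 2) :=
    Real.exp_le_exp.2 (by rw [mul_div_assoc] at hNε; linarith)
  have h4 : Real.exp (ε / 2) ≤ 2 := by
    have h5 : Real.exp (ε / 2) * Real.exp (ε / 2) = Real.exp ε := by
      rw [← Real.exp_add]; ring_nf
    have h6 : Real.exp ε < Real.exp 1 := Real.exp_lt_exp.2 hε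
    have h7 := Real.exp_one_lt_d9
    nlinarith [Real.exp_nonneg (ε / 2)]
  have h0 := pr_nonneg G' k t R T
  rw [e] at h1
  rw [eL] at h1 h2
  set E := Real.exp ((L + 2) / N)
  have hE : 0 ≤ E := Real.exp_nonneg _
  have h5 : Real.exp ε = Real.exp (ε / 2) * Real.exp (ε / 2) := by rw [← Real.exp_add]; ring_nf
  calc G.pr k t R T ≤ E * (E * G'.pr k t R T + δ / 3) + δ / 3 := by
        refine h1.trans ?_; gcongr
    _ = E * E * G'.pr k t R T + (E + 1) * (δ / 3) := by ring
    _ ≤ Real.exp (ε / 2) * Real.exp (ε / 2) * G'.pr k t R T + (2 + 1) * (δ / 3) := by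
        gcongr; exact h3.trans h4
    _ = _ := by rw [h5]; ring

end Greedy
end PrivateLearning

namespace RAM

/-! ### The weights as powers -/

/-- The number of the first examples with pattern `v`. -/
def patCount (P : ℕ → ℕ) (v n : ℕ) : ℕ := ((Finset.range n).filter fun i => P i = v).card

theorem patCount_succ (P : ℕ → ℕ) (v n : ℕ) :
    patCount P v (n + 1) = patCount P v n + if P n = v then 1 else 0 := by
  rw [patCount, Finset.range_add_one, Finset.filter_insert, patCount]
  split_ifs
  · rw [Finset.card_insert_of_notMem (by simp)]
  · rfl

/-- The exponent of a weight. -/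
def score (θ : ℕ) (P : ℕ → ℕ) (n : ℕ) : ℤ := ((min (patCount P 1 n) θ : ℕ) : ℤ) - patCount P 2 n

/-- The weights are those of the exponential mechanism, multiplied by `(N * (N + 1)) ^ n` to make them
integers. -/
theorem weightRec_eq {N : ℕ} (hN : 0 < N) (θ : ℕ) (P : ℕ → ℕ) (n : ℕ) :
    (weightRec N θ P n).1 = θ - patCount P 1 n ∧
    ((weightRec N θ P n).2 : ℝ) = ((N : ℝ) * (N + 1)) ^ n * ((N + 1) / N : ℝ) ^ score θ P n := by
  have hN' : (0:ℝ) < N := by exact_mod_cast hN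
  have hr : (0:ℝ) < (N + 1) / N := by positivity
  induction n with
  | zero => simp [weightRec, patCount, score]
  | succ n ih =>
    obtain ⟨h1, h2⟩ := ih
    simp only [weightRec, score] at h2 ⊢
    simp only [patCount_succ]
    by_cases e1 : P n = 1
    · simp only [e1, ↓reduceIte, h1, OfNat.one_ne_ofNat, add_zero]
      by_cases hlt : patCount P 1 n < θ
      · rw [if_pos (by omega)]
        refine ⟨by simp only; omega, ?_⟩
        rw [show ((min (patCount P 1 n + 1) θ : ℕ) : ℤ) = (min (patCount P 1 n) θ : ℕ) + 1 by omega,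
          add_sub_right_comm, zpow_add_one₀ hr.ne', pow_succ, Nat.cast_mul, Nat.cast_mul,
          Nat.cast_add, Nat.cast_one, h2]
        field_simp
      · rw [if_neg (by omega)]
        refine ⟨by simp only; omega, ?_⟩
        rw [show ((min (patCount P 1 n + 1) θ : ℕ) : ℤ) = (min (patCount P 1 n) θ : ℕ) by omega,
          pow_succ, Nat.cast_mul, Nat.cast_mul, Nat.cast_add, Nat.cast_one, h2]
        ring
    · by_cases e2 : P n = 2
      · simp only [e2, ↓reduceIte, OfNat.ofNat_ne_one, h1, add_zero, true_and]
        rw [Nat.cast_add, Nat.cast_one, Nat.cast_mul, Nat.cast_mul, ← sub_sub, zpow_sub_one₀ hr.ne', pow_succ, h2]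
        field_simp
      · simp only [e1, e2, ↓reduceIte, h1, add_zero, true_and]
        rw [Nat.cast_mul, Nat.cast_mul, Nat.cast_add, Nat.cast_one, pow_succ, h2]
        ring

/-- Changing one entry of the pattern to or from `0` changes the score by at most `1`. -/
theorem score_le_score_add_one (θ : ℕ) {P P' : ℕ → ℕ} {n i : ℕ} (h : ∀ j ≠ i, P j = P' j)
    (hi : P i = 0 ∨ P' i = 0 ∨ P i = P' i) : score θ P n ≤ score θ P' n + 1 := by
  have key : ∀ v, ∀ n, patCount P v n =
      patCount P' v n + (if i < n ∧ P i = v then 1 else 0) - (if i < n ∧ P' i = v then 1 else 0) := by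
    intro v n
    have : patCount P v n + (if i < n ∧ P' i = v then 1 else 0) =
      patCount P' v n + (if i < n ∧ P i = v then 1 else 0) := by
      induction n with
      | zero => simp [patCount]
      | succ n ih =>
        rw [patCount_succ, patCount_succ]
        by_cases hn : n = i
        · subst hn
          simp only [lt_irrefl, false_and, ↓reduceIte, add_zero] at ih
          simp only [Nat.lt_succ_self, true_and, ih]
          ring
        · rw [h n hn]
          have : i < n + 1 ↔ i < n := by omega
          simp only [this]
          omega
    omega
  unfold score
  rw [key 1, key 2]
  by_cases hin : i < n
  · simp only [hin, true_and]
    rcases hi with hi | hi | hi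
    · rw [hi]; simp only [OfNat.zero_ne_ofNat, zero_ne_one, ↓reduceIte]
      split_ifs <;> omega
    · rw [hi]; simp only [OfNat.zero_ne_ofNat, zero_ne_one, ↓reduceIte]
      split_ifs <;> omega
    · rw [hi]; split_ifs <;> omega
  · simp [hin]

theorem weightRec_le_weightRec {N : ℕ} (hN : 0 < N) (θ : ℕ) {P P' : ℕ → ℕ} {n i : ℕ}
    (h : ∀ j ≠ i, P j = P' j) (hi : P i = 0 ∨ P' i = 0 ∨ P i = P' i) :
    N * (weightRec N θ P n).2 ≤ (N + 1) * (weightRec N θ P' n).2 := by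
  have hN' : (0:ℝ) < N := by exact_mod_cast hN
  have hr : (1:ℝ) ≤ (N + 1) / N := by rw [le_div_iff₀ hN']; linarith
  have h1 := zpow_le_zpow_right₀ hr (score_le_score_add_one θ (n := n) h hi)
  rw [zpow_add_one₀ (by positivity)] at h1
  have : (N : ℝ) * (weightRec N θ P n).2 ≤ (N + 1) * (weightRec N θ P' n).2 := by
    rw [(weightRec_eq hN θ P n).2, (weightRec_eq hN θ P' n).2]
    calc (N:ℝ) * (((N : ℝ) * (N + 1)) ^ n * ((N + 1) / N : ℝ) ^ score θ P n) ≤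
        (N:ℝ) * (((N : ℝ) * (N + 1)) ^ n * (((N + 1) / N : ℝ) ^ score θ P' n * ((N + 1) / N))) := by
          gcongr
      _ = _ := by field_simp
  exact_mod_cast this

end RAM

namespace PrivateLearning

/-! ### The learner -/

/-- The parameters of the learner: the size `n` of the database, the size `d` of the grid, the number
`k` of halfplanes, the reciprocals `ia` and `ie` of `α` and `ε`, and a bound `ld` on the binary logarithm
of `1 / δ`. -/
structure Params where
  n : ℕ
  d : ℕ
  k : ℕ
  ia : ℕ
  ie : ℕ
  ld : ℕ
  n1 : 1 ≤ n
  d1 : 1 ≤ d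
  k1 : 1 ≤ k
  ia1 : 1 ≤ ia
  ie1 : 1 ≤ ie

/-- A labelled database of points of the grid. -/
structure Examples where
  X : ℕ → ℤ
  Y : ℕ → ℤ
  pos : ℕ → Bool

namespace Params
variable (p : Params)

/-- The number of phases; in each the number of remaining negative examples is halved. -/
def J : ℕ := Nat.size p.ia + 3

/-- The number of rounds; there are `2 * k` rounds in a phase. -/
def T : ℕ := 2 * p.k * p.J

/-- The cap on the reward for the elimination of negative examples. -/
def θ (t : ℕ) : ℕ := p.n / (2 * p.k * 2 ^ (t / (2 * p.k)))

/-- The slack between the cap and the score of the choice of no candidate. -/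
def gap : ℕ := p.n / (32 * p.T * p.ia)

/-- The ratio of weights of consecutive scores is `(N + 1) / N`. -/
def N : ℕ := 2 * p.ie * (p.ld + 4)

/-- The absolute value of the factor `c` of the candidate halfplanes `c * y ≥ a * x + b`. -/
def M : ℤ := 2 * p.d * p.d

/-- The bound on the slopes of the candidates. -/
def Am : ℤ := (p.d + 1) * p.M

/-- The bound on the intercepts of the candidates. -/
def Bm : ℤ := (p.d + 2) * p.Am

theorem N_pos : 0 < p.N := by have := p.ie1; unfold N; positivity

theorem J_pos : 0 < p.J := by unfold J; positivity

theorem T_pos : 0 < p.T := by have := p.k1; have := p.J_pos; unfold T; positivity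

theorem M_pos : 0 < p.M := by have := p.d1; unfold M; positivity

/-- The data of the search in round `t` with the set `R` of remaining examples. -/
def data (e : Examples) (t : ℕ) (R : Finset ℕ) : RAM.Data where
  n := p.n
  N := p.N
  θ := p.θ t
  M := p.M
  Am := p.Am
  Bm := p.Bm
  X := e.X
  Y := e.Y
  L i := if i ∈ R then (if e.pos i then 1 else 0) else 2

/-- The candidates `(a, b, c)`. -/
noncomputable def cands : Finset (ℤ × ℤ × ℤ) :=
  Finset.Ico (-p.Am) p.Am ×ˢ Finset.Ico (-p.Bm) p.Bm ×ˢ {p.M, -p.M}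

/-- The learner: it repeatedly selects a halfplane, given by `(a, b, c)`, that cuts off many negative
examples and few positive ones. -/
noncomputable def learner (e : Examples) : Greedy ℕ (ℤ × ℤ × ℤ) where
  Hs := p.cands
  cut h i := h.2.2 * e.Y i - h.1 * e.X i < h.2.1
  W t R h := (p.data e t R).wt h.2.2 h.1 h.2.1
  V t := (p.N * (p.N + 1)) ^ (p.n - (p.θ t - p.gap)) * ((p.N + 1) * (p.N + 1)) ^ (p.θ t - p.gap)
  V_pos t := by have := p.N_pos; positivity

variable {p}

theorem learner_stable (e : Examples) (i : ℕ) : (p.learner e).Stable p.N i := by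
  intro t R R' hR h hh
  have hpat : ∀ j, (j ≠ i ∨ ¬ (p.learner e).cut h i) →
      (p.data e t R).pat h.2.2 h.1 h.2.1 j = (p.data e t R').pat h.2.2 h.1 h.2.1 j := by
    intro j hj
    by_cases hji : j = i
    · subst hji
      have hc : ¬ (h.2.2 * e.Y j - h.1 * e.X j < h.2.1) := hj.resolve_left (by simp)
      simp [RAM.Data.pat, RAM.Data.key, data, hc]
    · have : j ∈ R ↔ j ∈ R' := by
        have := Finset.ext_iff.1 hR j
        simpa [hji] using this
      by_cases h2 : j ∈ R' <;> simp [RAM.Data.pat, RAM.Data.key, data, this, h2]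
  refine ⟨RAM.weightRec_le_weightRec p.N_pos _ (fun j hj => hpat j (Or.inl hj)) ?_, fun hc => ?_⟩
  · by_cases h1 : i ∈ R <;> by_cases h2 : i ∈ R' <;> simp [RAM.Data.pat, RAM.Data.key, data, h1, h2]
  · exact congrArg Prod.snd (RAM.Data.weightRec_congr _ _ fun j _ => hpat j (Or.inr hc))

theorem learner_private {e e' : Examples} {i : ℕ}
    (he : ∀ j ≠ i, e.X j = e'.X j ∧ e.Y j = e'.Y j ∧ e.pos j = e'.pos j) {ε δ : ℝ} (hδ : 0 < δ)
    (hε : ε < 1) (hNε : 2 * (Real.log (3 / δ) + 2) / p.N ≤ ε) (R : Finset ℕ) (k t : ℕ)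
    (T : Set (List (ℤ × ℤ × ℤ))) :
    (p.learner e).pr k t R T ≤ Real.exp ε * (p.learner e').pr k t R T + δ := by
  refine Greedy.pr_le_of_neighbours p.N_pos (learner_stable e i) (learner_stable e' i) rfl
    (fun _ => rfl) (fun h j hj => ?_) (fun t R h hR => ?_) hδ hε hNε k t R T
  · obtain ⟨h1, h2, -⟩ := he j hj
    simp only [learner, h1, h2]
  · refine congrArg Prod.snd (RAM.Data.weightRec_congr _ _ fun j _ => ?_)
    by_cases hj : j = i
    · subst hj
      simp [RAM.Data.pat, data, hR]
    · obtain ⟨h1, h2, h3⟩ := he j hj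
      by_cases h4 : j ∈ R <;> simp [RAM.Data.pat, RAM.Data.key, data, h1, h2, h3, h4]

theorem size_bounds (m : ℕ) (hm : 1 ≤ m) : m < 2 ^ Nat.size m ∧ 2 ^ Nat.size m ≤ 2 * m := by
  refine ⟨Nat.lt_size_self m, ?_⟩
  have h := Nat.lt_size.1 (show Nat.size m - 1 < Nat.size m by
    have := Nat.size_pos.2 hm; omega)
  have : Nat.size m = Nat.size m - 1 + 1 := by have := Nat.size_pos.2 hm; omega
  rw [this, pow_succ]; omega

theorem pow_J : 8 * p.ia < 2 ^ p.J ∧ 2 ^ p.J ≤ 16 * p.ia := by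
  have := size_bounds p.ia p.ia1
  rw [J, pow_add]; omega

theorem div_lt_J {t : ℕ} (ht : t < p.T) : t / (2 * p.k) < p.J := by
  rw [Nat.div_lt_iff_lt_mul (by have := p.k1; omega), mul_comm]; exact ht

theorem two_pow_div_le {t : ℕ} (ht : t < p.T) : 2 ^ (t / (2 * p.k)) ≤ 8 * p.ia := by
  have h1 := p.pow_J.2
  have h2 : 2 ^ (t / (2 * p.k) + 1) ≤ 2 ^ p.J := Nat.pow_le_pow_right (by norm_num) (div_lt_J ht)
  rw [pow_succ] at h2; omega

theorem gap_le_θ {t : ℕ} (ht : t < p.T) : p.gap ≤ p.θ t := by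
  have h1 := two_pow_div_le ht
  have h2 := p.k1
  have h3 := p.J_pos
  refine Nat.div_le_div_left ?_ (by positivity)
  calc 2 * p.k * 2 ^ (t / (2 * p.k)) ≤ 2 * p.k * (8 * p.ia) := by gcongr
    _ = 16 * p.k * 1 * p.ia := by ring
    _ ≤ 64 * p.k * p.J * p.ia := by gcongr <;> omega
    _ = _ := by rw [T]; ring

/-- The weight of no candidate corresponds to the score `θ - gap`. -/
theorem V_eq (e : Examples) {t : ℕ} (ht : t < p.T) : ((p.learner e).V t : ℝ) =
    ((p.N : ℝ) * (p.N + 1)) ^ p.n * ((p.N + 1) / p.N : ℝ) ^ ((p.θ t : ℤ) - p.gap) := by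
  have hN : (0:ℝ) < p.N := by exact_mod_cast p.N_pos
  have h1 := gap_le_θ ht
  have h2 : p.θ t ≤ p.n := Nat.div_le_self _ _
  rw [← Nat.cast_sub h1, zpow_natCast]
  set a := p.θ t - p.gap with ha
  have h3 : p.n = p.n - a + a := by omega
  simp only [learner, ← ha]
  push_cast
  conv_rhs => rw [h3, pow_add, mul_assoc, ← mul_pow]
  congr 2
  field_simp

theorem W_eq (e : Examples) (t : ℕ) (R : Finset ℕ) (h : ℤ × ℤ × ℤ) :
    ((p.learner e).W t R h : ℝ) = ((p.N : ℝ) * (p.N + 1)) ^ p.n * ((p.N + 1) / p.N : ℝ) ^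
      RAM.score (p.θ t) ((p.data e t R).pat h.2.2 h.1 h.2.1) p.n :=
  (RAM.weightRec_eq p.N_pos _ _ _).2

end Params

/-! ### The empirical error of the learner -/

namespace Greedy
variable {ι H : Type*} {G : Greedy ι H}

open Classical in
/-- If every round violates an invariant with probability at most `η`, then `k` rounds violate it with
probability at most `k * η`. -/
theorem run_not_inv_le {Inv : ℕ → Finset ι → Prop} {η : ENNReal} {K : ℕ}
    (hstep : ∀ t R, t < K → Inv t R →
      ∑ o ∈ Finset.insertNone G.Hs, (if Inv (t + 1) (G.next R o) then 0 else G.sel t R o) ≤ η)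
    (k : ℕ) : ∀ t R, t + k ≤ K → Inv t R →
      (G.run k t R).toOuterMeasure {l | ¬ Inv (t + k) (R.filter fun i => ∀ h ∈ l, ¬ G.cut h i)} ≤
        k * η := by
  induction k with
  | zero =>
    intro t R _ h
    simp [run, h]
  | succ k ih =>
    intro t R hk h
    rw [run_succ_toOuterMeasure]
    have hset : ∀ o : Option H, ((o.toList ++ ·) ⁻¹' {l | ¬ Inv (t + (k + 1))
        (R.filter fun i => ∀ h ∈ l, ¬ G.cut h i)}) = {l | ¬ Inv (t + 1 + k)
        ((G.next R o).filter fun i => ∀ h ∈ l, ¬ G.cut h i)} := by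
      intro o
      ext l
      simp only [Set.mem_preimage, Set.mem_ofPred_eq, show t + (k + 1) = t + 1 + k by ring]
      rw [not_iff_not]
      cases o with
      | none => simp [next]; congr!
      | some h => simp [next, Finset.filter_filter]
    have hsum : ∑ o ∈ Finset.insertNone G.Hs, G.sel t R o ≤ 1 := by
      rw [← (G.sel t R).tsum_coe]; exact ENNReal.sum_le_tsum _
    calc _ ≤ ∑ o ∈ Finset.insertNone G.Hs,
          ((if Inv (t + 1) (G.next R o) then 0 else G.sel t R o) + G.sel t R o * (k * η)) := by
          refine Finset.sum_le_sum fun o _ => ?_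
          rw [hset]
          split_ifs with hI
          · rw [zero_add]; gcongr; exact ih _ _ (by omega) hI
          · refine le_add_right ?_
            calc _ ≤ G.sel t R o * 1 := by gcongr; exact toOuterMeasure_le_one _ _
              _ = _ := mul_one _
      _ ≤ η + 1 * (k * η) := by
          rw [Finset.sum_add_distrib, ← Finset.sum_mul]
          gcongr
          exact hstep t R (by omega) h
      _ = _ := by push_cast; ring

/-- An outcome whose weight is smaller by the factor `ρ` than that of another outcome has probability at
most `ρ`. -/
theorem sel_le {t : ℕ} {R : Finset ι} {o o' : Option H} (ho : o ∈ Finset.insertNone G.Hs)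
    (ho' : o' ∈ Finset.insertNone G.Hs) {ρ : ℝ} (hρ : 0 ≤ ρ)
    (h : (G.wt t R o : ℝ) ≤ ρ * G.wt t R o') : G.sel t R o ≤ ENNReal.ofReal ρ := by
  have h1 : G.sel t R o' ≤ 1 := PMF.coe_le_one _ _
  have h2 : (G.wt t R o : ENNReal) ≤ ENNReal.ofReal ρ * G.wt t R o' := by
    have := ENNReal.ofReal_le_ofReal h
    rwa [ENNReal.ofReal_mul hρ, ENNReal.ofReal_natCast, ENNReal.ofReal_natCast] at this
  calc G.sel t R o = (G.wt t R o : ENNReal) / G.tot t R := sel_apply G ho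
    _ ≤ ENNReal.ofReal ρ * G.wt t R o' / G.tot t R := by gcongr
    _ = ENNReal.ofReal ρ * G.sel t R o' := by rw [sel_apply G ho', mul_div_assoc]
    _ ≤ ENNReal.ofReal ρ * 1 := by gcongr
    _ = _ := mul_one _

end Greedy

namespace Params
variable {p : Params} {e : Examples}

/-- The bound on the number of negative examples that remain after `t` rounds. -/
noncomputable def lev (p : Params) (t : ℕ) : ℝ :=
  p.n / 2 ^ (t / (2 * p.k)) * (1 - (t % (2 * p.k) : ℕ) / (4 * p.k))

theorem lev_succ (t : ℕ) : p.lev (t + 1) = p.lev t - p.n / 2 ^ (t / (2 * p.k)) / (4 * p.k) := by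
  have hk := p.k1
  have hk' : (0:ℝ) < p.k := by exact_mod_cast hk
  have h1 := Nat.div_add_mod t (2 * p.k)
  have h2 := Nat.mod_lt t (show 0 < 2 * p.k by omega)
  set j := t / (2 * p.k) with hj
  set s := t % (2 * p.k) with hs
  by_cases h : s + 1 < 2 * p.k
  · have e1 : (t + 1) / (2 * p.k) = j := by
      rw [← h1, add_assoc, Nat.mul_add_div (by omega), Nat.div_eq_of_lt h, add_zero]
    have e2 : (t + 1) % (2 * p.k) = s + 1 := by
      rw [← h1, add_assoc, Nat.mul_add_mod, Nat.mod_eq_of_lt h]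
    rw [lev, lev, e1, e2, ← hj, ← hs]
    push_cast
    field_simp
    ring
  · have e0 : t + 1 = 2 * p.k * (j + 1) := by rw [mul_add]; omega
    have e1 : (t + 1) / (2 * p.k) = j + 1 := by
      rw [e0, Nat.mul_div_cancel_left _ (by omega)]
    have e2 : (t + 1) % (2 * p.k) = 0 := by rw [e0, Nat.mul_mod_right]
    have e3 : (s : ℝ) = 2 * p.k - 1 := by
      have : s + 1 = 2 * p.k := by omega
      have : (s : ℝ) + 1 = 2 * p.k := by exact_mod_cast this
      linarith
    rw [lev, lev, e1, e2, ← hj, ← hs, e3]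
    field_simp
    push_cast
    ring

/-- As long as more than `lev (t + 1)` negative examples remain, one of `k` halfplanes that cut off all of them
cuts off at least `θ t`. -/
theorem half_le_lev_succ (t : ℕ) : p.k * (p.θ t : ℝ) ≤ p.lev (t + 1) := by
  have hk := p.k1
  have hk' : (0:ℝ) < p.k := by exact_mod_cast hk
  have h2 := Nat.mod_lt t (show 0 < 2 * p.k by omega)
  have h3 : ((t % (2 * p.k) : ℕ) : ℝ) + 1 ≤ 2 * p.k := by exact_mod_cast h2
  rw [lev_succ, lev]
  have h4 : (p.θ t : ℝ) ≤ p.n / ((2 * p.k) * 2 ^ (t / (2 * p.k))) := by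
    unfold θ; exact_mod_cast Nat.cast_div_le
  set P : ℝ := 2 ^ (t / (2 * p.k))
  have hP : 0 < P := by positivity
  calc (p.k : ℝ) * p.θ t ≤ p.k * (p.n / ((2 * p.k) * P)) := by gcongr
    _ = p.n / P * (1 / 2) := by field_simp
    _ ≤ p.n / P * (1 - (((t % (2 * p.k) : ℕ) : ℝ) + 1) / (4 * p.k)) := by
        gcongr
        rw [le_sub_comm, div_le_iff₀ (by positivity)]
        linarith
    _ = _ := by field_simp; ring

/-- Removing `θ t - 2 * gap` negative examples is progress enough for a round. The hypothesis on `n` absorbs the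
rounding of `θ t`. -/
theorem lev_drop (hn : 48 * p.k * p.ia ≤ p.n) {t : ℕ} (ht : t < p.T) :
    p.lev t - ((p.θ t : ℝ) - 2 * p.gap) ≤ p.lev (t + 1) := by
  have hk' : (1:ℝ) ≤ p.k := by exact_mod_cast p.k1
  have hia : (1:ℝ) ≤ p.ia := by exact_mod_cast p.ia1
  have hn' : 48 * p.k * p.ia ≤ (p.n : ℝ) := by exact_mod_cast hn
  have hJ : (4:ℝ) ≤ p.J := by
    have := Nat.size_pos.2 p.ia1
    have : 4 ≤ p.J := by unfold J; omega
    exact_mod_cast this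
  have hP := two_pow_div_le ht
  have hP' : (2:ℝ) ^ (t / (2 * p.k)) ≤ 8 * p.ia := by exact_mod_cast hP
  rw [lev_succ]
  have h1 : (p.n : ℝ) / ((2 * p.k) * 2 ^ (t / (2 * p.k))) ≤ p.θ t + 1 := by
    rw [div_le_iff₀ (by positivity)]
    have := Nat.lt_div_mul_add (a := p.n) (b := 2 * p.k * 2 ^ (t / (2 * p.k)))
      (by have := p.k1; positivity)
    have h2 : p.n ≤ (p.θ t + 1) * (2 * p.k * 2 ^ (t / (2 * p.k))) := by
      rw [add_mul, one_mul]; exact this.le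
    exact_mod_cast h2
  have h2 : (p.gap : ℝ) ≤ p.n / (256 * p.k * p.ia) := by
    have h3 : (p.gap : ℝ) ≤ p.n / ((32 * (2 * p.k * p.J) * p.ia : ℕ) : ℝ) := Nat.cast_div_le
    refine h3.trans ?_
    refine div_le_div_of_nonneg_left (by positivity) (by positivity) ?_
    have := mul_le_mul_of_nonneg_left hJ (show 0 ≤ (p.k : ℝ) * p.ia by positivity)
    push_cast
    linarith
  set P : ℝ := 2 ^ (t / (2 * p.k)) with hPd
  have hP0 : 0 < P := by positivity
  have h3 : (p.n : ℝ) / (32 * p.k * p.ia) ≤ p.n / P / (4 * p.k) := by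
    rw [div_div]
    refine div_le_div_of_nonneg_left (by positivity) (by positivity) ?_
    have := mul_le_mul_of_nonneg_left hP' (show 0 ≤ (p.k : ℝ) by positivity)
    linarith
  have h4 : (3:ℝ) / 4 * (p.n / (32 * p.k * p.ia)) ≥ 1 := by
    rw [ge_iff_le, mul_div, le_div_iff₀ (by positivity)]; nlinarith
  have h5 : (p.n : ℝ) / (256 * p.k * p.ia) = p.n / (32 * p.k * p.ia) / 8 := by
    rw [div_div]; congr 1; ring
  have h6 : (p.n : ℝ) / ((2 * p.k) * P) = 2 * (p.n / P / (4 * p.k)) := by field_simp; ring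
  linarith

open Classical in
/-- The invariant of the learner: at most `lev t` negative examples remain, and each round has eliminated at
most `2 * gap` positive ones. -/
def Inv (p : Params) (e : Examples) (t : ℕ) (R : Finset ℕ) : Prop :=
  R ⊆ Finset.range p.n ∧ ((R.filter fun i => e.pos i = false).card : ℝ) ≤ p.lev t ∧
    ((Finset.range p.n).filter fun i => e.pos i = true ∧ i ∉ R).card ≤ 2 * p.gap * t

open Classical in
theorem patCount_eq {t : ℕ} {R : Finset ℕ} (hR : R ⊆ Finset.range p.n) (h : ℤ × ℤ × ℤ) (b : Bool) :
    RAM.patCount ((p.data e t R).pat h.2.2 h.1 h.2.1) (if b then 2 else 1) p.n =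
      (R.filter fun i => e.pos i = b ∧ (p.learner e).cut h i).card := by
  unfold RAM.patCount
  congr 1
  ext i
  have key : (p.data e t R).pat h.2.2 h.1 h.2.1 i = (if b then 2 else 1) ↔
      i ∈ R ∧ e.pos i = b ∧ (p.learner e).cut h i := by
    unfold RAM.Data.pat RAM.Data.key data learner
    dsimp only
    by_cases hi : i ∈ R
    · by_cases hc : h.2.2 * e.Y i - h.1 * e.X i < h.2.1
      · rcases Bool.eq_false_or_eq_true (e.pos i) with hp | hp <;> cases b <;> simp [hi, hc, hp]
      · have hc' : ¬ (h.2.2 * e.Y i - h.1 * e.X i < h.2.1 ∧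
            (if i ∈ R then (if e.pos i then 1 else 0) else 2) ≤ 1) := fun hh => hc hh.1
        split_ifs <;> simp_all
    · split_ifs <;> simp_all
  rw [Finset.mem_filter, Finset.mem_filter, key]
  exact ⟨fun h => h.2, fun h => ⟨hR h.1, h⟩⟩

/-- The labels are those of a conjunction of at most `k` candidates. -/
def Realizable (p : Params) (e : Examples) : Prop :=
  ∃ l : List (ℤ × ℤ × ℤ), l.length ≤ p.k ∧ (∀ h ∈ l, h ∈ (p.learner e).Hs) ∧
    ∀ i < p.n, e.pos i = true ↔ ∀ h ∈ l, ¬ (p.learner e).cut h i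

open Classical in
/-- By the pigeonhole principle, one of the halfplanes of the target cuts off many of the remaining
negative examples. -/
theorem exists_good (hre : p.Realizable e) {t : ℕ} {R : Finset ℕ} (hR : R ⊆ Finset.range p.n)
    (hm : p.lev (t + 1) < (R.filter fun i => e.pos i = false).card) :
    ∃ h ∈ (p.learner e).Hs,
      RAM.score (p.θ t) ((p.data e t R).pat h.2.2 h.1 h.2.1) p.n = p.θ t := by
  obtain ⟨l, hl, hl', hlab⟩ := hre
  obtain ⟨h, hh, hc⟩ : ∃ h ∈ l,
      p.θ t ≤ (R.filter fun i => e.pos i = false ∧ (p.learner e).cut h i).card := by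
    by_contra! hcon
    have h1 : R.filter (fun i => e.pos i = false) ⊆ l.toFinset.biUnion
        fun h => R.filter fun i => e.pos i = false ∧ (p.learner e).cut h i := by
      intro i hi
      obtain ⟨h1, h2⟩ := Finset.mem_filter.1 hi
      have h3 := (hlab i (Finset.mem_range.1 (hR h1))).not.1 (by simp [h2])
      push Not at h3
      obtain ⟨h, h4, h5⟩ := h3
      exact Finset.mem_biUnion.2 ⟨h, by simpa using h4, Finset.mem_filter.2 ⟨h1, h2, h5⟩⟩
    have h2 := (Finset.card_le_card h1).trans (Finset.card_biUnion_le_card_mul _ _ (p.θ t)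
      fun h hh => (hcon h (by simpa using hh)).le)
    have h3 : l.toFinset.card ≤ p.k := (List.toFinset_card_le l).trans hl
    have h4 : ((R.filter fun i => e.pos i = false).card : ℝ) ≤ p.k * p.θ t := by
      exact_mod_cast h2.trans (Nat.mul_le_mul_right _ h3)
    linarith [p.half_le_lev_succ t]
  refine ⟨h, hl' h hh, ?_⟩
  have h0 : (R.filter fun i => e.pos i = true ∧ (p.learner e).cut h i).card = 0 := by
    rw [Finset.card_eq_zero, Finset.filter_eq_empty_iff]
    rintro i hi ⟨h1, h2⟩
    exact (hlab i (Finset.mem_range.1 (hR hi))).1 h1 h hh h2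
  have e1 := patCount_eq (p := p) (e := e) (t := t) hR h false
  have e2 := patCount_eq (p := p) (e := e) (t := t) hR h true
  simp only [Bool.false_eq_true, ↓reduceIte] at e1 e2
  rw [RAM.score, e1, e2, h0]
  simp [hc]

open Classical in
/-- An outcome that breaks the invariant has a score that is lower by at least `gap` than that of another
outcome: no choice is compared with the candidate of full score, and a bad candidate with no choice. -/
theorem inv_step (hn : 48 * p.k * p.ia ≤ p.n) (hre : p.Realizable e) {t : ℕ} {R : Finset ℕ}
    (ht : t < p.T) (hI : p.Inv e t R) :
    ∑ o ∈ Finset.insertNone (p.learner e).Hs,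
      (if p.Inv e (t + 1) ((p.learner e).next R o) then 0 else (p.learner e).sel t R o) ≤
      ((p.learner e).Hs.card + 1 : ℕ) * ENNReal.ofReal (((p.N + 1) / p.N : ℝ) ^ (-p.gap : ℤ)) := by
  have hN : (0:ℝ) < p.N := by exact_mod_cast p.N_pos
  set r : ℝ := (p.N + 1) / p.N with hr
  have hr1 : 1 ≤ r := by rw [hr, le_div_iff₀ hN]; linarith
  have hr0 : 0 < r := by linarith
  set Q : ℝ := ((p.N : ℝ) * (p.N + 1)) ^ p.n
  have hQ : 0 ≤ Q := by positivity
  obtain ⟨hR, hneg, hpos⟩ := hI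
  rw [← Finset.card_insertNone, ← nsmul_eq_mul]
  refine Finset.sum_le_card_nsmul _ _ _ fun o ho => ?_
  split_ifs with hI'
  · exact zero_le
  cases o with
  | none =>
    -- choosing no candidate is harmful only if many negative examples remain
    have hlt : p.lev (t + 1) < (R.filter fun i => e.pos i = false).card := by
      by_contra! hle
      exact hI' ⟨hR, hle, hpos.trans (by gcongr; omega)⟩
    obtain ⟨h, hh, hs⟩ := exists_good hre hR hlt
    refine Greedy.sel_le ho (Finset.some_mem_insertNone.2 hh) (by positivity) (le_of_eq ?_)
    simp only [Greedy.wt, V_eq e ht, W_eq, hs]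
    rw [mul_left_comm, ← zpow_add₀ hr0.ne', neg_add_eq_sub]
  | some h =>
    refine Greedy.sel_le ho (Finset.none_mem_insertNone) (by positivity) ?_
    simp only [Greedy.wt, V_eq e ht, W_eq]
    rw [mul_left_comm, ← zpow_add₀ hr0.ne']
    refine mul_le_mul_of_nonneg_left (zpow_le_zpow_right₀ hr1 ?_) hQ
    -- a candidate with a score above `θ - 2 * gap` preserves the invariant
    by_contra! hlt
    refine hI' ?_
    have e1 := patCount_eq (p := p) (e := e) (t := t) hR h false
    have e2 := patCount_eq (p := p) (e := e) (t := t) hR h true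
    simp only [Bool.false_eq_true, ↓reduceIte] at e1 e2
    rw [RAM.score, e1, e2] at hlt
    refine ⟨(Finset.filter_subset _ _).trans hR, ?_, ?_⟩
    · have hsplit : (R.filter fun i => e.pos i = false).card =
          (R.filter fun i => e.pos i = false ∧ (p.learner e).cut h i).card +
          (((p.learner e).next R (some h)).filter fun i => e.pos i = false).card := by
        rw [Greedy.next, Finset.filter_filter,
          ← Finset.card_filter_add_card_filter_not (s := R.filter fun i => e.pos i = false)
            (fun i => (p.learner e).cut h i), Finset.filter_filter, Finset.filter_filter]
        congr 3
        ext i; tauto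
      have h1 : (p.θ t : ℤ) ≤
          (R.filter fun i => e.pos i = false ∧ (p.learner e).cut h i).card + 2 * p.gap := by omega
      have h2 : (p.θ t : ℝ) ≤
          (R.filter fun i => e.pos i = false ∧ (p.learner e).cut h i).card + 2 * p.gap := by
        exact_mod_cast h1
      have h3 := lev_drop hn ht
      rw [hsplit] at hneg
      push_cast at hneg
      linarith
    · have h1 : (R.filter fun i => e.pos i = true ∧ (p.learner e).cut h i).card ≤ 2 * p.gap := by
        omega
      have h2 : ((Finset.range p.n).filter fun i => e.pos i = true ∧
          i ∉ (p.learner e).next R (some h)) ⊆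
          ((Finset.range p.n).filter fun i => e.pos i = true ∧ i ∉ R) ∪
          (R.filter fun i => e.pos i = true ∧ (p.learner e).cut h i) := by
        intro i hi
        simp only [Greedy.next, Finset.mem_filter, Finset.mem_union] at hi ⊢
        tauto
      have h3 := (Finset.card_le_card h2).trans (Finset.card_union_le _ _)
      rw [mul_add, mul_one]
      omega

open Classical in
theorem inv_zero : p.Inv e 0 (Finset.range p.n) := by
  refine ⟨le_rfl, ?_, ?_⟩
  · have : ((Finset.range p.n).filter fun i => e.pos i = false).card ≤ p.n := by
      simpa using Finset.card_filter_le (Finset.range p.n) fun i => e.pos i = false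
    simpa [lev] using this
  · simp +contextual

open Classical in
/-- The hypothesis that is described by the list of selected candidates has a small empirical error
if the invariant holds at the end. -/
theorem error_le {l : List (ℤ × ℤ × ℤ)}
    (hI : p.Inv e p.T ((Finset.range p.n).filter fun i => ∀ h ∈ l, ¬ (p.learner e).cut h i)) :
    16 * p.ia * ((Finset.range p.n).filter fun i =>
      ¬ (e.pos i = true ↔ ∀ h ∈ l, ¬ (p.learner e).cut h i)).card ≤ 3 * p.n := by
  obtain ⟨-, h1, h2⟩ := hI
  set A := ((Finset.range p.n).filter fun i => ∀ h ∈ l, ¬ (p.learner e).cut h i)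
  set E := ((Finset.range p.n).filter fun i =>
      ¬ (e.pos i = true ↔ ∀ h ∈ l, ¬ (p.learner e).cut h i))
  have hsub : E ⊆ (A.filter fun i => e.pos i = false) ∪
      ((Finset.range p.n).filter fun i => e.pos i = true ∧ i ∉ A) := by
    intro i hi
    simp only [E, A, Finset.mem_filter, Finset.mem_union] at hi ⊢
    by_cases hp : e.pos i = true
    · tauto
    · have : e.pos i = false := by simpa using hp
      tauto
  have hE := (Finset.card_le_card hsub).trans (Finset.card_union_le _ _)
  have hk := p.k1
  have hl : p.lev p.T = p.n / 2 ^ p.J := by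
    rw [lev, T, Nat.mul_mod_right, Nat.mul_div_cancel_left _ (by omega)]; simp
  rw [hl, le_div_iff₀ (by positivity)] at h1
  have h1' : (A.filter fun i => e.pos i = false).card * 2 ^ p.J ≤ p.n := by exact_mod_cast h1
  have h3 : p.gap * (32 * p.T * p.ia) ≤ p.n := Nat.div_mul_le_self _ _
  have h4 := p.pow_J.1
  have h5 : (A.filter fun i => e.pos i = false).card * (8 * p.ia) ≤ p.n :=
    (Nat.mul_le_mul_left _ h4.le).trans h1'
  have h6 : 16 * p.ia * (2 * p.gap * p.T) ≤ p.n := by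
    calc _ = p.gap * (32 * p.T * p.ia) := by ring
      _ ≤ _ := h3
  calc 16 * p.ia * E.card ≤ 16 * p.ia * ((A.filter fun i => e.pos i = false).card +
        2 * p.gap * p.T) := by gcongr; omega
    _ = 2 * ((A.filter fun i => e.pos i = false).card * (8 * p.ia)) +
        16 * p.ia * (2 * p.gap * p.T) := by ring
    _ ≤ _ := by omega

end Params

/-! ### Halfplanes on the grid -/

/-- A halfplane of nonnegative factor `c` agrees on the grid with one of the candidates. The slope is
the least integer above the slopes, multiplied by `2 * d ^ 2`, of the lines that are steeper than
required. Slopes of pairs of grid points differ by at least `1 / d ^ 2`. -/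
theorem exists_candidate_of_nonneg {d : ℤ} (hd : 1 ≤ d) (a b c : ℝ) (hc : 0 ≤ c) :
    ∃ A B : ℤ, |A| ≤ d * (2 * d * d) + 1 ∧ -((d * (2 * d * d) + 1) * d) ≤ B ∧
      B ≤ d * (2 * d * d) + (d * (2 * d * d) + 1) * d + 1 ∧
      ∀ x y : ℤ, 0 ≤ x → x ≤ d → 0 ≤ y → y ≤ d →
        (2 * d * d * y < A * x + B ↔ c * y < a * x + b) := by
  classical
  set M : ℤ := 2 * d * d with hM
  have hM0 : 0 < M := by positivity
  set G : Finset (ℤ × ℤ) := Finset.Icc 0 d ×ˢ Finset.Icc 0 d with hG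
  have memG : ∀ p : ℤ × ℤ, p ∈ G ↔ (0 ≤ p.1 ∧ p.1 ≤ d) ∧ 0 ≤ p.2 ∧ p.2 ≤ d := by
    intro p; simp [hG]
  -- the points on the two sides of the halfplane
  set I := G.filter fun p => c * p.2 < a * p.1 + b with hI
  set O := G.filter fun p => ¬ (c * p.2 < a * p.1 + b) with hO
  -- the least slopes that separate a point of `I` from a point of `O` to the left of it
  set VA : Finset ℤ := insert (-(d * M) - 1) (((I ×ˢ O).filter fun z => z.2.1 < z.1.1).image
    fun z => M * (z.1.2 - z.2.2) / (z.1.1 - z.2.1) + 1) with hVA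
  have hne : VA.Nonempty := Finset.insert_nonempty _ _
  set A := VA.max' hne with hA
  have hAmem : A ∈ VA := Finset.max'_mem _ _
  have hAle : ∀ v ∈ VA, v ≤ A := fun v hv => Finset.le_max' _ _ hv
  have hAlow : -(d * M) - 1 ≤ A := hAle _ (Finset.mem_insert_self _ _)
  have hcases : A = -(d * M) - 1 ∨ ∃ p ∈ I, ∃ q ∈ O, q.1 < p.1 ∧
      A = M * (p.2 - q.2) / (p.1 - q.1) + 1 := by
    rcases Finset.mem_insert.1 hAmem with h | h
    · exact Or.inl h
    · obtain ⟨⟨p, q⟩, hz, he⟩ := Finset.mem_image.1 h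
      obtain ⟨hz1, hz2⟩ := Finset.mem_filter.1 hz
      obtain ⟨hp, hq⟩ := Finset.mem_product.1 hz1
      exact Or.inr ⟨p, hp, q, hq, hz2, he.symm⟩
  have hAup : A ≤ d * M + 1 := by
    rcases hcases with h | ⟨p, hp, q, hq, hlt, h⟩
    · have : 0 ≤ d * M := by positivity
      linarith
    · have hp' := (memG p).1 (Finset.mem_filter.1 hp).1
      have hq' := (memG q).1 (Finset.mem_filter.1 hq).1
      rw [h]
      have h1 : M * (p.2 - q.2) / (p.1 - q.1) ≤ d * M := by
        apply Int.ediv_le_of_le_mul (by omega)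
        have h2 : M * (p.2 - q.2) ≤ M * d := mul_le_mul_of_nonneg_left (by omega) hM0.le
        have h3 : d * M * 1 ≤ d * M * (p.1 - q.1) :=
          mul_le_mul_of_nonneg_left (by omega) (by positivity)
        linarith
      linarith
  -- the given halfplane separates the two sides, and hence so does the slope `A`
  have hsep : ∀ p ∈ I, ∀ q ∈ O, a * (q.1 - p.1) < c * (q.2 - p.2) := by
    intro p hp q hq
    have h1 := (Finset.mem_filter.1 hp).2
    have h2 := (Finset.mem_filter.1 hq).2
    push Not at h2
    nlinarith
  have hkey : ∀ p ∈ I, ∀ q ∈ O, M * p.2 - A * p.1 < M * q.2 - A * q.1 := by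
    intro p hp q hq
    have hp' := (memG p).1 (Finset.mem_filter.1 hp).1
    have hq' := (memG q).1 (Finset.mem_filter.1 hq).1
    have hs := hsep p hp q hq
    rcases lt_trichotomy q.1 p.1 with hlt | heq | hgt
    · have h1 : M * (p.2 - q.2) / (p.1 - q.1) + 1 ≤ A := by
        refine hAle _ (Finset.mem_insert_of_mem (Finset.mem_image.2 ⟨(p, q), ?_, rfl⟩))
        exact Finset.mem_filter.2 ⟨Finset.mem_product.2 ⟨hp, hq⟩, hlt⟩
      have h2 := Int.lt_ediv_add_one_mul_self (M * (p.2 - q.2)) (show 0 < p.1 - q.1 by omega)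
      have h3 := mul_le_mul_of_nonneg_right h1 (show 0 ≤ p.1 - q.1 by omega)
      linarith
    · rw [heq, sub_self, mul_zero] at hs
      have h1 : (0:ℝ) < q.2 - p.2 := lt_of_mul_lt_mul_left (by rwa [mul_zero]) hc
      have h2 : p.2 < q.2 := by
        have : (p.2 : ℝ) < q.2 := by linarith
        exact_mod_cast this
      have := mul_lt_mul_of_pos_left h2 hM0
      rw [heq]; linarith
    · rcases hcases with h | ⟨p₀, hp₀, q₀, hq₀, hlt, h⟩
      · have h1 : M * (-d) ≤ M * (q.2 - p.2) := mul_le_mul_of_nonneg_left (by omega) hM0.le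
        have h2 : (d * M + 1) * 1 ≤ (d * M + 1) * (q.1 - p.1) :=
          mul_le_mul_of_nonneg_left (by omega) (by positivity)
        rw [h]
        linarith
      · have hp₀' := (memG p₀).1 (Finset.mem_filter.1 hp₀).1
        have hq₀' := (memG q₀).1 (Finset.mem_filter.1 hq₀).1
        have hs₀ := hsep p₀ hp₀ q₀ hq₀
        set s₀ := p₀.1 - q₀.1 with hs0
        set s := q.1 - p.1 with hs1
        set m₀ := p₀.2 - q₀.2 with hm0
        set m := q.2 - p.2 with hm1
        have h1 : (0:ℝ) < c * (((m * s₀ - m₀ * s : ℤ)) : ℝ) := by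
          have e1 : a * s < c * m := by simp only [hs1, hm1]; push_cast; linarith
          have e2 : c * m₀ < a * s₀ := by simp only [hs0, hm0]; push_cast; linarith
          have e3 : (0:ℝ) < s₀ := by exact_mod_cast (by omega : 0 < s₀)
          have e4 : (0:ℝ) < s := by exact_mod_cast (by omega : 0 < s)
          have e5 := mul_lt_mul_of_pos_right e1 e3
          have e6 := mul_lt_mul_of_pos_right e2 e4
          push_cast
          linarith
        have h2 : 0 < m * s₀ - m₀ * s := by
          have h1' : (0:ℝ) < ((m * s₀ - m₀ * s : ℤ) : ℝ) :=
            lt_of_mul_lt_mul_left (by rwa [mul_zero]) hc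
          exact_mod_cast h1'
        have h3 : M * m₀ / s₀ * s₀ ≤ M * m₀ := Int.ediv_mul_le _ (by omega)
        have h4 : A * s₀ ≤ M * m₀ + s₀ := by rw [h]; linarith
        have h5 : A * s₀ * s ≤ (M * m₀ + s₀) * s := mul_le_mul_of_nonneg_right h4 (by omega)
        have h6 : s₀ * s ≤ d * d := mul_le_mul (by omega) (by omega) (by omega) (by omega)
        have h7 : M * 1 ≤ M * (m * s₀ - m₀ * s) := mul_le_mul_of_nonneg_left (by omega) hM0.le
        have h8 : s₀ * (A * s) < s₀ * (M * m) := by nlinarith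
        have h9 : A * s < M * m := lt_of_mul_lt_mul_left h8 (by omega)
        simp only [hs1, hm1] at h9
        linarith
  have hAabs : |A| ≤ d * M + 1 := abs_le.2 ⟨by linarith, hAup⟩
  have hAx : ∀ x : ℤ, 0 ≤ x → x ≤ d → |A * x| ≤ (d * M + 1) * d := by
    intro x h0 h1
    rw [abs_mul, abs_of_nonneg h0]
    exact mul_le_mul hAabs h1 h0 (by positivity)
  have hrange : ∀ q ∈ G, -((d * M + 1) * d) ≤ M * q.2 - A * q.1 ∧
      M * q.2 - A * q.1 ≤ d * M + (d * M + 1) * d := by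
    intro q hq
    obtain ⟨⟨h1, h2⟩, h3, h4⟩ := (memG q).1 hq
    have := abs_le.1 (hAx q.1 h1 h2)
    have h5 := mul_le_mul_of_nonneg_left h4 hM0.le
    have h6 := mul_nonneg hM0.le h3
    constructor <;> linarith
  -- the intercept is the least key on the side `O`
  set VB : Finset ℤ := insert (d * M + (d * M + 1) * d + 1) (O.image fun q => M * q.2 - A * q.1)
    with hVB
  have hneB : VB.Nonempty := Finset.insert_nonempty _ _
  set B := VB.min' hneB with hB
  have hBle : ∀ v ∈ VB, B ≤ v := fun v hv => Finset.min'_le _ _ hv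
  have hBcases : B = d * M + (d * M + 1) * d + 1 ∨ ∃ q ∈ O, M * q.2 - A * q.1 = B := by
    have : B ∈ VB := Finset.min'_mem _ _
    rcases Finset.mem_insert.1 this with h | h
    · exact Or.inl h
    · exact Or.inr (by simpa using Finset.mem_image.1 h)
  refine ⟨A, B, hAabs, ?_, hBle _ (Finset.mem_insert_self _ _), fun x y hx hx' hy hy' => ?_⟩
  · rcases hBcases with h | ⟨q, hq, h⟩
    · have : 0 ≤ d * M := by positivity
      have : 0 ≤ (d * M + 1) * d := by positivity
      linarith
    · rw [← h]; exact (hrange q (Finset.mem_filter.1 hq).1).1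
  · have hxy : (x, y) ∈ G := (memG _).2 ⟨⟨hx, hx'⟩, hy, hy'⟩
    constructor
    · intro h
      by_contra hcon
      have : B ≤ M * y - A * x := hBle _ (Finset.mem_insert_of_mem
        (Finset.mem_image.2 ⟨(x, y), Finset.mem_filter.2 ⟨hxy, hcon⟩, rfl⟩))
      linarith
    · intro h
      have hin : (x, y) ∈ I := Finset.mem_filter.2 ⟨hxy, h⟩
      rcases hBcases with h' | ⟨q, hq, h'⟩
      · have := (hrange _ hxy).2
        simp only at this
        linarith
      · have := hkey _ hin q hq
        simp only at this
        linarith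

namespace Params
variable {p : Params}

/-- Every halfplane agrees on the grid with one of the candidates. -/
theorem exists_candidate (e : Examples) (a b c : ℝ) : ∃ h ∈ (p.learner e).Hs, ∀ x y : ℕ,
    x ≤ p.d → y ≤ p.d → (h.2.2 * y < h.1 * x + h.2.1 ↔ ¬ (c * y ≥ a * x + b)) := by
  have hd : (1:ℤ) ≤ p.d := by exact_mod_cast p.d1
  have hM : p.M = 2 * p.d * p.d := rfl
  have hAm : p.Am = (p.d + 1) * p.M := rfl
  have hBm : p.Bm = (p.d + 2) * p.Am := rfl
  set d : ℤ := (p.d : ℤ) with hdd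
  have hM0 : 2 ≤ p.M := by rw [hM]; nlinarith
  have hdM : d * 2 ≤ d * p.M := mul_le_mul_of_nonneg_left hM0 (by omega)
  have hddM : d * 1 ≤ d * (d * p.M) := mul_le_mul_of_nonneg_left (by linarith) (by omega)
  have hmem : ∀ A B C : ℤ, |A| ≤ d * p.M + 1 → -((d * p.M + 1) * d) - p.M * d ≤ B →
      B ≤ d * p.M + (d * p.M + 1) * d + 1 → (C = p.M ∨ C = -p.M) → (A, B, C) ∈ (p.learner e).Hs := by
    intro A B C hA hB hB' hC
    simp only [learner, cands, Finset.mem_product, Finset.mem_Ico, Finset.mem_insert,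
      Finset.mem_singleton]
    have := abs_le.1 hA
    rw [hBm, hAm]
    refine ⟨⟨by linarith, by linarith⟩, ⟨by linarith, by linarith⟩, hC⟩
  rcases le_total 0 c with hc | hc
  · obtain ⟨A, B, h1, h2, h3, h4⟩ := exists_candidate_of_nonneg hd a b c hc
    rw [← hM] at h1 h2 h3
    have h5 : 0 ≤ p.M * d := by positivity
    refine ⟨(A, B, p.M), hmem A B p.M h1 (by linarith) h3 (Or.inl rfl), fun x y hx hy => ?_⟩
    have := h4 x y (by omega) (by omega) (by omega) (by omega)
    simp only [Int.cast_natCast] at this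
    rw [not_le, ← this, hM]
  · -- reflect the grid
    obtain ⟨A, B, h1, h2, h3, h4⟩ := exists_candidate_of_nonneg hd a (b - c * p.d) (-c) (by linarith)
    rw [← hM] at h1 h2 h3
    have h5 : 0 ≤ p.M * d := by positivity
    refine ⟨(A, B - p.M * d, -p.M), hmem A (B - p.M * d) (-p.M) h1 (by linarith) (by linarith)
      (Or.inr rfl), fun x y hx hy => ?_⟩
    have := h4 x (d - y) (by omega) (by omega) (by omega) (by omega)
    rw [← hM] at this
    have e1 : (-p.M * (y : ℤ) < A * x + (B - p.M * d)) ↔ p.M * (d - y) < A * x + B := by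
      constructor <;> intro h <;> linarith
    simp only [e1, this, not_le]
    push_cast
    simp only [d, Int.cast_natCast]
    constructor <;> intro h <;> linarith

end Params

/-! ### Generalization -/

open Classical in
/-- A hypothesis of error greater than `α` is unlikely to have a small empirical error. -/
theorem measure_small_error_le {d n ia : ℕ} {α : ℝ} (hα : 0 < α) (hia : 1 / α ≤ ia)
    (D : Measure (Grid d)) [IsProbabilityMeasure D] (c h : Concept (Grid d))
    (herr : α < genError D c h) :
    (Measure.pi fun _ : Fin n => D) {x | 16 * ia * (Finset.univ.filter fun i =>
      h (x i) ≠ c (x i)).card ≤ 3 * n} ≤ ENNReal.ofReal (Real.exp (-(α * n / 4))) := by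
  set μ := Measure.pi fun _ : Fin n => D
  -- Markov's inequality for `(1 / 2) ^ Z`, where `Z` is the number of errors
  set f : Grid d → ℝ := fun q => if h q ≠ c q then 1 / 2 else 1 with hf
  set Z : (Fin n → Grid d) → ℕ := fun x => (Finset.univ.filter fun i => h (x i) ≠ c (x i)).card
  have hia0 : (0:ℝ) < ia := (by positivity : 0 < 1 / α).trans_le hia
  have hprod : ∀ x : Fin n → Grid d, ∏ i, f (x i) = (1 / 2) ^ Z x := by
    intro x
    simp only [hf, Finset.prod_ite, Finset.prod_const, one_pow, mul_one, Z]
  have hint : ∫ q, f q ∂D = 1 - genError D c h / 2 := by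
    have e1 : f = fun q => 1 - {q | h q ≠ c q}.indicator (fun _ => (1:ℝ) / 2) q := by
      funext q
      by_cases hq : h q = c q <;> simp [hf, hq]
      norm_num
    rw [e1, integral_sub (integrable_const _) Integrable.of_finite, integral_indicator
      (Set.toFinite _).measurableSet]
    simp [genError]
    ring
  have hE0 : 0 ≤ genError D c h := by linarith
  have hE1 : genError D c h ≤ 1 := measureReal_le_one
  have hI : ∫ x, ∏ i, f (x i) ∂μ ≤ Real.exp (-(α * n / 2)) := by
    rw [integral_fintype_prod_eq_pow, hint, Fintype.card_fin]
    calc (1 - genError D c h / 2) ^ n ≤ (Real.exp (-(α / 2))) ^ n := by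
          refine pow_le_pow_left₀ (by linarith) ?_ _
          have := Real.add_one_le_exp (-(α / 2))
          linarith
      _ = _ := by rw [← Real.exp_nat_mul]; ring_nf
  set ρ : ℝ := Real.exp (-(3 * α * n / 16)) with hρ
  have hsub : {x | 16 * ia * Z x ≤ 3 * n} ⊆ {x : Fin n → Grid d | ρ ≤ ∏ i, f (x i)} := by
    intro x hx
    have hx' : (16:ℝ) * ia * Z x ≤ 3 * n := by exact_mod_cast hx
    have h1 : (Z x : ℝ) ≤ 3 * α * n / 16 := by
      rw [div_le_iff₀ hα] at hia
      have : (Z x : ℝ) * 1 ≤ Z x * (ia * α) := by gcongr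
      nlinarith
    have h2 : Real.exp (-1) ≤ 1 / 2 := by
      rw [Real.exp_neg, ← one_div]
      have := Real.add_one_le_exp 1
      exact one_div_le_one_div_of_le (by norm_num) (by linarith)
    rw [Set.mem_ofPred_eq, hprod, hρ]
    calc Real.exp (-(3 * α * n / 16)) ≤ Real.exp (-(Z x)) := Real.exp_le_exp.2 (by linarith)
      _ = Real.exp (-1) ^ Z x := by rw [← Real.exp_nat_mul]; ring_nf
      _ ≤ _ := by gcongr
  have hmarkov := mul_meas_ge_le_integral_of_nonneg (μ := μ) (f := fun x => ∏ i, f (x i))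
    (Filter.Eventually.of_forall fun x => by simp only [hprod]; positivity)
    Integrable.of_finite ρ
  have h3 : μ.real {x | ρ ≤ ∏ i, f (x i)} ≤ Real.exp (-(α * n / 4)) := by
    have hρ0 : 0 < ρ := Real.exp_pos _
    rw [← mul_le_mul_iff_right₀ hρ0]
    refine (hmarkov.trans hI).trans ?_
    rw [hρ, ← Real.exp_add]
    refine Real.exp_le_exp.2 ?_
    have : 0 ≤ α * n := by positivity
    linarith
  calc μ {x | 16 * ia * Z x ≤ 3 * n} ≤ μ {x | ρ ≤ ∏ i, f (x i)} := measure_mono hsub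
    _ = ENNReal.ofReal (μ.real {x | ρ ≤ ∏ i, f (x i)}) := (ofReal_measureReal).symm
    _ ≤ _ := ENNReal.ofReal_le_ofReal h3

namespace Greedy
variable {ι H : Type*} [DecidableEq H]

/-- The lists that can be selected in `k` rounds. -/
noncomputable def lists (Hs : Finset H) : ℕ → Finset (List H)
  | 0 => {[]}
  | k + 1 => Finset.image₂ (fun o l => o.toList ++ l) (Finset.insertNone Hs) (lists Hs k)

theorem card_lists_le (Hs : Finset H) (k : ℕ) : (lists Hs k).card ≤ (Hs.card + 1) ^ k := by
  induction k with
  | zero => simp [lists]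
  | succ k ih =>
    rw [lists, pow_succ, mul_comm, ← Finset.card_insertNone]
    exact (Finset.card_image₂_le _ _ _).trans (Nat.mul_le_mul_left _ (by simpa using ih))

theorem mem_lists (G : Greedy ι H) (k : ℕ) :
    ∀ t R, ∀ l ∈ (G.run k t R).support, l ∈ lists G.Hs k := by
  induction k with
  | zero => intro t R l hl; simpa [run, lists] using hl
  | succ k ih =>
    intro t R l hl
    rw [run, PMF.mem_support_bind_iff] at hl
    obtain ⟨o, ho, hl⟩ := hl
    rw [PMF.mem_support_map_iff] at hl
    obtain ⟨l', hl', rfl⟩ := hl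
    refine Finset.mem_image₂_of_mem ?_ (ih _ _ _ hl')
    by_contra hcon
    exact (PMF.mem_support_iff _ _).1 ho (sel_eq_zero G hcon)

end Greedy

/-- The output that describes a list of halfplanes. -/
def encode (l : List (ℤ × ℤ × ℤ)) : List ℤ := l.flatMap fun h => [h.1, h.2.1, h.2.2]

theorem triples_encode (l : List (ℤ × ℤ × ℤ)) : triples (encode l) = l := by
  induction l with
  | nil => rfl
  | cons h l ih =>
    simp only [encode, List.flatMap_cons, List.cons_append, List.nil_append, triples] at ih ⊢
    rw [ih]

/-- The examples of a database. -/
def examples {n d : ℕ} (S : Fin n → Grid d × Bool) : Examples where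
  X i := if h : i < n then ((S ⟨i, h⟩).1.1 : ℕ) else 0
  Y i := if h : i < n then ((S ⟨i, h⟩).1.2 : ℕ) else 0
  pos i := if h : i < n then (S ⟨i, h⟩).2 else false

namespace Params
variable {p : Params}

theorem halfplane_iff (h : ℤ × ℤ × ℤ) (q : Grid p.d) :
    halfplane h.1 h.2.1 h.2.2 q.toPlane = true ↔
      ¬ (h.2.2 * (q.2 : ℕ) < h.1 * (q.1 : ℕ) + h.2.1) := by
  rw [halfplane, decide_eq_true_iff, Grid.toPlane, not_lt, ge_iff_le]
  dsimp only
  exact_mod_cast Iff.rfl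

theorem gridHypothesis_encode (l : List (ℤ × ℤ × ℤ)) (q : Grid p.d) :
    gridHypothesis (encode l) q = true ↔
      ∀ h ∈ l, ¬ (h.2.2 * (q.2 : ℕ) < h.1 * (q.1 : ℕ) + h.2.1) := by
  simp only [gridHypothesis, triples_encode, List.all_eq_true, halfplane_iff]

theorem cut_iff {S : Fin p.n → Grid p.d × Bool} {h : ℤ × ℤ × ℤ} (i : Fin p.n) :
    (p.learner (examples S)).cut h i ↔
      h.2.2 * ((S i).1.2 : ℕ) < h.1 * ((S i).1.1 : ℕ) + h.2.1 := by
  simp only [learner, examples, Fin.is_lt, ↓reduceDIte, Fin.eta]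
  constructor <;> intro h <;> linarith

theorem realizable {c : Concept (Grid p.d)} (hc : c ∈ gridConvexGons p.k p.d)
    (x : Fin p.n → Grid p.d) : p.Realizable (examples (labelled c x)) := by
  obtain ⟨f, ⟨l, hl, hH, rfl⟩, rfl⟩ := hc
  set e := examples (labelled (fun q : Grid p.d => l.all fun h => h q.toPlane) x)
  have hch : ∀ g : Concept (ℝ × ℝ), ∃ t : ℤ × ℤ × ℤ, g ∈ l → t ∈ (p.learner e).Hs ∧
      ∀ i : Fin p.n, (p.learner e).cut t i ↔ ¬ (g (x i).toPlane = true) := by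
    intro g
    by_cases hg : g ∈ l
    · obtain ⟨a, b, c, rfl⟩ := hH g hg
      obtain ⟨t, ht, ht'⟩ := exists_candidate e a b c
      refine ⟨t, fun _ => ⟨ht, fun i => ?_⟩⟩
      rw [cut_iff, halfplane, decide_eq_true_iff]
      exact ht' _ _ (Nat.lt_succ_iff.1 (x i).1.2) (Nat.lt_succ_iff.1 (x i).2.2)
    · exact ⟨0, fun h => absurd h hg⟩
  choose t ht using hch
  refine ⟨l.map t, by simpa using hl, ?_, fun i hi => ?_⟩
  · intro h hh
    obtain ⟨g, hg, rfl⟩ := List.mem_map.1 hh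
    exact (ht g hg).1
  · have e1 : e.pos i = l.all fun h => h (x ⟨i, hi⟩).toPlane := by
      simp [e, examples, labelled, hi]
    rw [e1, List.all_eq_true]
    simp only [List.forall_mem_map]
    refine forall₂_congr fun g hg => ?_
    rw [(ht g hg).2 ⟨i, hi⟩, not_not]

theorem card_cands : (p.cands.card : ℤ) = 8 * p.Am * p.Bm := by
  have hM := p.M_pos
  have hne : p.M ≠ -p.M := by omega
  have h1 : 0 ≤ p.Am := by unfold Am; positivity
  have h2 : 0 ≤ p.Bm := by unfold Bm; positivity
  simp only [cands, Finset.card_product, Int.card_Ico, Finset.card_pair hne]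
  push_cast
  rw [Int.toNat_of_nonneg (by omega), Int.toNat_of_nonneg (by omega)]
  ring

/-- The algorithm, as a map from databases to laws of outputs. -/
noncomputable def algorithm (p : Params) (S : Fin p.n → Grid p.d × Bool) : PMF (List ℤ) :=
  ((p.learner (examples S)).run p.T 0 (Finset.range p.n)).map encode

open Classical in
/-- Either the learner fails to attain a small empirical error, or one of the hypotheses that it may
output has a large error but a small empirical one. -/
theorem algorithm_failure_le {α β : ℝ} (hn : 48 * p.k * p.ia ≤ p.n)
    (h₁ : p.T * ((p.cands.card + 1) * ((p.N + 1) / p.N : ℝ) ^ (-p.gap : ℤ)) ≤ β)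
    (D : Measure (Grid p.d)) {c : Concept (Grid p.d)} (hc : c ∈ gridConvexGons p.k p.d)
    (x : Fin p.n → Grid p.d) :
    (p.algorithm (labelled c x)).toOuterMeasure {o | α < genError D c (gridHypothesis o)} ≤
      ENNReal.ofReal β + ∑ l ∈ (Greedy.lists p.cands p.T).filter
        fun l => α < genError D c (gridHypothesis (encode l)),
        {x : Fin p.n → Grid p.d | 16 * p.ia * (Finset.univ.filter fun i =>
          gridHypothesis (encode l) (x i) ≠ c (x i)).card ≤ 3 * p.n}.indicator 1 x := by
  set bad := fun (l : List (ℤ × ℤ × ℤ)) => {x : Fin p.n → Grid p.d | 16 * p.ia *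
    (Finset.univ.filter fun i => gridHypothesis (encode l) (x i) ≠ c (x i)).card ≤ 3 * p.n} with hbad
  set Ls := (Greedy.lists p.cands p.T).filter
    fun l => α < genError D c (gridHypothesis (encode l)) with hLs
  set e := examples (labelled c x) with he
  have hbadl : ∀ l, p.Inv e p.T
      ((Finset.range p.n).filter fun i => ∀ h ∈ l, ¬ (p.learner e).cut h i) → x ∈ bad l := by
    intro l hl
    refine le_trans ?_ (error_le hl)
    refine Nat.mul_le_mul_left _ ?_
    rw [← Finset.card_map Fin.valEmbedding]
    refine Finset.card_le_card fun i hi => ?_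
    obtain ⟨j, hj, rfl⟩ := Finset.mem_map.1 hi
    have hj' := (Finset.mem_filter.1 hj).2
    simp only [Fin.valEmbedding_apply, Finset.mem_filter, Finset.mem_range, Fin.is_lt, true_and]
    intro hcon
    refine hj' (Bool.eq_iff_iff.2 ?_)
    rw [gridHypothesis_encode]
    have hpos : e.pos j = c (x j) := by simp [he, examples, labelled]
    simp only [he, cut_iff] at hcon
    rw [← he, hpos] at hcon
    exact hcon.symm
  rw [algorithm, PMF.toOuterMeasure_map_apply, ← he]
  set A := {l : List (ℤ × ℤ × ℤ) | ¬ p.Inv e (0 + p.T)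
      ((Finset.range p.n).filter fun i => ∀ h ∈ l, ¬ (p.learner e).cut h i)} with hA
  set B := {l : List (ℤ × ℤ × ℤ) | l ∈ Ls ∧ x ∈ bad l} with hB
  have h3 : ((p.learner e).run p.T 0 (Finset.range p.n)).toOuterMeasure A ≤ ENNReal.ofReal β := by
    have h4 := Greedy.run_not_inv_le (G := p.learner e) (Inv := p.Inv e) (K := p.T)
      (fun t R ht hI => inv_step hn (realizable hc x) ht hI)
      p.T 0 (Finset.range p.n) (by omega) inv_zero
    refine h4.trans ?_
    have h5 : (p.learner e).Hs.card = p.cands.card := rfl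
    rw [h5]
    have h6 := ENNReal.ofReal_le_ofReal h₁
    rw [ENNReal.ofReal_mul (by positivity), ENNReal.ofReal_mul (by positivity),
      ENNReal.ofReal_natCast, ENNReal.ofReal_add (by positivity) (by positivity),
      ENNReal.ofReal_natCast, ENNReal.ofReal_one] at h6
    exact_mod_cast h6
  have h4 : ((p.learner e).run p.T 0 (Finset.range p.n)).toOuterMeasure B ≤
      ∑ l ∈ Ls, (bad l).indicator 1 x := by
    rcases B.eq_empty_or_nonempty with hE | ⟨l, hl, hx⟩
    · rw [hE, measure_empty]; exact zero_le
    · refine (Greedy.toOuterMeasure_le_one _ _).trans ?_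
      calc (1:ENNReal) = (bad l).indicator 1 x := by rw [Set.indicator_of_mem hx]; rfl
        _ ≤ _ := Finset.single_le_sum (f := fun l => (bad l).indicator (1 : (Fin p.n → Grid p.d) → ENNReal) x)
            (fun _ _ => zero_le) hl
  refine le_trans (PMF.toOuterMeasure_mono _ (t := A ∪ B) ?_) ((measure_union_le _ _).trans
    (add_le_add h3 h4))
  rintro l ⟨hl, hl'⟩
  by_cases hlA : l ∈ A
  · exact Or.inl hlA
  · refine Or.inr ⟨Finset.mem_filter.2 ⟨Greedy.mem_lists (p.learner e) _ _ _ l hl', hl⟩, hbadl l ?_⟩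
    have := not_not.1 hlA
    rwa [zero_add] at this

open Classical in
theorem algorithm_learns {α β : ℝ} (hα : 0 < α)
    (hβ : 0 < β) (hia : 1 / α ≤ p.ia) (hn : 48 * p.k * p.ia ≤ p.n)
    (h₁ : p.T * ((p.cands.card + 1) * ((p.N + 1) / p.N : ℝ) ^ (-p.gap : ℤ)) ≤ β / 2)
    (h₂ : (p.cands.card + 1 : ℝ) ^ p.T * Real.exp (-(α * p.n / 4)) ≤ β / 2) :
    IsPACLearner p.algorithm gridHypothesis (gridConvexGons p.k p.d) α β := by
  intro D hD c hc
  set bad := fun (l : List (ℤ × ℤ × ℤ)) => {x : Fin p.n → Grid p.d | 16 * p.ia *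
    (Finset.univ.filter fun i => gridHypothesis (encode l) (x i) ≠ c (x i)).card ≤ 3 * p.n} with hbad
  set Ls := (Greedy.lists p.cands p.T).filter
    fun l => α < genError D c (gridHypothesis (encode l)) with hLs
  calc _ ≤ ∫⁻ x, (ENNReal.ofReal (β / 2) + ∑ l ∈ Ls, (bad l).indicator 1 x)
        ∂(Measure.pi fun _ => D) := lintegral_mono fun x => algorithm_failure_le hn h₁ D hc x
    _ = ENNReal.ofReal (β / 2) + ∑ l ∈ Ls, (Measure.pi fun _ : Fin p.n => D) (bad l) := by
        have hm : ∀ s : Set (Fin p.n → Grid p.d), MeasurableSet s := fun s =>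
          (Set.toFinite s).measurableSet
        rw [lintegral_add_left measurable_const, lintegral_const, measure_univ, mul_one,
          lintegral_finsetSum _ fun l _ => measurable_one.indicator (hm _)]
        congr 1
        exact Finset.sum_congr rfl fun l _ => lintegral_indicator_one (hm _)
    _ ≤ ENNReal.ofReal (β / 2) + ∑ l ∈ Ls, ENNReal.ofReal (Real.exp (-(α * p.n / 4))) := by
        gcongr with l hl
        exact measure_small_error_le hα hia D c _ (Finset.mem_filter.1 hl).2
    _ ≤ ENNReal.ofReal (β / 2) + ENNReal.ofReal (β / 2) := by
        gcongr
        rw [Finset.sum_const, nsmul_eq_mul]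
        refine le_trans ?_ (ENNReal.ofReal_le_ofReal h₂)
        rw [ENNReal.ofReal_mul (by positivity)]
        gcongr
        have h3 : Ls.card ≤ (p.cands.card + 1) ^ p.T :=
          (Finset.card_filter_le _ _).trans (Greedy.card_lists_le p.cands p.T)
        rw [show (p.cands.card + 1 : ℝ) ^ p.T = (((p.cands.card + 1) ^ p.T : ℕ) : ℝ) by
          push_cast; rfl, ENNReal.ofReal_natCast]
        exact_mod_cast h3
    _ = ENNReal.ofReal β := by
        rw [← ENNReal.ofReal_add (by positivity) (by positivity)]; congr 1; ring

theorem algorithm_private {ε δ : ℝ} (hδ : 0 < δ) (hε : ε < 1)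
    (hNε : 2 * (Real.log (3 / δ) + 2) / p.N ≤ ε) : IsDP p.algorithm ε δ := by
  rintro S S' ⟨i, hi⟩ T
  simp only [algorithm, PMF.toOuterMeasure_map_apply]
  refine learner_private (i := i) (fun j hj => ?_) hδ hε hNε _ _ _ _
  by_cases hjn : j < p.n
  · have : S ⟨j, hjn⟩ = S' ⟨j, hjn⟩ := hi _ fun h => hj (by rw [← h])
    simp [examples, hjn, this]
  · simp [examples, hjn]

end Params
end PrivateLearning

namespace RAM
open RAM.Expr

/-! ### The program -/

/-- Adds to `mem[-11]` the bit length of `mem[-10]`. -/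
def sizeLoop : Prog :=
  .loop (reg (-10)) (asg (-10) (reg (-10) / lit 2) ;; asg (-11) (reg (-11) + lit 1))

/-- Computes the parameters of the search from the input. -/
def setup : Prog :=
  (asg (-10) (reg 6) ;; asg (-11) (lit 0)) ;; sizeLoop ;;
  (asg (-1) (lit 2 * reg 5 * (reg (-11) + lit 4)) ;; asg (-10) (reg 3) ;; asg (-11) (lit 0)) ;;
  sizeLoop ;;
  (asg (-6) (lit 2 * reg 2 * (reg (-11) + lit 3)) ;;
    asg (-5) (reg 0 / (lit 32 * reg (-6) * reg 3)) ;;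
    asg (-2) (lit 2 * reg 1 * reg 1) ;;
    asg (-3) ((reg 1 + lit 1) * reg (-2)) ;;
    asg (-4) ((reg 1 + lit 2) * reg (-3)) ;;
    asg (-7) (lit 0))

/-- Doubles `mem[-10]` once for each phase that has been completed. -/
def phaseLoop : Prog :=
  .loop (reg (-11) - lit 2 * reg 2 + lit 1)
    (asg (-10) (lit 2 * reg (-10)) ;; asg (-11) (reg (-11) - lit 2 * reg 2))

/-- Multiplies `mem[-9]` by the weight of choosing no candidate. -/
def skipLoop : Prog :=
  .loop (reg 0 - reg (-10))
    (.ite (reg (-8) - reg (-5) - reg (-10))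
      (asg (-9) (reg (-9) * ((reg (-1) + lit 1) * (reg (-1) + lit 1))))
      (asg (-9) (reg (-9) * (reg (-1) * (reg (-1) + lit 1)))) ;;
    asg (-10) (reg (-10) + lit 1))

/-- Prepares a round and computes the total weight of the candidates. -/
def prepare : Prog :=
  (asg (-10) (lit 2 * reg 2) ;; asg (-11) (reg (-7))) ;; phaseLoop ;;
  (asg (-8) (reg 0 / reg (-10)) ;; asg (-9) (lit 2) ;; asg (-10) (lit 0)) ;; skipLoop ;;
  (asg (-20) (lit (-1)) ;; asg (-21) (lit 0)) ;; walk

/-- Marks the examples that the selected candidate cuts off as eliminated. -/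
def markLoop : Prog :=
  .loop (reg 0 - reg (-10))
    (.ite (reg (-22) * get (lit 7 + lit 3 * reg (-10)) + reg (-24) -
        reg (-23) * get (lit 8 + lit 3 * reg (-10)))
      (.set (lit 9 + lit 3 * reg (-10)) (lit 2)) .skip ;;
    asg (-10) (reg (-10) + lit 1))

/-- Selects the candidate at the position `mem[-20]`, if there is one, and eliminates the examples that
it cuts off. -/
def choose : Prog :=
  asg (-21) (lit 0) ;; walk ;;
  .ite (reg (-21))
    ((.emit (reg (-22)) ;; .emit (reg (-24)) ;; .emit (reg (-23)) ;; asg (-10) (lit 0)) ;; markLoop)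
    .skip ;;
  asg (-7) (reg (-7) + lit 1)

/-- The random position in a round. -/
def draw : Prog := .rand (lit (-20)) (reg (-9) - reg (-20) - lit 2)

/-- A round of the learner. -/
def learnRound : Prog := prepare ;; draw ;; choose

/-- The learner. -/
def main : Prog := setup ;; .loop (reg (-6) - reg (-7)) learnRound

/-- A program that writes no output. -/
def Prog.silent : Prog → Bool
  | .emit _ => false
  | .seq p q => p.silent && q.silent
  | .ite _ p q => p.silent && q.silent
  | .loop _ p => p.silent
  | _ => true

theorem mem_support_andThen {μ : PMF Outcome} {g : State → PMF Outcome} {s' : State} {t : ℕ}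
    (h : some (s', t) ∈ (andThen μ g).support) : ∃ s₁ t₁ t₂, some (s₁, t₁) ∈ μ.support ∧
      some (s', t₂) ∈ (g s₁).support := by
  rw [andThen, PMF.mem_support_bind_iff] at h
  obtain ⟨_ | ⟨s₁, t₁⟩, h1, h2⟩ := h
  · simp at h2
  · rw [PMF.mem_support_map_iff] at h2
    obtain ⟨_ | ⟨s₂, t₂⟩, h3, h4⟩ := h2
    · simp [Outcome.delay] at h4
    · simp only [Outcome.delay, Option.map_some, Option.some.injEq, Prod.mk.injEq] at h4
      obtain ⟨rfl, -⟩ := h4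
      exact ⟨s₁, t₁, t₂, h1, h3⟩

theorem mem_support_delay {μ : PMF Outcome} {c : ℕ} {s' : State} {t : ℕ}
    (h : some (s', t) ∈ (μ.map (Outcome.delay c)).support) : ∃ t₂, some (s', t₂) ∈ μ.support := by
  rw [PMF.mem_support_map_iff] at h
  obtain ⟨_ | ⟨s₂, t₂⟩, h3, h4⟩ := h
  · simp [Outcome.delay] at h4
  · simp only [Outcome.delay, Option.map_some, Option.some.injEq, Prod.mk.injEq] at h4
    obtain ⟨rfl, -⟩ := h4
    exact ⟨t₂, h3⟩

theorem Prog.out_eq_of_silent {F : ℕ} : ∀ {p : Prog}, p.silent = true → ∀ {s s' : State} {t : ℕ},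
    some (s', t) ∈ (p.run F s).support → s'.out = s.out
  | .skip, _, s, s', t, h => by simp [Prog.run] at h; rw [h.1]
  | .set _ _, _, s, s', t, h => by simp [Prog.run] at h; rw [h.1]; rfl
  | .rand _ _, _, s, s', t, h => by
      rw [Prog.run, PMF.mem_support_map_iff] at h
      obtain ⟨r, -, h⟩ := h
      simp only [Option.some.injEq, Prod.mk.injEq] at h
      rw [← h.1]; rfl
  | .seq p q, hs, s, s', t, h => by
      simp only [Prog.silent, Bool.and_eq_true] at hs
      obtain ⟨s₁, t₁, t₂, h1, h2⟩ := mem_support_andThen h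
      rw [Prog.out_eq_of_silent hs.2 h2, Prog.out_eq_of_silent hs.1 h1]
  | .ite e p q, hs, s, s', t, h => by
      simp only [Prog.silent, Bool.and_eq_true] at hs
      obtain ⟨t₂, h⟩ := mem_support_delay h
      split_ifs at h
      · exact Prog.out_eq_of_silent hs.1 h
      · exact Prog.out_eq_of_silent hs.2 h
  | .loop e p, hs, s, s', t, h => by
      have key : ∀ (f : ℕ) (s : State) (t : ℕ),
          some (s', t) ∈ (whileRun e (p.run F) f s).support → s'.out = s.out := by
        intro f
        induction f with
        | zero =>
          intro s t h
          rw [whileRun] at h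
          split_ifs at h
          · simp at h
          · simp at h; rw [h.1]
        | succ f ih =>
          intro s t h
          rw [whileRun] at h
          split_ifs at h
          · obtain ⟨t', h⟩ := mem_support_delay h
            obtain ⟨s₁, t₁, t₂, h1, h2⟩ := mem_support_andThen h
            rw [ih _ _ h2, Prog.out_eq_of_silent (p := p) hs h1]
          · simp at h; rw [h.1]
      exact key F s t h

theorem Tri.silent {F : ℕ} {p : Prog} {s : State} {c : ℕ} {Q : State → Prop} (h : Tri F p s c Q)
    (hp : p.silent = true) : Tri F p s c (fun s' => Q s' ∧ s'.out = s.out) := fun hc => by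
  obtain ⟨s', t, h1, h2, h3⟩ := h hc
  exact ⟨s', t, h1, h2, h3, Prog.out_eq_of_silent hp (t := t) (by rw [h1]; simp)⟩

theorem size_half {z : ℕ} (hz : 0 < z) : Nat.size z = Nat.size (z / 2) + 1 := by
  have h0 := Nat.size_pos.2 hz
  have h1 : Nat.size (z / 2) ≤ Nat.size z - 1 := by
    rw [Nat.size_le, Nat.div_lt_iff_lt_mul (by norm_num), ← pow_succ,
      show Nat.size z - 1 + 1 = Nat.size z by omega]
    exact Nat.lt_size_self z
  have h2 : Nat.size z ≤ Nat.size (z / 2) + 1 := by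
    rw [Nat.size_le, pow_succ, ← Nat.div_lt_iff_lt_mul (by norm_num)]
    exact Nat.lt_size_self _
  omega

theorem sizeLoop_spec {F w : ℕ} (hw : 7 ≤ w) {s : State} {z : ℕ} (hB : Bdd w s.mem)
    (h10 : s.mem (-10) = z) (h11 : s.mem (-11) = 0) (hz : z < 2 ^ w) :
    Tri F sizeLoop s (w * (200 * (w + 1)) + 4 * (w + 1)) (fun s' => Bdd w s'.mem ∧
      Same (-10) s.mem s'.mem ∧ s'.mem (-11) = Nat.size z) := by
  have hzw : Nat.size z ≤ w := Nat.size_le.2 hz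
  have hww : (w : ℤ) < 2 ^ w := by exact_mod_cast Nat.lt_two_pow_self
  refine (Tri.loop (g := 4 * (w + 1)) (c := 100 * (w + 1)) (fun v s' => Bdd w s'.mem ∧
    Same (-10) s.mem s'.mem ∧
    ∃ y : ℕ, s'.mem (-10) = y ∧ v = Nat.size y ∧ y ≤ z ∧
      s'.mem (-11) = (Nat.size z : ℤ) - Nat.size y) ?_ ?_ ?_ (v := Nat.size z)
    ⟨hB, Same.refl _ _, z, h10, rfl, le_rfl, by rw [h11]; ring⟩).mono ?_ fun _ => id
  · intro v s' h
    exact (Expr.cost_le hw h.1 _ rfl).trans (Nat.mul_le_mul_right _ (by decide))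
  · rintro v s' ⟨hB', hS, y, h1, rfl, h3, h4⟩ hg
    simp only [val_reg, h1] at hg
    have hy : 0 < y := by exact_mod_cast hg
    have hsz := size_half hy
    have hyz : Nat.size y ≤ Nat.size z := Nat.size_le_size h3
    refine ⟨by omega, (Tri.block (C := 100) (Q := fun s' => Same (-10) s.mem s'.mem ∧
      s'.mem (-10) = (y / 2 : ℕ) ∧ s'.mem (-11) = (Nat.size z : ℤ) - Nat.size (y / 2))
      hw (by rfl) (by decide) hB' ?_).mono le_rfl fun s₁ h₁ =>
        ⟨h₁.2, h₁.1.1, y / 2, h₁.1.2.1, by omega, by omega, h₁.1.2.2⟩⟩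
    simp only [asg, Prog.wp, val_lit, val_reg, val_div, val_add, write_mem, h1, h4, Int.reduceNeg,
      Int.reduceEq, ↓reduceIte]
    have hy2 : (y : ℤ) < 2 ^ w := by exact_mod_cast h3.trans_lt hz
    refine ⟨by rw [abs_lt]; constructor <;> omega, by rw [abs_lt]; constructor <;> omega,
      fun j hj => ?_, by push_cast; rfl, by rw [hsz]; push_cast; ring⟩
    simp only [write_mem]
    rw [if_neg (by omega), if_neg (by omega)]
    exact hS j hj
  · rintro v s' ⟨hB', hS, y, h1, rfl, h3, h4⟩ hg
    simp only [val_reg, h1] at hg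
    have hy : y = 0 := by omega
    subst hy
    exact ⟨hB', hS, by simpa using h4⟩
  · calc _ ≤ w * (4 * (w + 1) + 100 * (w + 1)) + 4 * (w + 1) := by gcongr
      _ ≤ _ := by nlinarith

end RAM

namespace PrivateLearning

/-! ### The steps of a round -/

namespace Params
open RAM RAM.Expr
variable {p : Params} {e : Examples}

/-- All numbers that occur have at most `w` bits. -/
structure Room (p : Params) (e : Examples) (w : ℕ) : Prop where
  w7 : 7 ≤ w
  nn : (p.n : ℤ) * p.n < 2 ^ w
  par : 16 * p.T * p.ia < 2 ^ w
  big : 64 * p.Am * p.Bm * ((p.N + 1) * (p.N + 1)) ^ p.n < 2 ^ w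
  X : ∀ i, 0 ≤ e.X i ∧ e.X i ≤ p.d
  Y : ∀ i, 0 ≤ e.Y i ∧ e.Y i ≤ p.d

theorem Am_pos : 0 < p.Am := by have := p.M_pos; unfold Am; positivity

theorem Room.fits {w : ℕ} (h : p.Room e w) (t : ℕ) (R : Finset ℕ) : (p.data e t R).Fits w where
  w7 := h.w7
  n1 := p.n1
  N1 := p.N_pos
  L2 i _ := by unfold data; dsimp only; split_ifs <;> omega
  nn := h.nn
  Am1 := p.Am_pos
  big := h.big
  key_lt sg hsg A hA hA' i _ := by
    simp only [data] at hA hA' ⊢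
    have hM := p.M_pos
    obtain ⟨hx, hx'⟩ := h.X i
    obtain ⟨hy, hy'⟩ := h.Y i
    have hAA : |A| ≤ p.Am := abs_le.2 ⟨hA, hA'.le⟩
    have h1 : |sg * p.M * e.Y i| ≤ p.M * p.d := by
      rw [abs_mul, abs_mul, hsg, one_mul, abs_of_pos hM, abs_of_nonneg hy]
      exact mul_le_mul_of_nonneg_left hy' hM.le
    have h2 : |A * e.X i| ≤ p.Am * p.d := by
      rw [abs_mul, abs_of_nonneg hx]
      exact mul_le_mul hAA hx' hx p.Am_pos.le
    have h3 := abs_sub (sg * p.M * e.Y i) (A * e.X i)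
    have h4 : p.M * p.d ≤ p.Am := by unfold Am; nlinarith
    have h5 := p.Am_pos
    refine lt_of_le_of_lt h3 ?_
    rw [Bm]
    linarith

/-- The state before round `t`, where `R` is the set of remaining examples. -/
structure Ready (p : Params) (e : Examples) (w t : ℕ) (R : Finset ℕ) (s : State) : Prop where
  bdd : Bdd w s.mem
  n : s.mem 0 = p.n
  k : s.mem 2 = p.k
  N : s.mem (-1) = p.N
  M : s.mem (-2) = p.M
  Am : s.mem (-3) = p.Am
  Bm : s.mem (-4) = p.Bm
  gap : s.mem (-5) = p.gap
  T : s.mem (-6) = p.T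
  rd : s.mem (-7) = t
  X : ∀ i < p.n, s.mem (7 + 3 * (i : ℤ)) = e.X i
  Y : ∀ i < p.n, s.mem (8 + 3 * (i : ℤ)) = e.Y i
  L : ∀ i < p.n, s.mem (9 + 3 * (i : ℤ)) = (p.data e t R).L i

theorem Ready.same {w t : ℕ} {R : Finset ℕ} {s s' : State} (h : p.Ready e w t R s) {a : ℤ}
    (hs : Same a s.mem s'.mem) (ha : a < -7) (hB : Bdd w s'.mem) : p.Ready e w t R s' where
  bdd := hB
  n := (hs _ (by omega)).trans h.n
  k := (hs _ (by omega)).trans h.k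
  N := (hs _ (by omega)).trans h.N
  M := (hs _ (by omega)).trans h.M
  Am := (hs _ (by omega)).trans h.Am
  Bm := (hs _ (by omega)).trans h.Bm
  gap := (hs _ (by omega)).trans h.gap
  T := (hs _ (by omega)).trans h.T
  rd := (hs _ (by omega)).trans h.rd
  X i hi := (hs _ (by omega)).trans (h.X i hi)
  Y i hi := (hs _ (by omega)).trans (h.Y i hi)
  L i hi := (hs _ (by omega)).trans (h.L i hi)

theorem Ready.holds {w t : ℕ} {R : Finset ℕ} {s : State} (h : p.Ready e w t R s)
    (hθ : s.mem (-8) = p.θ t) : (p.data e t R).Holds s.mem where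
  n := h.n
  N := h.N
  M := h.M
  Am := h.Am
  Bm := h.Bm
  θ := hθ
  X := h.X
  Y := h.Y
  L := h.L

/-- The initial memory of the learner. -/
structure Input (p : Params) (e : Examples) (w : ℕ) (s : State) : Prop where
  bdd : Bdd w s.mem
  n : s.mem 0 = p.n
  d : s.mem 1 = p.d
  k : s.mem 2 = p.k
  ia : s.mem 3 = p.ia
  ie : s.mem 5 = p.ie
  ld : ∃ z : ℕ, s.mem 6 = z ∧ p.ld = Nat.size z
  X : ∀ i < p.n, s.mem (7 + 3 * (i : ℤ)) = e.X i
  Y : ∀ i < p.n, s.mem (8 + 3 * (i : ℤ)) = e.Y i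
  L : ∀ i < p.n, s.mem (9 + 3 * (i : ℤ)) = if e.pos i then 1 else 0

/-- The bound on the time of `setup`. -/
def sCost (w : ℕ) : ℕ := 2 * (w * (200 * (w + 1)) + 4 * (w + 1)) + 3000 * (w + 1)

theorem Room.consts {w : ℕ} (h : p.Room e w) : p.M < 2 ^ w ∧ p.Am < 2 ^ w ∧ p.Bm < 2 ^ w ∧
    (p.N : ℤ) < 2 ^ w ∧ (p.T : ℤ) < 2 ^ w ∧ 16 * p.k * p.ia < 2 ^ w ∧ (p.n : ℤ) < 2 ^ w := by
  obtain ⟨h1, h2, h3, h4⟩ := (h.fits 0 ∅).consts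
  have hA : p.Am < 2 ^ w := h1
  have hB : 4 * p.Bm < 2 ^ w := h2
  have hB1 : 1 ≤ p.Bm := h3
  have hM := p.M_pos
  have hM' : p.M ≤ p.Am := by unfold Am; nlinarith
  have hN : ((p.N + 1) * (p.N + 1)) ^ 1 < 2 ^ w := h4 1 p.n1
  have hN' : p.N < 2 ^ w := by nlinarith
  have hia := p.ia1
  have hJ := p.J_pos
  have hpar := h.par
  have hT : p.T < 2 ^ w := by nlinarith [p.T_pos]
  have hk : 16 * p.k * p.ia < 2 ^ w := by
    refine lt_of_le_of_lt ?_ hpar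
    gcongr
    unfold T; nlinarith
  have hn1 : (1:ℤ) ≤ p.n := by exact_mod_cast p.n1
  have := h.nn
  exact ⟨by linarith, hA, by linarith, by exact_mod_cast hN', by exact_mod_cast hT, hk, by nlinarith⟩

theorem setup_spec {F w : ℕ} (hr : p.Room e w) {s : State} (hI : p.Input e w s) :
    Tri F setup s (sCost w) (p.Ready e w 0 (Finset.range p.n)) := by
  obtain ⟨z, hz, hld⟩ := hI.ld
  have hzw : z < 2 ^ w := by
    have := hI.bdd 6
    rw [hz, abs_of_nonneg (by positivity)] at this
    exact_mod_cast this
  have hiaw : p.ia < 2 ^ w := by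
    have := hI.bdd 3
    rw [hI.ia, abs_of_nonneg (by positivity)] at this
    exact_mod_cast this
  obtain ⟨cM, cA, cB, cN, cT, -, cn⟩ := hr.consts
  have hM0 := p.M_pos
  have hA0 := p.Am_pos
  have hB0 : 0 ≤ p.Bm := by unfold Bm; positivity
  have hP : (128 : ℤ) ≤ 2 ^ w := by
    calc (128:ℤ) = 2 ^ 7 := by norm_num
      _ ≤ 2 ^ w := pow_le_pow_right₀ (by norm_num) hr.w7
  refine (Tri.seq (c₁ := 100 * (w + 1)) (Tri.block (Q := fun s' => Same (-10) s.mem s'.mem ∧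
    s'.mem (-10) = z ∧ s'.mem (-11) = 0) hr.w7 (by rfl) (by decide) hI.bdd ?_) fun s₁ h₁ =>
    Tri.seq (sizeLoop_spec hr.w7 h₁.2 h₁.1.2.1 h₁.1.2.2 hzw) fun s₂ h₂ =>
    Tri.seq (c₁ := 500 * (w + 1)) (Tri.block (Q := fun s' => Same (-1) s.mem s'.mem ∧
      s'.mem (-1) = p.N ∧ s'.mem (-10) = p.ia ∧ s'.mem (-11) = 0)
      hr.w7 (by rfl) (by decide) h₂.1 ?_) fun s₃ h₃ =>
    Tri.seq (sizeLoop_spec hr.w7 h₃.2 h₃.1.2.2.1 h₃.1.2.2.2 hiaw) fun s₄ h₄ =>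
    (Tri.block (C := 2000) (Q := fun s' => Same (-1) s.mem s'.mem ∧ s'.mem (-1) = p.N ∧
      s'.mem (-2) = p.M ∧ s'.mem (-3) = p.Am ∧ s'.mem (-4) = p.Bm ∧ s'.mem (-5) = p.gap ∧
      s'.mem (-6) = p.T ∧ s'.mem (-7) = 0) hr.w7 (by rfl) (by decide) h₄.1 ?_).mono le_rfl
    fun s₅ h₅ => ?_).mono ?_ fun _ => id
  · have h6 := hI.bdd 6
    rw [hz] at h6
    simp only [asg, Prog.wp, val_lit, val_reg, write_mem, hz, Int.reduceNeg, Int.reduceEq, ↓reduceIte]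
    refine ⟨h6, by rw [abs_zero]; positivity, fun j hj => ?_, trivial, trivial⟩
    simp only [write_mem]
    rw [if_neg (by omega), if_neg (by omega)]
  · have hS : Same (-10) s.mem s₂.mem := h₁.1.1.trans h₂.2.1
    have e5 : s₂.mem 5 = p.ie := (hS _ (by norm_num)).trans hI.ie
    have e3 : s₂.mem 3 = p.ia := (hS _ (by norm_num)).trans hI.ia
    have e11 : s₂.mem (-11) = p.ld := by rw [h₂.2.2, hld]
    have eN : 2 * (p.ie : ℤ) * (p.ld + 4) = p.N := by unfold N; push_cast; ring
    have h3 : |(p.ia : ℤ)| < 2 ^ w := by rw [abs_of_nonneg (by positivity)]; exact_mod_cast hiaw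
    simp only [asg, Prog.wp, val_lit, val_reg, val_mul, val_add, write_mem, e5, e3, e11, eN,
      Int.reduceNeg, Int.reduceEq, ↓reduceIte]
    refine ⟨by rwa [abs_of_nonneg (by positivity)], h3, by rw [abs_zero]; positivity, fun j hj => ?_,
      trivial, trivial, trivial⟩
    simp only [write_mem]
    rw [if_neg (by omega), if_neg (by omega), if_neg (by omega)]
    exact hS j (by omega)
  · have hS : Same (-1) s.mem s₄.mem := h₃.1.1.trans (h₄.2.1.mono (by norm_num))
    have e0 := (hS 0 (by norm_num)).trans hI.n
    have e1 := (hS 1 (by norm_num)).trans hI.d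
    have e2 := (hS 2 (by norm_num)).trans hI.k
    have e3 := (hS 3 (by norm_num)).trans hI.ia
    have eN : s₄.mem (-1) = p.N := (h₄.2.1 _ (by norm_num)).trans h₃.1.2.1
    have e11 := h₄.2.2
    have eT : 2 * (p.k : ℤ) * (Nat.size p.ia + 3) = p.T := by unfold T J; push_cast; ring
    have eg : (p.n : ℤ) / (32 * p.T * p.ia) = p.gap := by unfold gap; push_cast; rfl
    have eM : 2 * (p.d : ℤ) * p.d = p.M := rfl
    have eA : ((p.d : ℤ) + 1) * p.M = p.Am := rfl
    have eB : ((p.d : ℤ) + 2) * p.Am = p.Bm := rfl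
    have cg : (p.gap : ℤ) ≤ p.n := by exact_mod_cast Nat.div_le_self _ _
    simp only [asg, Prog.wp, val_lit, val_reg, val_mul, val_add, val_div, write_mem, e0, e1, e2, e3,
      eN, e11, eT, eg, eM, eA, eB, Int.reduceNeg, Int.reduceEq, ↓reduceIte]
    refine ⟨by rwa [abs_of_nonneg (by positivity)],
      by rw [abs_of_nonneg (by positivity)]; linarith, by rwa [abs_of_pos hM0],
      by rwa [abs_of_pos hA0], by rwa [abs_of_nonneg hB0], by rw [abs_zero]; positivity,
      fun j hj => ?_, trivial, trivial, trivial, trivial, trivial, trivial, trivial⟩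
    simp only [write_mem]
    rw [if_neg (by omega), if_neg (by omega), if_neg (by omega), if_neg (by omega),
      if_neg (by omega), if_neg (by omega)]
    exact hS j (by omega)
  · obtain ⟨⟨hS, f1, f2, f3, f4, f5, f6, f7⟩, hB⟩ := h₅
    refine ⟨hB, (hS _ (by norm_num)).trans hI.n, (hS _ (by norm_num)).trans hI.k, f1, f2, f3, f4, f5,
      f6, by simpa using f7, fun i hi => (hS _ (by omega)).trans (hI.X i hi),
      fun i hi => (hS _ (by omega)).trans (hI.Y i hi), fun i hi => ?_⟩
    rw [hS _ (by omega), hI.L i hi]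
    simp only [data, Finset.mem_range, hi, ↓reduceIte]
    split_ifs <;> rfl
  · unfold sCost; nlinarith

theorem phaseLoop_spec {F w t : ℕ} (hr : p.Room e w) (ht : t < p.T) {s : State}
    (hB : Bdd w s.mem) (hk : s.mem 2 = p.k) (h10 : s.mem (-10) = 2 * p.k) (h11 : s.mem (-11) = t) :
    Tri F phaseLoop s (t * (500 * (w + 1)) + 100 * (w + 1)) (fun s' => Bdd w s'.mem ∧
      Same (-10) s.mem s'.mem ∧ s'.mem (-10) = (2 * p.k * 2 ^ (t / (2 * p.k)) : ℕ)) := by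
  have hk1 := p.k1
  obtain ⟨-, -, -, -, cT, ck, -⟩ := hr.consts
  have h2t := two_pow_div_le ht
  set q := t / (2 * p.k) with hq
  have hqt : q ≤ t := Nat.div_le_self _ _
  have hdm : 2 * p.k * q ≤ t := Nat.mul_div_le _ _
  have hdl : t < 2 * p.k * (q + 1) := by
    have := Nat.lt_mul_div_succ t (show 0 < 2 * p.k by omega)
    exact this
  refine (Tri.loop (g := 100 * (w + 1)) (c := 400 * (w + 1)) (fun v s' => Bdd w s'.mem ∧
    Same (-10) s.mem s'.mem ∧ v ≤ q ∧
    s'.mem (-10) = (2 * p.k * 2 ^ (q - v) : ℕ) ∧ s'.mem (-11) = t - 2 * p.k * (q - v : ℕ))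
    ?_ ?_ ?_ (v := q) ⟨hB, Same.refl _ _, le_rfl, by rw [h10]; simp, by rw [h11]; simp⟩).mono ?_
    fun _ => id
  · intro v s' h
    exact (Expr.cost_le hr.w7 h.1 _ rfl).trans (Nat.mul_le_mul_right _ (by decide))
  · rintro v s' ⟨hB', hS, hv, h1, h2⟩ hg
    have e2 := (hS 2 (by norm_num)).trans hk
    simp only [val_reg, val_sub, val_add, val_mul, val_lit, h2, e2] at hg
    have hv0 : 0 < v := by
      by_contra hcon
      obtain rfl : v = 0 := by omega
      have : (t : ℤ) < 2 * p.k * (q + 1) := by exact_mod_cast hdl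
      rw [Nat.sub_zero] at hg
      linarith
    have hqv : q - (v - 1) = q - v + 1 := by omega
    refine ⟨hv0, (Tri.block (C := 400) (Q := fun s' => Same (-10) s.mem s'.mem ∧
      s'.mem (-10) = (2 * p.k * 2 ^ (q - (v - 1)) : ℕ) ∧
      s'.mem (-11) = t - 2 * p.k * (q - (v - 1) : ℕ)) hr.w7 (by rfl) (by decide) hB' ?_).mono le_rfl
      fun s₁ h₁ => ⟨h₁.2, h₁.1.1, by omega, h₁.1.2.1, h₁.1.2.2⟩⟩
    simp only [asg, Prog.wp, val_lit, val_reg, val_mul, val_sub, write_mem, h1, h2, e2, Int.reduceNeg,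
      Int.reduceEq, ↓reduceIte]
    have b1 : (2 * p.k * 2 ^ (q - v) : ℕ) * 2 < 2 ^ w := by
      have : 2 ^ (q - v + 1) ≤ 2 ^ q := Nat.pow_le_pow_right (by norm_num) (by omega)
      rw [pow_succ] at this
      calc _ = 2 * p.k * (2 ^ (q - v) * 2) := by ring
        _ ≤ 2 * p.k * (8 * p.ia) := Nat.mul_le_mul_left _ (this.trans h2t)
        _ = 16 * p.k * p.ia := by ring
        _ < _ := ck
    have b1' : (((2 * p.k * 2 ^ (q - v) : ℕ)) : ℤ) * 2 < 2 ^ w := by exact_mod_cast b1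
    have b2 : 2 * (p.k : ℤ) * ((q - v : ℕ) : ℤ) + 2 * p.k ≤ t := by
      have : 2 * p.k * (q - v) + 2 * p.k ≤ t := by
        calc 2 * p.k * (q - v) + 2 * p.k = 2 * p.k * (q - v + 1) := by ring
          _ ≤ 2 * p.k * q := by gcongr; omega
          _ ≤ t := hdm
      exact_mod_cast this
    have b3 : (t : ℤ) < 2 ^ w := by
      have : (t : ℤ) < p.T := by exact_mod_cast ht
      linarith
    have b4 : 0 ≤ 2 * (p.k : ℤ) * ((q - v : ℕ) : ℤ) := by positivity
    refine ⟨by rw [abs_of_nonneg (by positivity)]; linarith,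
      by rw [abs_lt]; constructor <;> linarith, fun j hj => ?_, ?_, ?_⟩
    · simp only [write_mem]
      rw [if_neg (by omega), if_neg (by omega)]
      exact hS j hj
    · rw [hqv, pow_succ]; push_cast; ring
    · rw [hqv]; push_cast; ring
  · rintro v s' ⟨hB', hS, hv, h1, h2⟩ hg
    have e2 := (hS 2 (by norm_num)).trans hk
    simp only [val_reg, val_sub, val_add, val_mul, val_lit, h2, e2] at hg
    have hv0 : v = 0 := by
      by_contra hcon
      have h3 : 2 * p.k * (q - v) + 2 * p.k ≤ t := by
        calc 2 * p.k * (q - v) + 2 * p.k = 2 * p.k * (q - v + 1) := by ring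
          _ ≤ 2 * p.k * q := by gcongr; omega
          _ ≤ t := hdm
      have h4 : 2 * (p.k : ℤ) * ((q - v : ℕ) : ℤ) + 2 * p.k ≤ t := by exact_mod_cast h3
      linarith
    subst hv0
    exact ⟨hB', hS, by simpa using h1⟩
  · calc _ = q * (500 * (w + 1)) + 100 * (w + 1) := by ring
      _ ≤ _ := by gcongr

end Params

namespace Params
open RAM RAM.Expr RAM.Data
variable {p : Params} {e : Examples}

/-- The product of the first `i` factors of the weight of choosing no candidate. -/
def skipW (N a i : ℕ) : ℕ := (N * (N + 1)) ^ (i - min i a) * ((N + 1) * (N + 1)) ^ min i a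

theorem skipW_succ (N a i : ℕ) : skipW N a (i + 1) =
    skipW N a i * (if i < a then (N + 1) * (N + 1) else N * (N + 1)) := by
  unfold skipW
  split_ifs with h
  · rw [show min (i + 1) a = i + 1 by omega, show min i a = i by omega, Nat.sub_self, Nat.sub_self,
      pow_succ]; ring
  · rw [show min (i + 1) a = a by omega, show min i a = a by omega,
      show i + 1 - a = i - a + 1 by omega, pow_succ]; ring

theorem skipW_le (N a i : ℕ) : skipW N a i ≤ ((N + 1) * (N + 1)) ^ i := by
  unfold skipW
  calc _ ≤ ((N + 1) * (N + 1)) ^ (i - min i a) * ((N + 1) * (N + 1)) ^ min i a := by gcongr; omega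
    _ = _ := by rw [← pow_add]; congr 1; omega

theorem V_eq_skipW (t : ℕ) : (p.learner e).V t = skipW p.N (p.θ t - p.gap) p.n := by
  have : p.θ t ≤ p.n := Nat.div_le_self _ _
  unfold skipW
  rw [min_eq_right (by omega)]
  rfl

theorem skipLoop_spec {F w t : ℕ} (hr : p.Room e w) {R : Finset ℕ} {s : State}
    (hs : p.Ready e w t R s) (h8 : s.mem (-8) = p.θ t) (h9 : s.mem (-9) = 2) (h10 : s.mem (-10) = 0) :
    Tri F skipLoop s (p.n * (1000 * (w + 1)) + 100 * (w + 1)) (fun s' => Bdd w s'.mem ∧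
      Same (-9) s.mem s'.mem ∧ s'.mem (-9) = 2 * (p.learner e).V t) := by
  obtain ⟨-, cA, cB, cN, cT, -, cn⟩ := hr.consts
  have hA := p.Am_pos
  have hB : 0 < p.Bm := by have := p.Am_pos; unfold Bm; positivity
  set a := p.θ t - p.gap with ha
  have hW : ∀ i ≤ p.n, (2 * skipW p.N a i : ℤ) < 2 ^ w := by
    intro i hi
    have h1 : skipW p.N a i ≤ ((p.N + 1) * (p.N + 1)) ^ p.n :=
      (skipW_le _ _ _).trans (Nat.pow_le_pow_right (by positivity) hi)
    have h2 : (skipW p.N a i : ℤ) ≤ ((p.N + 1) * (p.N + 1)) ^ p.n := by exact_mod_cast h1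
    have h3 : (64 * 1 * 1) * (((p.N : ℤ) + 1) * (p.N + 1)) ^ p.n ≤
        64 * p.Am * p.Bm * (((p.N : ℤ) + 1) * (p.N + 1)) ^ p.n := by
      gcongr <;> omega
    have h4 := hr.big
    have h5 : (0:ℤ) ≤ (((p.N : ℤ) + 1) * (p.N + 1)) ^ p.n := by positivity
    linarith
  refine (Tri.loop (g := 100 * (w + 1)) (c := 900 * (w + 1)) (fun v s' => Bdd w s'.mem ∧
    v ≤ p.n ∧ Same (-9) s.mem s'.mem ∧ s'.mem (-10) = (p.n - v : ℕ) ∧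
    s'.mem (-9) = 2 * skipW p.N a (p.n - v)) ?_ ?_ ?_ (v := p.n)
    ⟨hs.bdd, le_rfl, Same.refl _ _, by rw [h10]; simp, by rw [h9]; simp [skipW]⟩).mono
    (by apply le_of_eq; ring) fun _ => id
  · intro v s' h
    exact (Expr.cost_le hr.w7 h.1 _ rfl).trans (Nat.mul_le_mul_right _ (by decide))
  · rintro v s' ⟨hB', hv, hS, h1, h2⟩ hg
    have e0 := (hS 0 (by norm_num)).trans hs.n
    have e1 := (hS (-1) (by norm_num)).trans hs.N
    have e5 := (hS (-5) (by norm_num)).trans hs.gap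
    have e8 := (hS (-8) (by norm_num)).trans h8
    simp only [val_reg, val_sub, h1, e0] at hg
    have hv0 : 0 < v := by omega
    set i := p.n - v with hi
    have hi1 : p.n - (v - 1) = i + 1 := by omega
    have hW1 := hW (i + 1) (by omega)
    have hsk := skipW_succ p.N a i
    refine ⟨hv0, (Tri.block (C := 900) (Q := fun s' => Same (-9) s.mem s'.mem ∧
      s'.mem (-10) = (i + 1 : ℕ) ∧ s'.mem (-9) = 2 * skipW p.N a (i + 1))
      hr.w7 (by rfl) (by decide) hB' ?_).mono le_rfl
      fun s₁ h₁ => ⟨h₁.2, by omega, h₁.1.1, by rw [hi1]; exact h₁.1.2.1, by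
        rw [hi1]; exact h₁.1.2.2⟩⟩
    have b1 : |(i : ℤ) + 1| < 2 ^ w := by
      rw [abs_of_nonneg (by positivity)]
      have : (i : ℤ) + 1 ≤ p.n := by omega
      linarith
    have hsame : ∀ z z' : ℤ, Same (-9) s.mem ((s'.write (-9) z).write (-10) z').mem := by
      intro z z' j hj
      simp only [write_mem]
      rw [if_neg (by omega), if_neg (by omega)]
      exact hS j hj
    simp only [asg, Prog.wp, val_lit, val_reg, val_mul, val_sub, val_add, write_mem, h1, h2, e1, e5,
      e8, Int.reduceNeg, Int.reduceEq, ↓reduceIte]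
    refine ⟨fun h => ?_, fun h => ?_⟩
    · rw [if_pos (by omega)] at hsk
      have e : (2:ℤ) * skipW p.N a i * ((p.N + 1) * (p.N + 1)) = 2 * skipW p.N a (i + 1) := by
        rw [hsk]; push_cast; ring
      rw [e]
      exact ⟨by rwa [abs_of_nonneg (by positivity)], b1, hsame _ _, by push_cast; rfl, rfl⟩
    · rw [if_neg (by omega)] at hsk
      have e : (2:ℤ) * skipW p.N a i * (p.N * (p.N + 1)) = 2 * skipW p.N a (i + 1) := by
        rw [hsk]; push_cast; ring
      rw [e]
      exact ⟨by rwa [abs_of_nonneg (by positivity)], b1, hsame _ _, by push_cast; rfl, rfl⟩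
  · rintro v s' ⟨hB', hv, hS, h1, h2⟩ hg
    have e0 := (hS 0 (by norm_num)).trans hs.n
    simp only [val_reg, val_sub, h1, e0] at hg
    obtain rfl : v = 0 := by omega
    refine ⟨hB', hS, ?_⟩
    rw [h2, V_eq_skipW, Nat.sub_zero]

theorem total_eq_sum (t : ℕ) (R : Finset ℕ) :
    (p.data e t R).total = ∑ h ∈ (p.learner e).Hs, (p.learner e).W t R h := rfl

/-- The positions and the total weights fit into a word. -/
theorem Room.total_lt {w : ℕ} (hr : p.Room e w) (t : ℕ) (R : Finset ℕ) :
    2 * ((p.learner e).V t : ℤ) + 6 * (p.data e t R).total + 1 < 2 ^ w := by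
  have hA := p.Am_pos
  have hB : 0 < p.Bm := by unfold Bm; positivity
  set W := ((p.N + 1) * (p.N + 1)) ^ p.n with hW
  have hW1 : 1 ≤ W := Nat.one_le_pow _ _ (by positivity)
  have h1 : (p.data e t R).total ≤ p.cands.card * W := by
    exact (Finset.sum_le_card_nsmul _ _ W fun h _ => weightRec_le _ _ _ _).trans_eq
      (smul_eq_mul _ _)
  have h2 : (p.learner e).V t ≤ W := by rw [V_eq_skipW]; exact skipW_le _ _ _
  have h3 : ((p.data e t R).total : ℤ) ≤ 8 * p.Am * p.Bm * W := by
    rw [← card_cands]; exact_mod_cast h1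
  have h4 : (((p.learner e).V t : ℕ) : ℤ) ≤ W := by exact_mod_cast h2
  have h5 : 64 * p.Am * p.Bm * W < 2 ^ w := by rw [hW]; push_cast; exact hr.big
  have h6 : 1 * 1 * (W : ℤ) ≤ p.Am * p.Bm * W := by gcongr <;> omega
  have h7 : (1:ℤ) ≤ W := by exact_mod_cast hW1
  linarith

/-- The bound on the time of `prepare`. -/
def pCost (n T w : ℕ) : ℕ := T * (500 * (w + 1)) + n * (1000 * (w + 1)) + 1000 * (w + 1) + wCost n w

/-- What a walk through the candidates in round `t` finds: `dec` are the candidates at the positions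
below twice the total weight. -/
structure Walks (p : Params) (e : Examples) (F w t : ℕ) (R : Finset ℕ) (dec : ℕ → ℤ × ℤ × ℤ) :
    Prop where
  sum : ∀ φ : ℤ × ℤ × ℤ → ENNReal, ∑ u ∈ Finset.range (2 * (p.data e t R).total), φ (dec u) =
    2 * ∑ h ∈ (p.learner e).Hs, (p.learner e).W t R h * φ h
  walk : ∀ (s : State) (u : ℤ), (p.data e t R).Holds s.mem → s.mem (-20) = u → Bdd w s.mem →
    |u| + 4 * (p.data e t R).total < 2 ^ w →
    Tri F RAM.walk s (wCost p.n w) (fun s' => (Same (-19) s.mem s'.mem ∧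
      Passes w (2 * (p.data e t R).total) dec u s s') ∧ s'.out = s.out)

theorem exists_walks (F : ℕ) {w : ℕ} (hr : p.Room e w) (t : ℕ) (R : Finset ℕ) :
    ∃ dec, p.Walks e F w t R dec := by
  obtain ⟨dec, h1, h2⟩ := walk_spec (F := F) (hr.fits t R) p.M_pos
  exact ⟨dec, h1, fun s u h3 h4 h5 h6 => (h2 s u h3 h4 h5 h6).silent (by rfl)⟩

theorem prepare_spec {F w t : ℕ} (hr : p.Room e w) (ht : t < p.T) {R : Finset ℕ} {s : State}
    (hs : p.Ready e w t R s) :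
    Tri F prepare s (pCost p.n p.T w) (fun s' => (p.Ready e w t R s' ∧ s'.mem (-8) = p.θ t ∧
      s'.mem (-9) = 2 * (p.learner e).V t ∧ s'.mem (-20) = -1 - 2 * (p.data e t R).total) ∧
      s'.out = s.out) := by
  obtain ⟨dec, hdec⟩ := exists_walks F hr t R
  obtain ⟨-, -, -, -, cT, ck, cn⟩ := hr.consts
  have hP : (128 : ℤ) ≤ 2 ^ w := by
    calc (128:ℤ) = 2 ^ 7 := by norm_num
      _ ≤ 2 ^ w := pow_le_pow_right₀ (by norm_num) hr.w7
  have htT : (t : ℤ) < p.T := by exact_mod_cast ht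
  refine Tri.silent ((Tri.seq (c₁ := 100 * (w + 1)) (Tri.block (Q := fun s' =>
      Same (-10) s.mem s'.mem ∧ s'.mem (-10) = 2 * p.k ∧ s'.mem (-11) = t)
      hr.w7 (by rfl) (by decide) hs.bdd ?_) fun s₁ h₁ =>
    Tri.seq (phaseLoop_spec hr ht h₁.2 ((h₁.1.1 _ (by norm_num)).trans hs.k) h₁.1.2.1 h₁.1.2.2)
      fun s₂ h₂ =>
    Tri.seq (c₁ := 100 * (w + 1)) (Tri.block (Q := fun s' =>
      Same (-8) s.mem s'.mem ∧ s'.mem (-8) = p.θ t ∧ s'.mem (-9) = 2 ∧ s'.mem (-10) = 0)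
      hr.w7 (by rfl) (by decide) h₂.1 ?_) fun s₃ h₃ =>
    Tri.seq (skipLoop_spec hr (hs.same h₃.1.1 (by norm_num) h₃.2) h₃.1.2.1 h₃.1.2.2.1 h₃.1.2.2.2)
      fun s₄ h₄ =>
    Tri.seq (c₁ := 100 * (w + 1)) (Tri.block (Q := fun s' =>
      Same (-20) s₄.mem s'.mem ∧ s'.mem (-20) = -1)
      hr.w7 (by rfl) (by decide) h₄.1 ?_) fun s₅ h₅ =>
    ((hdec.walk s₅ (-1) ?_ h₅.1.2 h₅.2 ?_).mono le_rfl fun s₆ h₆ => ?_)).mono ?_ fun _ => id)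
    (by rfl)
  · simp only [asg, Prog.wp, val_lit, val_reg, val_mul, write_mem, hs.k, hs.rd, Int.reduceNeg,
      Int.reduceEq, ↓reduceIte]
    have hk2 : 2 * (p.k : ℤ) < 2 ^ w := by
      have : 2 * p.k ≤ 16 * p.k * p.ia := by nlinarith [p.ia1]
      exact_mod_cast this.trans_lt ck
    refine ⟨by rwa [abs_of_nonneg (by positivity)], by rw [abs_of_nonneg (by positivity)]; linarith,
      fun j hj => ?_, trivial, trivial⟩
    simp only [write_mem]
    rw [if_neg (by omega), if_neg (by omega)]
  · have hS := h₁.1.1.trans h₂.2.1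
    have e0 := (hS 0 (by norm_num)).trans hs.n
    have eθ : (p.n : ℤ) / ((2 * p.k * 2 ^ (t / (2 * p.k)) : ℕ) : ℤ) = p.θ t := by
      unfold θ; push_cast; rfl
    have hθ : (p.θ t : ℤ) ≤ p.n := by exact_mod_cast Nat.div_le_self _ _
    simp only [asg, Prog.wp, val_lit, val_reg, val_div, write_mem, e0, h₂.2.2, eθ, Int.reduceNeg,
      Int.reduceEq, ↓reduceIte]
    refine ⟨by rw [abs_of_nonneg (by positivity)]; linarith, by norm_num; linarith, by
      rw [abs_zero]; positivity, fun j hj => ?_, trivial, trivial, trivial⟩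
    simp only [write_mem]
    rw [if_neg (by omega), if_neg (by omega), if_neg (by omega)]
    exact hS j (by omega)
  · simp only [asg, Prog.wp, val_lit, write_mem, Int.reduceNeg, Int.reduceEq, ↓reduceIte]
    refine ⟨by norm_num; linarith, by rw [abs_zero]; positivity, fun j hj => ?_, trivial⟩
    simp only [write_mem]
    rw [if_neg (by omega), if_neg (by omega)]
  · have hS : Same (-8) s₃.mem s₅.mem := (h₄.2.1.mono (by norm_num)).trans (h₅.1.1.mono (by norm_num))
    refine (hs.same (h₃.1.1.trans hS) (by norm_num) h₅.2).holds ?_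
    rw [h₅.1.1 _ (by norm_num), h₄.2.1 _ (by norm_num), h₃.1.2.1]
  · have := hr.total_lt t R
    rw [abs_neg, abs_one]
    have h0 : (0:ℤ) ≤ (p.learner e).V t := by positivity
    have h1 : (0:ℤ) ≤ (p.data e t R).total := by positivity
    linarith
  · obtain ⟨⟨g1, g2⟩, -⟩ := h₆
    have hS : Same (-8) s₃.mem s₆.mem := ((h₄.2.1.mono (by norm_num)).trans
      (h₅.1.1.mono (by norm_num))).trans (g1.mono (by norm_num))
    refine ⟨hs.same (h₃.1.1.trans hS) (by norm_num) g2.bdd, ?_, ?_, ?_⟩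
    · rw [g1 _ (by norm_num), h₅.1.1 _ (by norm_num), h₄.2.1 _ (by norm_num), h₃.1.2.1]
    · rw [g1 _ (by norm_num), h₅.1.1 _ (by norm_num), h₄.2.2]
    · rw [g2.pos]; push_cast; ring
  · have : t * (500 * (w + 1)) ≤ p.T * (500 * (w + 1)) := by gcongr
    unfold pCost
    omega

theorem markLoop_spec {F w t : ℕ} (hr : p.Room e w) {R : Finset ℕ} {s : State}
    (hs : p.Ready e w t R s) (h10 : s.mem (-10) = 0) {h : ℤ × ℤ × ℤ} (h22 : s.mem (-22) = h.1)
    (h24 : s.mem (-24) = h.2.1) (h23 : s.mem (-23) = h.2.2) :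
    Tri F markLoop s (p.n * (2000 * (w + 1)) + 100 * (w + 1)) (fun s' =>
      p.Ready e w t ((p.learner e).next R (some h)) s') := by
  obtain ⟨-, cA, cB, cN, cT, -, cn⟩ := hr.consts
  have hP : (128 : ℤ) ≤ 2 ^ w := by
    calc (128:ℤ) = 2 ^ 7 := by norm_num
      _ ≤ 2 ^ w := pow_le_pow_right₀ (by norm_num) hr.w7
  have hL : ∀ i, ((p.data e t ((p.learner e).next R (some h))).L i : ℤ) =
      if h.2.2 * e.Y i - h.1 * e.X i < h.2.1 then 2 else ((p.data e t R).L i : ℤ) := by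
    intro i
    simp only [data, Greedy.next, learner]
    by_cases h1 : i ∈ R <;> by_cases h2 : h.2.2 * e.Y i - h.1 * e.X i < h.2.1 <;> simp [h1, h2]
  refine (Tri.loop (g := 100 * (w + 1)) (c := 1900 * (w + 1)) (fun v s' => Bdd w s'.mem ∧
    v ≤ p.n ∧ s'.mem (-10) = (p.n - v : ℕ) ∧
    (∀ z, z ≠ -10 → (∀ i < p.n, z ≠ 9 + 3 * (i : ℤ)) → s'.mem z = s.mem z) ∧
    ∀ i < p.n, s'.mem (9 + 3 * (i : ℤ)) = if i < p.n - v then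
      ((p.data e t ((p.learner e).next R (some h))).L i : ℤ) else ((p.data e t R).L i : ℤ))
    ?_ ?_ ?_ (v := p.n)
    ⟨hs.bdd, le_rfl, by rw [h10]; simp, fun _ _ _ => rfl, fun i hi => by
      rw [hs.L i hi, if_neg (by omega)]⟩).mono (by apply le_of_eq; ring) fun _ => id
  · intro v s' h
    exact (Expr.cost_le hr.w7 h.1 _ rfl).trans (Nat.mul_le_mul_right _ (by decide))
  · rintro v s' ⟨hB', hv, h1, h2, h3⟩ hg
    have e0 : s'.mem 0 = p.n := (h2 0 (by norm_num) fun i _ => by omega).trans hs.n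
    have e22 : s'.mem (-22) = h.1 := (h2 _ (by norm_num) fun i _ => by omega).trans h22
    have e23 : s'.mem (-23) = h.2.2 := (h2 _ (by norm_num) fun i _ => by omega).trans h23
    have e24 : s'.mem (-24) = h.2.1 := (h2 _ (by norm_num) fun i _ => by omega).trans h24
    simp only [val_reg, val_sub, h1, e0] at hg
    have hv0 : 0 < v := by omega
    set i := p.n - v with hi
    have hin : i < p.n := by omega
    have eX : s'.mem (7 + 3 * (i : ℤ)) = e.X i :=
      (h2 _ (by omega) fun j _ => by omega).trans (hs.X i hin)
    have eY : s'.mem (8 + 3 * (i : ℤ)) = e.Y i :=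
      (h2 _ (by omega) fun j _ => by omega).trans (hs.Y i hin)
    have hi1 : p.n - (v - 1) = i + 1 := by omega
    have b1 : |(i : ℤ) + 1| < 2 ^ w := by
      rw [abs_of_nonneg (by positivity)]
      have : (i : ℤ) + 1 ≤ p.n := by omega
      linarith
    refine ⟨hv0, (Tri.block (C := 1900) (Q := fun s' =>
      s'.mem (-10) = (i + 1 : ℕ) ∧
      (∀ z, z ≠ -10 → (∀ i < p.n, z ≠ 9 + 3 * (i : ℤ)) → s'.mem z = s.mem z) ∧
      ∀ j < p.n, s'.mem (9 + 3 * (j : ℤ)) = if j < i + 1 then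
        ((p.data e t ((p.learner e).next R (some h))).L j : ℤ) else ((p.data e t R).L j : ℤ))
      hr.w7 (by rfl) (by decide) hB' ?_).mono le_rfl
      fun s₁ h₁ => ⟨h₁.2, by omega, by rw [hi1]; exact h₁.1.1, h₁.1.2.1, by
        rw [hi1]; exact h₁.1.2.2⟩⟩
    have n9 : (-10 : ℤ) ≠ 9 + 3 * (i : ℤ) := by omega
    simp only [asg, Prog.wp, val_lit, val_reg, val_get, val_mul, val_sub, val_add, write_mem, h1,
      e22, e23, e24, eX, eY, n9, Int.reduceNeg, ↓reduceIte]
    refine ⟨fun hc => ⟨by norm_num; linarith, b1, by push_cast; rfl, fun z hz hz' => ?_,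
      fun j hj => ?_⟩, fun hc => ⟨b1, by push_cast; rfl, fun z hz hz' => ?_, fun j hj => ?_⟩⟩
    · rw [if_neg hz, if_neg (hz' i hin)]; exact h2 z hz hz'
    · rw [if_neg (by omega)]
      by_cases hji : j = i
      · subst hji
        rw [if_pos rfl, if_pos (by omega), hL, if_pos (by linarith)]
      · rw [if_neg (by omega), h3 j hj]
        by_cases hlt : j < i
        · rw [if_pos hlt, if_pos (by omega)]
        · rw [if_neg hlt, if_neg (by omega)]
    · rw [if_neg hz]; exact h2 z hz hz'
    · rw [if_neg (by omega), h3 j hj]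
      by_cases hji : j = i
      · subst hji
        rw [if_neg (by omega), if_pos (by omega), hL, if_neg (by linarith)]
      · by_cases hlt : j < i
        · rw [if_pos hlt, if_pos (by omega)]
        · rw [if_neg hlt, if_neg (by omega)]
  · rintro v s' ⟨hB', hv, h1, h2, h3⟩ hg
    have e0 : s'.mem 0 = p.n := (h2 0 (by norm_num) fun i _ => by omega).trans hs.n
    simp only [val_reg, val_sub, h1, e0] at hg
    obtain rfl : v = 0 := by omega
    have hk : ∀ z : ℤ, z ≠ -10 → z < 9 → s'.mem z = s.mem z := fun z hz hz' =>
      h2 z hz fun i _ => by omega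
    exact ⟨hB', e0, (hk _ (by norm_num) (by norm_num)).trans hs.k,
      (hk _ (by norm_num) (by norm_num)).trans hs.N, (hk _ (by norm_num) (by norm_num)).trans hs.M,
      (hk _ (by norm_num) (by norm_num)).trans hs.Am, (hk _ (by norm_num) (by norm_num)).trans hs.Bm,
      (hk _ (by norm_num) (by norm_num)).trans hs.gap, (hk _ (by norm_num) (by norm_num)).trans hs.T,
      (hk _ (by norm_num) (by norm_num)).trans hs.rd,
      fun i hi => (h2 _ (by omega) fun j _ => by omega).trans (hs.X i hi),
      fun i hi => (h2 _ (by omega) fun j _ => by omega).trans (hs.Y i hi),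
      fun i hi => by rw [h3 i hi, if_pos (by omega)]⟩

end Params
end PrivateLearning

namespace RAM

/-! ### The law of the output -/

/-- `μ` always halts within time `c`, and `ν` is the law of its output. -/
def Computes (μ : PMF Outcome) (c : ℕ) (ν : PMF (List ℤ)) : Prop :=
  (∀ o ∈ μ.support, ∃ s t, o = some (s, t) ∧ t ≤ c) ∧
    μ.map (fun o => o.elim [] fun r => r.1.out) = ν

theorem Computes.mono {μ : PMF Outcome} {c c' : ℕ} {ν : PMF (List ℤ)} (h : Computes μ c ν)
    (hc : c ≤ c') : Computes μ c' ν :=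
  ⟨fun o ho => by obtain ⟨s, t, h1, h2⟩ := h.1 o ho; exact ⟨s, t, h1, h2.trans hc⟩, h.2⟩

theorem Computes.pure {s : State} {t c : ℕ} (h : t ≤ c) :
    Computes (PMF.pure (some (s, t))) c (PMF.pure s.out) :=
  ⟨fun o ho => ⟨s, t, by simpa using ho, h⟩, by simp [PMF.pure_map]⟩

theorem Computes.delay {μ : PMF Outcome} {c : ℕ} {ν : PMF (List ℤ)} (h : Computes μ c ν) (t : ℕ) :
    Computes (μ.map (Outcome.delay t)) (t + c) ν := by
  refine ⟨fun o ho => ?_, ?_⟩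
  · obtain ⟨o', ho', rfl⟩ := (PMF.mem_support_map_iff _ _ _).1 ho
    obtain ⟨s, t', rfl, h2⟩ := h.1 o' ho'
    exact ⟨s, t + t', rfl, by omega⟩
  · rw [PMF.map_comp, ← h.2]
    congr 1
    funext o
    cases o <;> rfl

theorem Computes.bind {ι : Type*} {l : PMF ι} {f : ι → PMF Outcome} {c : ℕ} {ν : ι → PMF (List ℤ)}
    (h : ∀ i, Computes (f i) c (ν i)) : Computes (l.bind f) c (l.bind ν) := by
  refine ⟨fun o ho => ?_, ?_⟩
  · obtain ⟨i, -, hi⟩ := (PMF.mem_support_bind_iff _ _ _).1 ho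
    exact (h i).1 o hi
  · rw [PMF.map_bind]
    congr 1
    funext i
    exact (h i).2

theorem andThen_map {ι : Type*} (l : PMF ι) (S : ι → State) (τ : ι → ℕ) (g : State → PMF Outcome) :
    andThen (l.map fun i => some (S i, τ i)) g =
      l.bind fun i => (g (S i)).map (Outcome.delay (τ i)) := by
  rw [andThen, PMF.bind_map]
  rfl

theorem run_rand {F m : ℕ} {a e : Expr} {s : State} (h : (e.val s.mem).toNat = m) :
    (Prog.rand a e).run F s = (PMF.uniformOfFintype (Fin (m + 1))).map fun r : Fin (m + 1) =>
      some (s.write (a.val s.mem) (r : ℕ), a.cost s.mem + e.cost s.mem) := by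
  subst h
  rw [Prog.run]
  refine (PMF.map_bind _ _ _).trans ?_
  rw [← PMF.bind_pure_comp]
  congr 1
  funext r
  exact PMF.pure_map _ _

end RAM

namespace PrivateLearning

theorem encode_append (l l' : List (ℤ × ℤ × ℤ)) : encode (l ++ l') = encode l ++ encode l' :=
  List.flatMap_append

namespace Params
open RAM RAM.Expr RAM.Data
variable {p : Params} {e : Examples}

/-- The bound on the time of `choose`. -/
def cCost (n w : ℕ) : ℕ := wCost n w + n * (2000 * (w + 1)) + 1000 * (w + 1)

/-- The outcome of a round, for the position `r`. -/
noncomputable def pick (p : Params) (e : Examples) (t : ℕ) (R : Finset ℕ) (dec : ℕ → ℤ × ℤ × ℤ) (r : ℕ) :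
    Option (ℤ × ℤ × ℤ) := if r < 2 * (p.data e t R).total then some (dec r) else none

theorem choose_spec {F w t : ℕ} (hr : p.Room e w) (ht : t < p.T) {R : Finset ℕ}
    {dec : ℕ → ℤ × ℤ × ℤ} (hdec : p.Walks e F w t R dec) {s : State} (hs : p.Ready e w t R s)
    (h8 : s.mem (-8) = p.θ t) {r : ℕ} (h20 : s.mem (-20) = r)
    (hrlt : r < 2 * ((p.learner e).V t + (p.data e t R).total)) :
    Tri F choose s (cCost p.n w) (fun s' =>
      p.Ready e w (t + 1) ((p.learner e).next R (p.pick e t R dec r)) s' ∧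
      s'.out = s.out ++ encode (p.pick e t R dec r).toList) := by
  obtain ⟨-, -, -, -, cT, ck, cn⟩ := hr.consts
  have htot := hr.total_lt t R
  have hP : (128 : ℤ) ≤ 2 ^ w := by
    calc (128:ℤ) = 2 ^ 7 := by norm_num
      _ ≤ 2 ^ w := pow_le_pow_right₀ (by norm_num) hr.w7
  have htT : (t : ℤ) + 1 ≤ p.T := by exact_mod_cast ht
  set tot := (p.data e t R).total with htotd
  have h0t : (0:ℤ) ≤ tot := by positivity
  have hrlt' : (r : ℤ) < 2 * ((p.learner e).V t + tot) := by exact_mod_cast hrlt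
  set o := p.pick e t R dec r with ho
  refine (Tri.seq (c₁ := 100 * (w + 1)) (Tri.block (Q := fun s' =>
      (∀ j, j ≠ -21 → s'.mem j = s.mem j) ∧ s'.mem (-21) = 0 ∧ s'.out = s.out)
      hr.w7 (by rfl) (by decide) hs.bdd ?_) fun s₁ h₁ =>
    Tri.seq (hdec.walk s₁ r (hs.same (a := -21) (fun j hj => h₁.1.1 j (by omega)) (by norm_num)
      h₁.2 |>.holds ((h₁.1.1 _ (by norm_num)).trans h8)) ((h₁.1.1 _ (by norm_num)).trans h20) h₁.2
      (by rw [abs_of_nonneg (by positivity)]; linarith)) fun s₂ h₂ =>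
    Tri.seq (R := fun s₃ => p.Ready e w t ((p.learner e).next R o) s₃ ∧
      s₃.out = s.out ++ encode o.toList)
      (Tri.ite (g := 4 * (w + 1)) (c := 200 * (w + 1) + (p.n * (2000 * (w + 1)) + 100 * (w + 1)))
        ?_ (fun hpos => ?_) (fun hneg => ?_)) fun s₃ h₃ =>
    (Tri.block (C := 100) (Q := fun s' => p.Ready e w (t + 1) ((p.learner e).next R o) s' ∧
      s'.out = s.out ++ encode o.toList) hr.w7 (by rfl) (by decide) h₃.1.bdd ?_).mono le_rfl
      fun s' h' => h'.1).mono ?_ fun _ => id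
  · simp only [asg, Prog.wp, val_lit, write_mem, write_out, ↓reduceIte]
    exact ⟨by rw [abs_zero]; positivity, fun j hj => if_neg hj, trivial, trivial⟩
  · exact (Expr.cost_le hr.w7 h₂.1.2.bdd _ rfl).trans (Nat.mul_le_mul_right _ (by decide))
  · obtain ⟨⟨g1, g2⟩, g3⟩ := h₂
    have hrt : r < 2 * tot := by
      by_contra hcon
      have := g2.keep (Or.inr (by exact_mod_cast not_lt.1 hcon)) (-21) (by simp)
      rw [val_reg, this, h₁.1.2.1] at hpos
      exact lt_irrefl _ hpos
    have hsel := g2.sel r rfl hrt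
    have ho' : o = some (dec r) := if_pos hrt
    have hs₂ : p.Ready e w t R s₂ := hs.same (a := -19)
      (fun j hj => (g1 j hj).trans (h₁.1.1 j (by omega))) (by norm_num) g2.bdd
    rw [← g3.trans h₁.1.2.2]
    simp only [Prod.ext_iff] at hsel
    refine Tri.seq (Tri.block (C := 200) (Q := fun s' => (∀ j, j ≠ -10 → s'.mem j = s₂.mem j) ∧
      s'.mem (-10) = 0 ∧ s'.out = s₂.out ++ encode o.toList) hr.w7 (by rfl) (by decide) g2.bdd ?_)
      fun s₄ h₄ => ((markLoop_spec hr (hs₂.same (a := -10) (fun j hj => h₄.1.1 j (by omega))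
        (by norm_num) h₄.2) h₄.1.2.1 (h := dec r) ((h₄.1.1 _ (by norm_num)).trans hsel.1)
        ((h₄.1.1 _ (by norm_num)).trans hsel.2.1) ((h₄.1.1 _ (by norm_num)).trans hsel.2.2)).silent
        (by rfl)).mono le_rfl fun s₅ h₅ => ⟨by rw [ho']; exact h₅.1, h₅.2.trans h₄.1.2.2⟩
    simp only [asg, Prog.wp, val_lit, val_reg, write_mem, write_out, ↓reduceIte]
    refine ⟨by rw [abs_zero]; positivity, fun j hj => if_neg hj, trivial, ?_⟩
    rw [hsel.1, hsel.2.1, hsel.2.2, ho']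
    simp [encode]
  · obtain ⟨⟨g1, g2⟩, g3⟩ := h₂
    have hrt : ¬ r < 2 * tot := by
      intro hcon
      have := g2.flag (by positivity) (by exact_mod_cast hcon)
      rw [val_reg, this] at hneg
      exact hneg one_pos
    have ho' : o = none := if_neg hrt
    rw [ho']
    exact fun _ => ⟨s₂, 1, rfl, by omega, hs.same (a := -19)
      (fun j hj => (g1 j hj).trans (h₁.1.1 j (by omega))) (by norm_num) g2.bdd,
      by rw [g3, h₁.1.2.2]; simp [encode]⟩
  · obtain ⟨h3, h4⟩ := h₃
    have b1 : |(t : ℤ) + 1| < 2 ^ w := by rw [abs_of_nonneg (by positivity)]; linarith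
    simp only [asg, Prog.wp, val_lit, val_reg, val_add, h3.rd]
    have hk : ∀ j : ℤ, j ≠ -7 → (s₃.write (-7) ((t : ℤ) + 1)).mem j = s₃.mem j := fun j hj => by
      rw [write_mem, if_neg hj]
    exact ⟨b1, ⟨h3.bdd.write b1, (hk _ (by norm_num)).trans h3.n, (hk _ (by norm_num)).trans h3.k,
      (hk _ (by norm_num)).trans h3.N, (hk _ (by norm_num)).trans h3.M,
      (hk _ (by norm_num)).trans h3.Am, (hk _ (by norm_num)).trans h3.Bm,
      (hk _ (by norm_num)).trans h3.gap, (hk _ (by norm_num)).trans h3.T,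
      by rw [write_mem, if_pos rfl]; push_cast; rfl,
      fun i hi => (hk _ (by omega)).trans (h3.X i hi), fun i hi => (hk _ (by omega)).trans (h3.Y i hi),
      fun i hi => (hk _ (by omega)).trans (h3.L i hi)⟩, h4⟩
  · unfold cCost; omega

/-- A uniform position leads to the law of the exponential mechanism. -/
theorem map_pick_eq_sel {F w t m : ℕ} {R : Finset ℕ} {dec : ℕ → ℤ × ℤ × ℤ}
    (hdec : p.Walks e F w t R dec)
    (hm : m + 1 = 2 * (p.data e t R).total + 2 * (p.learner e).V t) :
    (PMF.uniformOfFintype (Fin (m + 1))).map (fun r : Fin (m + 1) => p.pick e t R dec r) =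
      (p.learner e).sel t R := by
  classical
  set tot := (p.data e t R).total with htot
  have hZ : m + 1 = 2 * (p.learner e).tot t R := by
    rw [Greedy.tot_eq, hm, mul_add, ← total_eq_sum, add_comm]
  have hcast : ((m + 1 : ℕ) : ENNReal) = 2 * (p.learner e).tot t R := by rw [hZ]; push_cast; rfl
  ext o
  rw [PMF.map_apply, tsum_fintype]
  simp only [PMF.uniformOfFintype_apply, Fintype.card_fin]
  rw [Fin.sum_univ_eq_sum_range (fun r => if o = p.pick e t R dec r then
    (((m + 1 : ℕ) : ENNReal))⁻¹ else 0) (m + 1), hcast, hm, Finset.sum_range_add]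
  have e1 : ∀ r ∈ Finset.range (2 * tot), p.pick e t R dec r = some (dec r) := fun r hr =>
    if_pos (Finset.mem_range.1 hr)
  have e2 : ∀ r, p.pick e t R dec (2 * tot + r) = none := fun r => if_neg (by omega)
  rw [Finset.sum_congr rfl fun r hr => by rw [e1 r hr]]
  simp only [e2]
  set c : ENNReal := (2 * (p.learner e).tot t R)⁻¹ with hc
  have hdiv : ∀ x : ENNReal, 2 * x * c = x / (p.learner e).tot t R := fun x => by
    rw [hc, ← div_eq_mul_inv, ENNReal.mul_div_mul_left _ _ (by norm_num) (by norm_num)]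
  cases o with
  | none =>
    rw [Greedy.sel_apply _ Finset.none_mem_insertNone, ← hdiv]
    simp [Greedy.wt]
  | some h =>
    have e3 := hdec.sum fun h' => if h = h' then c else 0
    simp only [Option.some.injEq, reduceCtorEq, ↓reduceIte, Finset.sum_const_zero, add_zero]
    rw [e3]
    by_cases hh : h ∈ (p.learner e).Hs
    · rw [Greedy.sel_apply _ (Finset.some_mem_insertNone.2 hh), ← hdiv,
        Finset.sum_eq_single h (fun b _ hb => by rw [if_neg (Ne.symm hb), mul_zero])
          (fun hcon => absurd hh hcon), if_pos rfl, mul_assoc]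
      rfl
    · rw [Greedy.sel_eq_zero _ (by simpa using hh), Finset.sum_eq_zero fun b hb => by
        rw [if_neg (fun hcon : h = b => hh (hcon ▸ hb)), mul_zero], mul_zero]

/-- The bound on the time of a round, with the test of the main loop. -/
def roundCost (n T w : ℕ) : ℕ := pCost n T w + cCost n w + 200 * (w + 1)

/-- A round is a uniform choice of a position, followed by a deterministic computation. -/
theorem round_run {F w t : ℕ} (hr : p.Room e w) (ht : t < p.T) {R : Finset ℕ} {s : State}
    (hs : p.Ready e w t R s) (hF : pCost p.n p.T w + cCost p.n w ≤ F) :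
    ∃ (m : ℕ) (o : Fin (m + 1) → Option (ℤ × ℤ × ℤ)) (S : Fin (m + 1) → State)
      (τ : Fin (m + 1) → ℕ),
      learnRound.run F s = (PMF.uniformOfFintype (Fin (m + 1))).map (fun r => some (S r, τ r)) ∧
      (PMF.uniformOfFintype (Fin (m + 1))).map o = (p.learner e).sel t R ∧
      ∀ r, τ r ≤ pCost p.n p.T w + cCost p.n w + 100 * (w + 1) ∧
        p.Ready e w (t + 1) ((p.learner e).next R (o r)) (S r) ∧
        (S r).out = s.out ++ encode (o r).toList := by
  obtain ⟨dec, hdec⟩ := exists_walks (e := e) F hr t R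
  obtain ⟨s₁, t₁, r₁, ht₁, ⟨hs₁, h8, h9, h20⟩, ho⟩ := prepare_spec (F := F) hr ht hs (by omega)
  have hV := (p.learner e).V_pos t
  set tot := (p.data e t R).total with htot
  obtain ⟨m, hm⟩ : ∃ m, m + 1 = 2 * tot + 2 * (p.learner e).V t :=
    ⟨2 * tot + 2 * (p.learner e).V t - 1, by omega⟩
  have hval : ((reg (-9) - reg (-20) - lit 2).val s₁.mem).toNat = m := by
    simp only [val_sub, val_reg, val_lit, h9, h20]
    omega
  have hlt := hr.total_lt t R
  have hch : ∀ r : Fin (m + 1), ∃ s' t', choose.run F (s₁.write (-20) (r : ℕ)) =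
      PMF.pure (some (s', t')) ∧ t' ≤ cCost p.n w ∧
      p.Ready e w (t + 1) ((p.learner e).next R (p.pick e t R dec r)) s' ∧
      s'.out = s₁.out ++ encode (p.pick e t R dec r).toList := by
    intro r
    have hrlt : (r : ℕ) < 2 * ((p.learner e).V t + tot) := by have := r.2; omega
    have hB : Bdd w (s₁.write (-20) (r : ℕ)).mem := by
      refine hs₁.bdd.write ?_
      rw [abs_of_nonneg (by positivity)]
      have : ((r : ℕ) : ℤ) < 2 * ((p.learner e).V t + tot) := by exact_mod_cast hrlt
      have h0 : (0:ℤ) ≤ tot := by positivity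
      linarith
    have hS : Same (-20) s₁.mem (s₁.write (-20) (r : ℕ)).mem := fun j hj => by
      rw [write_mem, if_neg (by omega)]
    exact choose_spec hr ht hdec (hs₁.same hS (by norm_num) hB) (by rw [hS _ (by norm_num), h8])
      (by rw [write_mem, if_pos rfl]) hrlt (by omega)
  choose S τ h1 h2 h3 h4 using hch
  set dc := (lit (-20)).cost s₁.mem + (reg (-9) - reg (-20) - lit 2).cost s₁.mem with hdc
  have hdc' : dc ≤ 100 * (w + 1) := by
    have c1 := Expr.cost_le hr.w7 hs₁.bdd (lit (-20)) rfl
    have c2 := Expr.cost_le hr.w7 hs₁.bdd (reg (-9) - reg (-20) - lit 2) rfl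
    have e1 : (lit (-20)).nodes ^ 2 ≤ 1 := by decide
    have e2 : (reg (-9) - reg (-20) - lit 2).nodes ^ 2 ≤ 49 := by decide
    have := Nat.mul_le_mul_right (w + 1) e1
    have := Nat.mul_le_mul_right (w + 1) e2
    omega
  refine ⟨m, fun r => p.pick e t R dec r, S, fun r => t₁ + (dc + τ r), ?_,
    map_pick_eq_sel hdec hm, fun r => ⟨?_, h3 r, by rw [h4 r, ho]⟩⟩
  · have hdraw : draw.run F s₁ = (PMF.uniformOfFintype (Fin (m + 1))).map
        fun r : Fin (m + 1) => some (s₁.write (-20) (r : ℕ), dc) := run_rand hval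
    rw [learnRound, Prog.run, r₁, andThen_pure, Prog.run, hdraw, andThen_map]
    simp only [h1, PMF.pure_map, Outcome.delay, Option.map_some]
    exact (PMF.map_comp _ _ _).trans (PMF.bind_pure_comp _ _).symm |>.symm ▸ rfl
  · have := h2 r
    beta_reduce
    omega

/-- The remaining rounds have the law of the greedy selection process. -/
theorem rounds_computes {F w : ℕ} (hr : p.Room e w) (hF : pCost p.n p.T w + cCost p.n w ≤ F)
    (k : ℕ) : ∀ (f t : ℕ) (R : Finset ℕ) (s : State), t + k = p.T → k ≤ f → p.Ready e w t R s →
      Computes (whileRun (reg (-6) - reg (-7)) (learnRound.run F) f s)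
        (k * roundCost p.n p.T w + 100 * (w + 1))
        (((p.learner e).run k t R).map fun l => s.out ++ encode l) := by
  have hg : ∀ s : State, Bdd w s.mem → (reg (-6) - reg (-7)).cost s.mem ≤ 100 * (w + 1) :=
    fun s hs => (Expr.cost_le hr.w7 hs _ rfl).trans (Nat.mul_le_mul_right _ (by decide))
  induction k with
  | zero =>
    intro f t R s ht hf hs
    have hv : ¬ 0 < (reg (-6) - reg (-7)).val s.mem := by
      simp only [val_sub, val_reg, hs.T, hs.rd]; omega
    have h1 : whileRun (reg (-6) - reg (-7)) (learnRound.run F) f s =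
        PMF.pure (some (s, (reg (-6) - reg (-7)).cost s.mem)) := by
      cases f <;> simp only [whileRun, if_neg hv]
    rw [h1, Greedy.run, PMF.pure_map]
    have := Computes.pure (s := s) (hg s hs.bdd)
    simpa [encode] using this
  | succ k ih =>
    intro f t R s ht hf hs
    obtain ⟨f, rfl⟩ : ∃ f', f = f' + 1 := ⟨f - 1, by omega⟩
    have hv : 0 < (reg (-6) - reg (-7)).val s.mem := by
      simp only [val_sub, val_reg, hs.T, hs.rd]; omega
    obtain ⟨m, o, S, τ, h1, h2, h3⟩ := round_run hr (by omega) hs hF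
    rw [whileRun, if_pos hv, h1, andThen_map]
    have hstep : Computes ((PMF.uniformOfFintype (Fin (m + 1))).bind fun i =>
        (whileRun (reg (-6) - reg (-7)) (learnRound.run F) f (S i)).map (Outcome.delay (τ i)))
        (pCost p.n p.T w + cCost p.n w + 100 * (w + 1) +
          (k * roundCost p.n p.T w + 100 * (w + 1)))
        ((PMF.uniformOfFintype (Fin (m + 1))).bind fun i =>
          ((p.learner e).run k (t + 1) ((p.learner e).next R (o i))).map
            fun l => (S i).out ++ encode l) := by
      refine Computes.bind fun i => ?_
      obtain ⟨c1, c2, c3⟩ := h3 i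
      exact ((ih f (t + 1) _ (S i) (by omega) (by omega) c2).delay (τ i)).mono (by omega)
    have hlaw : ((PMF.uniformOfFintype (Fin (m + 1))).bind fun i =>
          ((p.learner e).run k (t + 1) ((p.learner e).next R (o i))).map
            fun l => (S i).out ++ encode l) =
        ((p.learner e).run (k + 1) t R).map fun l => s.out ++ encode l := by
      rw [Greedy.run, ← h2, PMF.bind_map, PMF.map_bind]
      congr 1
      funext i
      simp only [Function.comp]
      rw [PMF.map_comp]
      congr 1
      funext l
      simp only [Function.comp, (h3 i).2.2, encode_append, List.append_assoc]
    rw [← hlaw]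
    refine (hstep.delay _).mono ?_
    have := hg s hs.bdd
    rw [add_mul, one_mul]
    unfold roundCost
    omega

/-- The bound on the time of the learner. -/
def mainCost (n T w : ℕ) : ℕ := sCost w + T * roundCost n T w + 100 * (w + 1)

/-- The program outputs the law of the learner. -/
theorem main_computes {F w : ℕ} (hr : p.Room e w) {s : State} (hI : p.Input e w s)
    (hout : s.out = []) (hF : mainCost p.n p.T w ≤ F) :
    Computes (main.run F s) (mainCost p.n p.T w)
      (((p.learner e).run p.T 0 (Finset.range p.n)).map encode) := by
  have hT := p.T_pos
  have hc1 : p.T * 1 ≤ p.T * roundCost p.n p.T w :=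
    Nat.mul_le_mul_left _ (by unfold roundCost; omega)
  have hc2 : 1 * roundCost p.n p.T w ≤ p.T * roundCost p.n p.T w := Nat.mul_le_mul_right _ hT
  have hc3 : pCost p.n p.T w + cCost p.n w ≤ roundCost p.n p.T w := by unfold roundCost; omega
  unfold mainCost at hF ⊢
  obtain ⟨s₁, t₁, h1, h2, h3, h4⟩ := (setup_spec (F := F) hr hI).silent (by rfl) (by omega)
  have h5 := (rounds_computes (F := F) hr (by omega) p.T F 0 (Finset.range p.n) s₁ (by omega) (by omega)
    h3).delay t₁
  rw [h4, hout] at h5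
  simp only [List.nil_append] at h5
  rw [main, Prog.run, h1, andThen_pure, Prog.run]
  exact h5.mono (by omega)

end Params

/-! ### Numerical estimates -/

/-- The inequalities between the parameters that all estimates are derived from: `a` is `1 / α`, `l` its
logarithm, `E` is `1 / ε`, `g` is the logarithm of `1 / δ`, and `v` that of `y = d * k / β * l`. -/
structure Estimates (p : Params) (β a l E g y v : ℝ) : Prop where
  a2 : 2 ≤ a
  l_ge : 0.69 ≤ l
  E1 : 1 ≤ E
  g1 : 1 ≤ g
  y_ge : 1.38 ≤ y
  v_ge : 1 / 4 ≤ v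
  y_eq : Real.log y = v
  β0 : 0 < β
  y_def : y = p.d * p.k / β * l
  dβ : (p.d : ℝ) ≤ 1.5 * y
  ia : a ≤ p.ia
  ia' : (p.ia : ℝ) ≤ 1.5 * a
  ie' : (p.ie : ℝ) ≤ 2 * E
  J : (p.J : ℝ) ≤ 9 * l
  ld : (p.ld : ℝ) ≤ 5 * g
  n : 10 ^ 7 * (p.k * a * E * l * g * v) ≤ p.n

theorem two_pow_le_log {m : ℕ} {x : ℝ} (hx : 2 ≤ x) (h : (2:ℝ) ^ m ≤ x ^ 3) :
    (m : ℝ) ≤ 5 * Real.log x := by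
  have h1 := Real.log_le_log (by positivity) h
  rw [Real.log_pow, Real.log_pow] at h1
  have h2 := Real.log_two_gt_d9
  have h3 : 0 ≤ Real.log x := Real.log_nonneg (by linarith)
  push_cast at h1
  nlinarith

theorem two_pow_le_log' {m : ℕ} {x : ℝ} (hx : 2 ≤ x) (h : (2:ℝ) ^ m ≤ x ^ 3) :
    (m : ℝ) + 3 ≤ 9 * Real.log x := by
  have h1 := Real.log_le_log (by positivity) h
  rw [Real.log_pow, Real.log_pow] at h1
  have h2 := Real.log_two_gt_d9
  have h3 : Real.log 2 ≤ Real.log x := Real.log_le_log (by norm_num) hx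
  push_cast at h1
  nlinarith

theorem estimates {p : Params} {α β ε δ : ℝ} (hα : 0 < α) (hα' : α ≤ 1 / 2) (hβ : 0 < β) (hβ' : β < 1)
    (hdk : 2 * β ≤ (p.d : ℝ) * p.k) (hε : 0 < ε) (hε' : ε < 1) (hδ : 0 < δ)
    (hδ' : δ < Real.exp (-1)) (hia : p.ia = ⌈1 / α⌉₊) (hie : p.ie = ⌈1 / ε⌉₊)
    (hld : p.ld = Nat.size ⌈1 / δ⌉₊) (hC : 10 ^ 7 * sampleBound p.k p.d α β ε δ ≤ p.n) :
    Estimates p β (1 / α) (Real.log (1 / α)) (1 / ε) (Real.log (1 / δ))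
      (p.d * p.k / β * Real.log (1 / α)) (Real.log (p.d * p.k / β * Real.log (1 / α))) := by
  have hd : (1:ℝ) ≤ p.d := by exact_mod_cast p.d1
  have hk : (1:ℝ) ≤ p.k := by exact_mod_cast p.k1
  have ha2 : 2 ≤ 1 / α := by rw [le_div_iff₀ hα]; linarith
  have hE1 : 1 ≤ 1 / ε := by rw [le_div_iff₀ hε]; linarith
  have hl : 0.69 ≤ Real.log (1 / α) := by
    have h2 := Real.log_two_gt_d9
    have h3 : Real.log 2 ≤ Real.log (1 / α) := Real.log_le_log (by norm_num) ha2
    linarith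
  have he : 2 ≤ 1 / δ := by
    have h1 : Real.exp (-1) ≤ 1 / 2 := by
      rw [Real.exp_neg, ← one_div]
      have := Real.add_one_le_exp 1
      exact one_div_le_one_div_of_le (by norm_num) (by linarith)
    rw [le_div_iff₀ hδ]; linarith
  have hg : 1 ≤ Real.log (1 / δ) := by
    rw [Real.le_log_iff_exp_le (by positivity), le_div_iff₀ hδ]
    have : Real.exp 1 * Real.exp (-1) = 1 := by rw [← Real.exp_add]; norm_num
    nlinarith [Real.exp_pos 1]
  set l := Real.log (1 / α) with hl_def
  have hq : 2 ≤ p.d * p.k / β := by rw [le_div_iff₀ hβ]; linarith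
  have hy : 1.38 ≤ p.d * p.k / β * l := by nlinarith
  have hdq : (p.d : ℝ) ≤ p.d * p.k / β := by
    rw [le_div_iff₀ hβ]; nlinarith
  have size_le : ∀ {x : ℝ} {m : ℕ}, 2 ≤ x → m = ⌈x⌉₊ → (2:ℝ) ^ Nat.size m ≤ x ^ 3 := by
    intro x m hx hm
    have h1 : (m : ℝ) < x + 1 := hm ▸ Nat.ceil_lt_add_one (by linarith)
    have h2 : 1 ≤ m := by
      rw [hm]; exact Nat.one_le_ceil_iff.2 (by linarith)
    have h3 : ((2 ^ Nat.size m : ℕ) : ℝ) ≤ (2 * m : ℕ) := by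
      exact_mod_cast (Params.size_bounds m h2).2
    push_cast at h3
    nlinarith [sq_nonneg (x - 2)]
  refine ⟨ha2, hl, hE1, hg, hy, ?_, rfl, hβ, rfl, ?_, ?_, ?_, ?_, ?_, ?_, ?_⟩
  · have h1 := Real.one_sub_inv_le_log_of_pos (show 0 < p.d * p.k / β * l by linarith)
    have h2 : (p.d * p.k / β * l)⁻¹ ≤ (1.38)⁻¹ := inv_anti₀ (by norm_num) hy
    have h3 : ((1.38 : ℝ))⁻¹ ≤ 3 / 4 := by norm_num
    linarith
  · nlinarith
  · rw [hia]; exact Nat.le_ceil _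
  · rw [hia]
    have := Nat.ceil_lt_add_one (show 0 ≤ 1 / α by positivity)
    linarith
  · rw [hie]
    have := Nat.ceil_lt_add_one (show 0 ≤ 1 / ε by positivity)
    linarith
  · unfold Params.J
    push_cast
    exact two_pow_le_log' ha2 (size_le ha2 hia)
  · rw [hld]
    exact two_pow_le_log he (size_le he rfl)
  · refine le_trans (le_of_eq ?_) hC
    unfold sampleBound
    rw [← hl_def]
    field_simp

namespace Estimates
variable {p : Params} {α β ε δ a l E g y v : ℝ}

theorem k1 (_h : Estimates p β a l E g y v) : (1 : ℝ) ≤ p.k := by exact_mod_cast p.k1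

theorem d1 (_h : Estimates p β a l E g y v) : (1 : ℝ) ≤ p.d := by exact_mod_cast p.d1

theorem prod_ge (h : Estimates p β a l E g y v) : 0.69 * (p.k * a) ≤ p.k * a * l := by
  have h1 := h.l_ge
  have h2 : 0 ≤ p.k * a := mul_nonneg (by linarith [h.k1]) (by linarith [h.a2])
  nlinarith

theorem ka_ge (h : Estimates p β a l E g y v) : 2 ≤ p.k * a := by
  nlinarith [h.k1, h.a2]

theorem Eg_ge (h : Estimates p β a l E g y v) : 1 ≤ E * g := by
  nlinarith [h.E1, h.g1]

theorem Egv_ge (h : Estimates p β a l E g y v) : E * g / 4 ≤ E * g * v := by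
  nlinarith [h.Eg_ge, h.v_ge]

theorem n_ge (h : Estimates p β a l E g y v) : 10 ^ 7 * ((p.k * a * l) * (E * g * v)) ≤ p.n :=
  le_trans (le_of_eq (by ring)) h.n

theorem n_ge_Eg (h : Estimates p β a l E g y v) : 10 ^ 6 * (E * g) ≤ p.n := by
  have h1 := h.n_ge
  have h2 := h.prod_ge
  have h3 := h.ka_ge
  have h4 := h.Egv_ge
  have h5 := h.Eg_ge
  have h6 : 1 * (E * g * v) ≤ p.k * a * l * (E * g * v) :=
    mul_le_mul_of_nonneg_right (by linarith) (by linarith)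
  linarith

theorem n_ge_kal (h : Estimates p β a l E g y v) : 10 ^ 6 * (p.k * a * l) ≤ p.n := by
  have h1 := h.n_ge
  have h2 := h.prod_ge
  have h3 := h.ka_ge
  have h4 := h.Egv_ge
  have h5 := h.Eg_ge
  have h6 : p.k * a * l * (1 / 4) ≤ p.k * a * l * (E * g * v) :=
    mul_le_mul_of_nonneg_left (by linarith) (by linarith)
  linarith

theorem T_le (h : Estimates p β a l E g y v) : (p.T : ℝ) ≤ 18 * (p.k * l) := by
  unfold Params.T
  push_cast
  nlinarith [h.k1, h.J]

theorem T_le_n (h : Estimates p β a l E g y v) : p.T ≤ p.n := by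
  have h1 := h.T_le
  have h2 := h.n_ge_kal
  have h3 : p.k * l * 1 ≤ p.k * l * a :=
    mul_le_mul_of_nonneg_left (by linarith [h.a2]) (mul_nonneg (by linarith [h.k1]) (by linarith [h.l_ge]))
  have h4 : 0 ≤ p.k * a * l := by linarith [h.prod_ge, h.ka_ge]
  have h5 : (p.T : ℝ) ≤ p.n := by linarith [mul_right_comm (p.k : ℝ) a l]
  exact_mod_cast h5

theorem ia_le (h : Estimates p β a l E g y v) : 48 * p.k * p.ia ≤ p.n := by
  have h1 : (p.k : ℝ) * p.ia ≤ p.k * (1.5 * a) :=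
    mul_le_mul_of_nonneg_left h.ia' (by linarith [h.k1])
  have h2 := h.prod_ge
  have h3 := h.ka_ge
  have h4 := h.n_ge_kal
  have h5 : (48 * p.k * p.ia : ℝ) ≤ p.n := by linarith
  exact_mod_cast h5

theorem ie_le (h : Estimates p β a l E g y v) : p.ie ≤ p.n := by
  have h1 : E * 1 ≤ E * g := mul_le_mul_of_nonneg_left h.g1 (by linarith [h.E1])
  have h5 : (p.ie : ℝ) ≤ p.n := by linarith [h.ie', h.n_ge_Eg, h.E1]
  exact_mod_cast h5

theorem ld_le (h : Estimates p β a l E g y v) : p.ld ≤ p.n := by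
  have h1 : 1 * g ≤ E * g := mul_le_mul_of_nonneg_right h.E1 (by linarith [h.g1])
  have h5 : (p.ld : ℝ) ≤ p.n := by linarith [h.ld, h.n_ge_Eg, h.g1]
  exact_mod_cast h5

theorem v_le (h : Estimates p β a l E g y v) : v ≤ p.n := by
  have h2 : 1 * v ≤ E * g * v := mul_le_mul_of_nonneg_right h.Eg_ge (by linarith [h.v_ge])
  have h3 : 1 * (E * g * v) ≤ p.k * a * l * (E * g * v) :=
    mul_le_mul_of_nonneg_right (by linarith [h.prod_ge, h.ka_ge]) (by linarith [h.v_ge])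
  linarith [h.n_ge, h.v_ge]

theorem exp_v (h : Estimates p β a l E g y v) : Real.exp v = y := by
  rw [← h.y_eq, Real.exp_log (by linarith [h.y_ge])]

theorem kl_eq (h : Estimates p β a l E g y v) : p.d * (p.k * l) = y * β := by
  have := h.β0
  rw [h.y_def]
  field_simp

theorem inv_β_le (h : Estimates p β a l E g y v) : 1 / β ≤ 1.45 * y := by
  have h1 := h.kl_eq
  have h2 : 1 ≤ (p.d : ℝ) * p.k := one_le_mul_of_one_le_of_one_le h.d1 h.k1
  have h3 := h.l_ge
  rw [div_le_iff₀ h.β0]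
  nlinarith

theorem card_le : (p.cands.card : ℝ) + 1 ≤ 385 * (p.d : ℝ) ^ 7 := by
  have hd : (1:ℝ) ≤ p.d := by exact_mod_cast p.d1
  have h1 : (p.cands.card : ℝ) = ((p.cands.card : ℤ) : ℝ) := by push_cast; rfl
  rw [h1, p.card_cands]
  unfold Params.Bm Params.Am Params.M
  push_cast
  have h2 : (p.d + 1 : ℝ) * ((p.d + 1) * (p.d + 2)) ≤ 2 * p.d * ((2 * p.d) * (3 * p.d)) := by gcongr <;> linarith
  have h3 : (1:ℝ) ≤ (p.d:ℝ) ^ 7 := one_le_pow₀ hd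
  have h4 := mul_le_mul_of_nonneg_right h2 (show (0:ℝ) ≤ p.d ^ 4 by positivity)
  nlinarith

/-- The union bound over all rounds and candidates costs a factor of at most `exp (50 * v)`. -/
theorem union_le (h : Estimates p β a l E g y v) :
    2 * p.T * ((p.cands.card : ℝ) + 1) ≤ β * Real.exp (50 * v) := by
  have hd := h.d1
  have hk := h.k1
  have hl := h.l_ge
  have hy := h.y_ge
  have hβ := h.β0
  have e1 : Real.exp (50 * v) = y ^ 43 * y ^ 7 := by
    rw [← pow_add, ← h.exp_v, ← Real.exp_nat_mul]; norm_num
  have h6 : (p.d : ℝ) ^ 6 ≤ (1.5 * y) ^ 6 := pow_le_pow_left₀ (by linarith) h.dβ 6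
  have h43 : (157875:ℝ) ≤ y ^ 43 := le_trans (by norm_num) (pow_le_pow_left₀ (by norm_num) hy 43)
  calc 2 * p.T * ((p.cands.card : ℝ) + 1)
      ≤ 2 * (18 * (p.k * l)) * (385 * (p.d : ℝ) ^ 7) := by
        gcongr
        · exact h.T_le
        · exact card_le
    _ = 13860 * (p.d * (p.k * l)) * (p.d : ℝ) ^ 6 := by ring
    _ ≤ 13860 * (y * β) * (1.5 * y) ^ 6 := by
        rw [h.kl_eq]
        gcongr
    _ ≤ β * (157875 * y ^ 7) := by
        rw [mul_pow]
        have : 0 ≤ β * y ^ 7 := by positivity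
        norm_num
        nlinarith
    _ ≤ _ := by
        rw [e1]
        gcongr

theorem T_ge (p : Params) : (1 : ℝ) ≤ p.T := by
  have : 1 ≤ p.T := by
    have h1 := p.k1
    unfold Params.T Params.J
    exact Nat.mul_pos (by omega) (by omega)
  exact_mod_cast this

theorem gap_ge (h : Estimates p β a l E g y v) : 5000 * (E * g * v) ≤ p.gap := by
  have hT := h.T_le
  have h1 := h.n_ge
  have h2 := h.prod_ge
  have h3 := h.ka_ge
  have h4 := h.n_ge_kal
  have hk := h.k1
  have hl := h.l_ge
  have hTi : (p.T : ℝ) * p.ia ≤ 27 * (p.k * a * l) :=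
    (mul_le_mul hT h.ia' (by positivity) (by positivity)).trans (le_of_eq (by ring))
  have hT1 := T_ge p
  have hia : (1 : ℝ) ≤ p.ia := by linarith [h.ia, h.a2]
  have hD : 32 * p.T * p.ia ≤ p.n := by
    have : (32 * p.T * p.ia : ℝ) ≤ p.n := by linarith
    exact_mod_cast this
  have hD0 : 0 < 32 * p.T * p.ia := by
    have : (0:ℝ) < 32 * p.T * p.ia := by positivity
    exact_mod_cast this
  have g1 : 1 ≤ p.gap := (Nat.one_le_div_iff hD0).2 hD
  have g2 : p.n < p.gap * (32 * p.T * p.ia) + 32 * p.T * p.ia := Nat.lt_div_mul_add hD0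
  have g3 : p.n ≤ p.gap * (64 * p.T * p.ia) := by nlinarith
  have g4 : (p.n : ℝ) ≤ p.gap * (64 * p.T * p.ia) := by exact_mod_cast g3
  have g5 : (p.gap : ℝ) * (p.T * p.ia) ≤ p.gap * (27 * (p.k * a * l)) := by gcongr
  refine le_of_mul_le_mul_left (a := 1728 * (p.k * a * l)) ?_ (by linarith)
  have : 0 ≤ p.k * a * l * (E * g * v) := mul_nonneg (by linarith)
    (by linarith [h.Egv_ge, h.Eg_ge])
  linarith

theorem N_le (h : Estimates p β a l E g y v) : (p.N : ℝ) + 1 ≤ 37 * (E * g) := by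
  have h1 := h.ie'
  have h2 : (p.ld : ℝ) + 4 ≤ 9 * g := by linarith [h.ld, h.g1]
  have h3 : (p.ie : ℝ) * (p.ld + 4) ≤ 2 * E * (9 * g) :=
    mul_le_mul h1 h2 (by positivity) (by linarith [h.E1])
  unfold Params.N
  push_cast
  linarith [h.Eg_ge]

theorem N_pos (p : Params) : (0 : ℝ) < p.N := by
  have h1 : (1:ℝ) ≤ p.ie := by exact_mod_cast p.ie1
  unfold Params.N
  push_cast
  positivity

/-- The probability that some round fails. -/
theorem failure_le (h : Estimates p β a l E g y v) :
    p.T * ((p.cands.card + 1) * ((p.N + 1) / p.N : ℝ) ^ (-p.gap : ℤ)) ≤ β / 2 := by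
  have hN := N_pos p
  have hv := h.v_ge
  have hN1 := h.N_le
  have h1 : 1 / ((p.N : ℝ) + 1) ≤ Real.log ((p.N + 1) / p.N) := by
    have := Real.one_sub_inv_le_log_of_pos (show 0 < ((p.N : ℝ) + 1) / p.N by positivity)
    refine le_trans (le_of_eq ?_) this
    field_simp
    ring
  have h2 : 50 * v ≤ p.gap * (1 / ((p.N : ℝ) + 1)) := by
    rw [mul_one_div, le_div_iff₀ (by positivity)]
    have h3 : v * ((p.N : ℝ) + 1) ≤ v * (37 * (E * g)) := by gcongr
    have h4 := h.gap_ge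
    have h5 : 0 ≤ E * g * v := by linarith [h.Egv_ge, h.Eg_ge]
    linarith
  have h3 : ((p.N + 1) / p.N : ℝ) ^ (-p.gap : ℤ) ≤ Real.exp (-(50 * v)) := by
    have e1 : ((p.N + 1) / p.N : ℝ) = Real.exp (Real.log ((p.N + 1) / p.N)) :=
      (Real.exp_log (by positivity)).symm
    rw [e1, ← Real.rpow_intCast, ← Real.exp_mul, Real.exp_le_exp]
    push_cast
    have : (p.gap : ℝ) * (1 / ((p.N : ℝ) + 1)) ≤ p.gap * Real.log ((p.N + 1) / p.N) := by gcongr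
    linarith
  have h4 := h.union_le
  calc p.T * ((p.cands.card + 1) * ((p.N + 1) / p.N : ℝ) ^ (-p.gap : ℤ))
      ≤ p.T * ((p.cands.card + 1) * Real.exp (-(50 * v))) := by gcongr
    _ = 2 * p.T * (p.cands.card + 1) * Real.exp (-(50 * v)) / 2 := by ring
    _ ≤ β * Real.exp (50 * v) * Real.exp (-(50 * v)) / 2 := by gcongr
    _ = β / 2 := by rw [mul_assoc, ← Real.exp_add]; simp

/-- The probability that some hypothesis of large error has a small empirical error. -/
theorem generalization_le (h : Estimates p β a l E g y v) (hα : 0 < α) (ha : a = 1 / α) (hβ : β < 1) :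
    (p.cands.card + 1 : ℝ) ^ p.T * Real.exp (-(α * p.n / 4)) ≤ β / 2 := by
  have hβ0 := h.β0
  have hT := T_ge p
  have hv := h.v_ge
  have hk := h.k1
  have hl := h.l_ge
  have hK : (1:ℝ) ≤ p.cands.card + 1 := by linarith [(Nat.cast_nonneg p.cands.card : (0:ℝ) ≤ _)]
  have hu := h.union_le
  have h1 : (p.cands.card + 1 : ℝ) ≤ Real.exp (50 * v) := by
    have := Real.exp_pos (50 * v)
    nlinarith
  have h2 : 2 ≤ β * Real.exp (50 * v) := by nlinarith
  have hn : 1000 * (p.k * l * v) ≤ α * p.n / 4 := by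
    have h3 := h.n_ge
    have h4 : p.k * a * l * (v * 1) ≤ p.k * a * l * (v * (E * g)) := by
      have := h.Eg_ge
      have := h.prod_ge
      have := h.ka_ge
      gcongr
    have h5 : α * (10 ^ 7 * (p.k * a * l * v)) ≤ α * p.n :=
      mul_le_mul_of_nonneg_left (by linarith) hα.le
    have h6 : α * (10 ^ 7 * (p.k * a * l * v)) = 10 ^ 7 * (p.k * l * v) := by
      rw [ha]; field_simp
    have : 0 ≤ p.k * l * v := by positivity
    linarith
  have h3 : (p.T + 1 : ℝ) * (50 * v) ≤ α * p.n / 4 := by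
    have : (p.T + 1 : ℝ) ≤ 20 * (p.k * l) := by nlinarith [h.T_le]
    nlinarith
  calc (p.cands.card + 1 : ℝ) ^ p.T * Real.exp (-(α * p.n / 4))
      ≤ Real.exp (50 * v) ^ p.T * Real.exp (-(α * p.n / 4)) := by gcongr
    _ ≤ (β * Real.exp (50 * v) / 2) * (Real.exp (50 * v) ^ p.T * Real.exp (-(α * p.n / 4))) :=
        le_mul_of_one_le_left (by positivity) (by linarith)
    _ = β / 2 * Real.exp ((p.T + 1) * (50 * v) - α * p.n / 4) := by
        rw [← Real.exp_nat_mul, sub_eq_add_neg, Real.exp_add, add_mul, Real.exp_add]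
        ring_nf
    _ ≤ β / 2 * 1 := by
        gcongr
        exact Real.exp_le_one_iff.2 (by linarith)
    _ = β / 2 := mul_one _

/-- The input `⌈1 / β⌉` has only polynomially many bits. -/
theorem ceil_β_le (h : Estimates p β a l E g y v) : ⌈1 / β⌉₊ < 4 ^ (p.n + 1) := by
  have h1 := h.inv_β_le
  have h2 := Nat.ceil_lt_add_one (show 0 ≤ 1 / β from one_div_nonneg.2 h.β0.le)
  have h3 : y ≤ 4 ^ p.n := by
    rw [← h.exp_v]
    calc Real.exp v ≤ Real.exp (p.n * 1) := Real.exp_le_exp.2 (by linarith [h.v_le])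
      _ = Real.exp 1 ^ p.n := Real.exp_nat_mul _ _
      _ ≤ 4 ^ p.n := pow_le_pow_left₀ (Real.exp_pos _).le (by linarith [Real.exp_one_lt_d9]) _
  have h4 : (1:ℝ) ≤ 4 ^ p.n := one_le_pow₀ (by norm_num)
  have h5 : (⌈1 / β⌉₊ : ℝ) < 4 ^ (p.n + 1) := by rw [pow_succ]; linarith
  exact_mod_cast h5

end Estimates

theorem Params.privacy_le {p : Params} {ε δ : ℝ} (hε : 0 < ε) (hδ : 0 < δ) (hie : p.ie = ⌈1 / ε⌉₊)
    (hld : p.ld = Nat.size ⌈1 / δ⌉₊) : 2 * (Real.log (3 / δ) + 2) / p.N ≤ ε := by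
  have h1 : 1 / δ ≤ 2 ^ p.ld := by
    have h2 : (⌈1 / δ⌉₊ : ℝ) < 2 ^ p.ld := by
      rw [hld]; exact_mod_cast Nat.lt_size_self _
    exact (Nat.le_ceil _).trans h2.le
  have h2 : Real.log (3 / δ) + 2 ≤ p.ld + 4 := by
    have h3 : 3 / δ ≤ 3 * 2 ^ p.ld := by rw [div_eq_mul_one_div]; gcongr
    have h4 := Real.log_le_log (by positivity) h3
    rw [Real.log_mul (by norm_num) (by positivity), Real.log_pow] at h4
    have h5 : Real.log 3 ≤ 2 := by
      have := Real.log_le_sub_one_of_pos (show (0:ℝ) < 3 by norm_num)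
      linarith
    have h6 : p.ld * Real.log 2 ≤ p.ld * 1 := by
      gcongr
      linarith [Real.log_two_lt_d9]
    linarith
  have h3 : 1 / ε ≤ p.ie := by rw [hie]; exact Nat.le_ceil _
  have h4 : 1 ≤ ε * p.ie := by rwa [div_le_iff₀' hε] at h3
  rw [div_le_iff₀ (Estimates.N_pos p)]
  unfold Params.N
  push_cast
  have : (1:ℝ) * (p.ld + 4) ≤ ε * p.ie * (p.ld + 4) := by gcongr
  linarith

/-! ### The input -/

theorem abs_getD_lt {l : List ℤ} {B : ℤ} (hB : 0 < B) (h : ∀ x ∈ l, |x| < B) (i : ℕ) :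
    |l.getD i 0| < B := by
  rw [List.getD_eq_getElem?_getD]
  rcases hx : l[i]? with _ | x
  · simpa using hB
  · exact h x (List.mem_of_getElem? hx)

theorem getD_flatMap {α : Type*} {g : α → List ℤ} {c : ℕ} (hg : ∀ x, (g x).length = c) {r : ℕ} (hr : r < c)
    {l : List α} {i : ℕ} (hi : i < l.length) :
    (l.flatMap g).getD (c * i + r) 0 = (g l[i]).getD r 0 := by
  induction l generalizing i with
  | nil => simp at hi
  | cons x l ih =>
    rw [List.flatMap_cons]
    rcases i with _ | i
    · rw [mul_zero, zero_add, List.getD_append _ _ _ _ (by rw [hg]; exact hr)]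
      rfl
    · have hlen : (g x).length ≤ c * (i + 1) + r := by rw [hg]; nlinarith
      rw [List.getD_append_right _ _ _ _ hlen, hg,
        show c * (i + 1) + r - c = c * i + r by rw [mul_add]; omega]
      exact ih (by simpa using hi)

theorem init_mem {l : List ℤ} (j : ℕ) : (RAM.State.init l).mem j = l.getD j 0 := by
  simp [RAM.State.init]

section Input
variable {n d k : ℕ} {α β ε δ : ℝ} {S : Fin n → Grid d × Bool}

theorem init_param (j : ℕ) (hj : j < 7) :
    (RAM.State.init (learnerInput k α β ε δ S)).mem j =
      [(n : ℤ), (d : ℤ), (k : ℤ), ⌈1 / α⌉, ⌈1 / β⌉, ⌈1 / ε⌉, ⌈1 / δ⌉].getD j 0 := by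
  rw [init_mem, learnerInput, List.getD_append _ _ _ _ (by simpa using hj)]

theorem init_example (i : Fin n) (r : ℕ) (hr : r < 3) :
    (RAM.State.init (learnerInput k α β ε δ S)).mem ((7 + (3 * (i : ℕ) + r) : ℕ) : ℤ) =
      [(((S i).1.1 : ℕ) : ℤ), (((S i).1.2 : ℕ) : ℤ), if (S i).2 then 1 else 0].getD r 0 := by
  rw [init_mem, learnerInput, List.getD_append_right _ _ _ _ (by simp)]
  simp only [List.length_cons, List.length_nil, zero_add, Nat.reduceAdd, add_tsub_cancel_left]
  rw [getD_flatMap (c := 3) (fun _ => rfl) hr (by simp)]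
  simp

/-- All numbers in the input are smaller than any `B` that exceeds the parameters. -/
theorem abs_learnerInput_lt {B : ℤ} (hn : (n : ℤ) < B) (hd : (d : ℤ) < B) (hk : (k : ℤ) < B)
    (ha : |⌈1 / α⌉| < B) (hb : |⌈1 / β⌉| < B) (he : |⌈1 / ε⌉| < B) (hδ : |⌈1 / δ⌉| < B) (hB : 1 < B) :
    ∀ x ∈ learnerInput k α β ε δ S, |x| < B := by
  intro x hx
  simp only [learnerInput, List.mem_append, List.mem_cons, List.not_mem_nil, or_false,
    List.mem_flatMap] at hx
  rcases hx with (rfl | rfl | rfl | rfl | rfl | rfl | rfl) | ⟨q, -, rfl | rfl | rfl⟩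
  · simpa using hn
  · simpa using hd
  · simpa using hk
  · exact ha
  · exact hb
  · exact he
  · exact hδ
  · have := q.1.1.2
    rw [Nat.abs_cast]; omega
  · have := q.1.2.2
    rw [Nat.abs_cast]; omega
  · split_ifs
    · simpa using hB
    · simpa using hB.trans' one_pos

end Input

/-! ### Polynomial time -/

/-- The functions that are given by a polynomial. -/
def IsPoly (f : ℕ → ℕ) : Prop := ∃ q : Polynomial ℕ, ∀ m, q.eval m = f m

theorem IsPoly.const (c : ℕ) : IsPoly fun _ => c := ⟨Polynomial.C c, fun m => by simp⟩

theorem IsPoly.id : IsPoly fun m => m := ⟨Polynomial.X, fun m => by simp⟩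

theorem IsPoly.add {f g : ℕ → ℕ} (hf : IsPoly f) (hg : IsPoly g) : IsPoly fun m => f m + g m := by
  obtain ⟨p, hp⟩ := hf
  obtain ⟨q, hq⟩ := hg
  exact ⟨p + q, fun m => by simp [hp, hq]⟩

theorem IsPoly.mul {f g : ℕ → ℕ} (hf : IsPoly f) (hg : IsPoly g) : IsPoly fun m => f m * g m := by
  obtain ⟨p, hp⟩ := hf
  obtain ⟨q, hq⟩ := hg
  exact ⟨p * q, fun m => by simp [hp, hq]⟩

namespace Params
open RAM RAM.Data

/-- A word length that suffices for inputs of size `m`. -/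
def width (m : ℕ) : ℕ := 10 * ((m + 1) * (m + 1))

theorem mainCost_poly : IsPoly fun m => mainCost m m (width m) := by
  unfold mainCost sCost roundCost pCost cCost wCost aTotal aCost bCost width
  repeat' first
    | with_reducible exact IsPoly.const _
    | with_reducible exact IsPoly.id
    | with_reducible refine IsPoly.mul ?_ ?_
    | with_reducible refine IsPoly.add ?_ ?_

theorem mainCost_mono {n n' T T' w : ℕ} (hn : n ≤ n') (hT : T ≤ T') :
    mainCost n T w ≤ mainCost n' T' w := by
  unfold mainCost roundCost pCost cCost wCost aTotal aCost bCost
  gcongr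

/-- The numbers that occur in the computation have at most `width m` bits, where `m` is the size of the
input. -/
theorem room {p : Params} {m : ℕ} (hn : p.n ≤ m) (hd : p.d < 2 ^ m) (hT : p.T ≤ p.n) (hia : p.ia ≤ p.n)
    (hie : p.ie ≤ p.n) (hld : p.ld ≤ p.n) (S : Fin p.n → Grid p.d × Bool) :
    p.Room (examples S) (width m) := by
  have hn1 := p.n1
  have hnm : p.n ≤ 2 ^ m := hn.trans Nat.lt_two_pow_self.le
  have hpow : ∀ c, c ≤ width m → (2:ℤ) ^ c ≤ 2 ^ width m := fun c hc =>
    pow_le_pow_right₀ (by norm_num) hc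
  refine ⟨by unfold width; nlinarith, ?_, ?_, ?_, ?_, ?_⟩
  · refine lt_of_lt_of_le ?_ (hpow (m + m + 1) (by unfold width; nlinarith))
    have h1 : p.n * p.n ≤ 2 ^ m * 2 ^ m := Nat.mul_le_mul hnm hnm
    have h2 : p.n * p.n < 2 ^ (m + m + 1) := by
      rw [pow_succ, pow_add]; have : 0 < 2 ^ m * 2 ^ m := by positivity
      omega
    exact_mod_cast h2
  · refine lt_of_lt_of_le ?_ (Nat.pow_le_pow_right two_pos
      (show m + m + 5 ≤ width m by unfold width; nlinarith))
    have h1 : p.T * p.ia ≤ 2 ^ m * 2 ^ m := Nat.mul_le_mul (hT.trans hnm) (hia.trans hnm)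
    have h2 : 16 * p.T * p.ia < 2 ^ (m + m + 5) := by
      rw [pow_add, pow_add, mul_assoc]; have : 0 < 2 ^ m * 2 ^ m := by positivity
      omega
    exact h2
  · refine lt_of_lt_of_le ?_ (hpow (7 * m + 9 + (4 * m + 8) * m + 1) (by unfold width; nlinarith))
    have hd' : (p.d : ℤ) + 1 ≤ 2 ^ m := by exact_mod_cast hd
    have hm0 : (1:ℤ) ≤ 2 ^ m := one_le_pow₀ (by norm_num)
    have hM : p.M ≤ 2 * (2 ^ m * 2 ^ m) := by
      unfold M; nlinarith
    have hM0 := p.M_pos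
    have hA : p.Am ≤ 2 ^ m * (2 * (2 ^ m * 2 ^ m)) := by
      unfold Am; gcongr
    have hA0 := p.Am_pos
    have hB : p.Bm ≤ (2 * 2 ^ m) * (2 ^ m * (2 * (2 ^ m * 2 ^ m))) := by
      unfold Bm; gcongr; linarith
    have hB0 : 0 ≤ p.Bm := by unfold Bm; positivity
    have hN : (p.N : ℤ) + 1 ≤ 2 ^ (2 * m + 4) := by
      have h1 : p.ie * (p.ld + 4) ≤ 2 ^ m * (5 * 2 ^ m) := by
        have : 1 ≤ 2 ^ m := Nat.one_le_two_pow
        gcongr <;> omega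
      have h2 : p.N + 1 ≤ 2 ^ (2 * m + 4) := by
        unfold N
        rw [pow_add, two_mul m, pow_add, mul_assoc]
        have : 0 < 2 ^ m * 2 ^ m := by positivity
        have h3 : 2 ^ m * (5 * 2 ^ m) = 5 * (2 ^ m * 2 ^ m) := by ring
        omega
      exact_mod_cast h2
    have hNN : ((p.N : ℤ) + 1) * (p.N + 1) ≤ 2 ^ (4 * m + 8) :=
      (mul_le_mul hN hN (by positivity) (by positivity)).trans (le_of_eq (by rw [← pow_add]; congr 1; ring))
    have hNp : (((p.N : ℤ) + 1) * (p.N + 1)) ^ p.n ≤ 2 ^ ((4 * m + 8) * m) := by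
      rw [pow_mul]
      exact (pow_le_pow_left₀ (by positivity) hNN _).trans
        (pow_le_pow_right₀ (one_le_pow₀ (by norm_num)) hn)
    calc 64 * p.Am * p.Bm * (((p.N : ℤ) + 1) * (p.N + 1)) ^ p.n
        ≤ 64 * (2 ^ m * (2 * (2 ^ m * 2 ^ m))) * ((2 * 2 ^ m) * (2 ^ m * (2 * (2 ^ m * 2 ^ m)))) *
          2 ^ ((4 * m + 8) * m) := by gcongr
      _ = 2 ^ (7 * m + 9 + (4 * m + 8) * m) := by
          rw [pow_add, pow_add _ (7 * m) 9, show 7 * m = m + m + m + m + m + m + m by ring]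
          simp only [pow_add _ _ m]
          ring
      _ < _ := by
          rw [pow_succ _ (7 * m + 9 + (4 * m + 8) * m)]
          have : (0:ℤ) < 2 ^ (7 * m + 9 + (4 * m + 8) * m) := by positivity
          linarith
  all_goals
    intro i
    simp only [examples]
    split_ifs
    · refine ⟨Int.natCast_nonneg _, ?_⟩
      exact_mod_cast Nat.lt_succ_iff.1 (Fin.is_lt _)
    · exact ⟨le_rfl, Int.natCast_nonneg _⟩

end Params

theorem sampleBound_pos {k d : ℕ} {α β ε δ : ℝ} (hk : 1 ≤ k) (hα : 0 < α) (hα' : α ≤ 1 / 2) (hβ : 0 < β)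
    (hdk : 2 * β ≤ (d : ℝ) * k) (hε : 0 < ε) (hδ : 0 < δ) (hδ' : δ < Real.exp (-1)) :
    0 < sampleBound k d α β ε δ := by
  have hl : 0.69 ≤ Real.log (1 / α) := by
    have h2 := Real.log_two_gt_d9
    have h3 : Real.log 2 ≤ Real.log (1 / α) :=
      Real.log_le_log (by norm_num) (by rw [le_div_iff₀ hα]; linarith)
    linarith
  have hq : 2 ≤ d * k / β := by rw [le_div_iff₀ hβ]; linarith
  have hg : 0 < Real.log (1 / δ) := by
    apply Real.log_pos
    rw [lt_div_iff₀ hδ, one_mul]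
    exact hδ'.trans (by simp)
  have hv : 0 < Real.log (d * k / β * Real.log (1 / α)) := Real.log_pos (by nlinarith)
  have hk' : (0:ℝ) < k := by exact_mod_cast hk
  unfold sampleBound
  have : 0 < Real.log (1 / α) := by linarith
  positivity

namespace Params
open RAM

theorem input {p : Params} {α β ε δ : ℝ} {m : ℕ} (hα : 0 < α) (hβ : 0 < β) (hε : 0 < ε) (hδ : 0 < δ)
    (hn : p.n ≤ m) (hd : p.d < 2 ^ m) (hk : p.k ≤ p.n) (hia : p.ia = ⌈1 / α⌉₊) (hie : p.ie = ⌈1 / ε⌉₊)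
    (hld : p.ld = Nat.size ⌈1 / δ⌉₊) (hian : p.ia ≤ p.n) (hien : p.ie ≤ p.n) (hldn : p.ld ≤ p.n)
    (hβn : ⌈1 / β⌉₊ < 4 ^ (p.n + 1)) (S : Fin p.n → Grid p.d × Bool) :
    p.Input (examples S) (width m) (State.init (learnerInput p.k α β ε δ S)) := by
  have ea : ⌈1 / α⌉ = (p.ia : ℤ) := by rw [hia, Int.natCast_ceil_eq_ceil (by positivity)]
  have ee : ⌈1 / ε⌉ = (p.ie : ℤ) := by rw [hie, Int.natCast_ceil_eq_ceil (by positivity)]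
  have eb : ⌈1 / β⌉ = ((⌈1 / β⌉₊ : ℕ) : ℤ) := by rw [Int.natCast_ceil_eq_ceil (by positivity)]
  have ed : ⌈1 / δ⌉ = ((⌈1 / δ⌉₊ : ℕ) : ℤ) := by rw [Int.natCast_ceil_eq_ceil (by positivity)]
  have hpow : ∀ {c x : ℕ}, x < 2 ^ c → c ≤ width m → (x : ℤ) < 2 ^ width m := fun hx hc => by
    exact_mod_cast hx.trans_le (Nat.pow_le_pow_right two_pos hc)
  have hm : m ≤ width m := by unfold width; nlinarith
  have hlt : ∀ {x : ℕ}, x ≤ p.n → (x : ℤ) < 2 ^ width m := fun hx =>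
    hpow ((hx.trans hn).trans_lt Nat.lt_two_pow_self) hm
  have hδm : ⌈1 / δ⌉₊ < 2 ^ m := (Nat.lt_size_self _).trans_le
    (Nat.pow_le_pow_right two_pos (hld ▸ hldn.trans hn))
  have hβm : ⌈1 / β⌉₊ < 2 ^ (2 * (m + 1)) := by
    rw [pow_mul]
    exact hβn.trans_le (Nat.pow_le_pow_right (by norm_num) (by omega))
  refine ⟨fun j => ?_, ?_, ?_, ?_, ?_, ?_, ?_, ?_, ?_, ?_⟩
  · simp only [State.init]
    split_ifs
    · refine abs_getD_lt (by positivity) (abs_learnerInput_lt (hlt le_rfl) (hpow hd hm) (hlt hk) ?_ ?_ ?_ ?_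
        ?_) _
      · rw [ea, Nat.abs_cast]; exact hlt hian
      · rw [eb, Nat.abs_cast]; exact hpow hβm (by unfold width; nlinarith)
      · rw [ee, Nat.abs_cast]; exact hlt hien
      · rw [ed, Nat.abs_cast]; exact hpow hδm hm
      · exact hlt p.n1
    · simp
  · exact init_param 0 (by norm_num)
  · exact init_param 1 (by norm_num)
  · exact init_param 2 (by norm_num)
  · exact (init_param 3 (by norm_num)).trans ea
  · exact (init_param 5 (by norm_num)).trans ee
  · exact ⟨_, (init_param 6 (by norm_num)).trans ed, hld⟩
  · intro i hi
    have := init_example (k := p.k) (α := α) (β := β) (ε := ε) (δ := δ) (S := S) ⟨i, hi⟩ 0 (by norm_num)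
    simpa [examples, hi] using this
  · intro i hi
    have := init_example (k := p.k) (α := α) (β := β) (ε := ε) (δ := δ) (S := S) ⟨i, hi⟩ 1 (by norm_num)
    rw [show (8 + 3 * (i : ℤ)) = ((7 + (3 * i + 1) : ℕ) : ℤ) by push_cast; ring, this]
    simp [examples, hi]
  · intro i hi
    have := init_example (k := p.k) (α := α) (β := β) (ε := ε) (δ := δ) (S := S) ⟨i, hi⟩ 2 (by norm_num)
    rw [show (9 + 3 * (i : ℤ)) = ((7 + (3 * i + 2) : ℕ) : ℤ) by push_cast; ring, this]
    simp [examples, hi]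

end Params

end PrivateLearning

theorem mainTheorem2 :
    ∃ (C : ℝ) (P : RAM.Prog) (poly : Polynomial ℕ), 0 < C ∧
      ∀ (k d n : ℕ) (α β ε δ : ℝ), 1 ≤ k → 1 ≤ d →
        0 < α → α ≤ 1 / 2 → 0 < β → β < 1 → 2 * β ≤ (d : ℝ) * k →
        0 < ε → ε < 1 → 0 < δ → δ < Real.exp (-1) →
        C * PrivateLearning.sampleBound k d α β ε δ ≤ n →
        ∃ A : (Fin n → PrivateLearning.Grid d × Bool) → PMF (List ℤ),
          (∀ S, P.OutputsWithin (PrivateLearning.learnerInput k α β ε δ S)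
            (poly.eval (n + Nat.log 2 d)) (A S)) ∧
          PrivateLearning.IsDP A ε δ ∧
          PrivateLearning.IsPACLearner A PrivateLearning.gridHypothesis
            (PrivateLearning.gridConvexGons k d) α β := by
  open PrivateLearning PrivateLearning.Params in
  obtain ⟨q, hq⟩ := mainCost_poly
  refine ⟨10 ^ 7, RAM.main, q, by norm_num, ?_⟩
  intro k d n α β ε δ hk hd hα hα' hβ hβ' hdk hε hε' hδ hδ' hC
  have hn1 : 1 ≤ n := by
    have h1 := sampleBound_pos hk hα hα' hβ hdk hε hδ hδ'
    have h2 : (0:ℝ) < n := lt_of_lt_of_le (by positivity) hC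
    exact_mod_cast h2
  let p : Params := ⟨n, d, k, ⌈1 / α⌉₊, ⌈1 / ε⌉₊, Nat.size ⌈1 / δ⌉₊, hn1, hd, hk,
    Nat.one_le_ceil_iff.2 (by positivity), Nat.one_le_ceil_iff.2 (by positivity)⟩
  have h := estimates (p := p) hα hα' hβ hβ' hdk hε hε' hδ hδ' rfl rfl rfl hC
  have hia := h.ia_le
  have hian : p.ia ≤ p.n := by nlinarith [p.k1, p.ia1]
  have hkn : p.k ≤ p.n := by nlinarith [p.k1, p.ia1]
  have hdm : p.d < 2 ^ (n + Nat.log 2 d) :=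
    (Nat.lt_pow_succ_log_self one_lt_two d).trans_le (Nat.pow_le_pow_right two_pos (by omega))
  have hnm : p.n ≤ n + Nat.log 2 d := Nat.le_add_right n _
  refine ⟨p.algorithm, fun S => ?_, algorithm_private hδ hε' (privacy_le hε hδ rfl rfl),
    algorithm_learns hα hβ h.ia hia h.failure_le (h.generalization_le hα rfl hβ')⟩
  have hcost : mainCost p.n p.T (width (n + Nat.log 2 d)) ≤ q.eval (n + Nat.log 2 d) := by
    rw [hq]
    exact mainCost_mono hnm (h.T_le_n.trans hnm)
  have hrun := (main_computes (room hnm hdm h.T_le_n hian h.ie_le h.ld_le S)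
    (input hα hβ hε hδ hnm hdm hkn rfl rfl rfl hian h.ie_le h.ld_le h.ceil_β_le S) rfl
    hcost).mono hcost
  exact ⟨hrun.1, hrun.2.symm⟩
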